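/- **Setting.** Let $M>0$. A *static solution of the (spherically symmetric, asymptotically flat) Einstein–Vlasov system with Schwarzschild singularity of mass $M$* consists of a non-negative spherically symmetric $f(x,v)$, compactly supported in $\{x\in\mathbb R^3: r=|x|>2M\}\times\mathbb R^3$, and metric coefficients $\mu\in C^2$, $\lambda\in C^1$ on $]2M,\infty[$ such that $f$ is constant along the characteristics of $$\frac{e^{\mu-\lambda}v}{\sqrt{1+|v|^2}}\cdot\partial_xf-e^{\mu-\lambda}\mu'\sqrt{1+|v|^2}\,\frac xr\cdot\partial_vf=0$$ in $\{r>2M\}$, and such that for $r>2M$ $$e^{-2\lambda}(2r\lambda'-1)+1=8\pi r^2\rho_f,\quad e^{-2\lambda}(2r\mu'+1)-1=8\pi r^2p_f,\quad 0=-4\pi re^{\lambda+\mu}j_f,$$ $$e^{-2\lambda}\Big(\mu''+(\mu'-\lambda')\big(\mu'+\tfrac1r\big)\Big)=8\pi q_f,\qquad M+4\pi\int_{2M}^r\rho_f(s)s^2ds<\frac r2,$$ with $\lim_{r\to\infty}\mu=\lim_{r\to\infty}\lambda=0$ and $\lim_{r\to2M}e^{-2\lambda}=0$, where $$\rho_f=\int\sqrt{1+|v|^2}f\,dv,\quad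 p_f=\int\Big(\frac{x\cdot v}r\Big)^2\frac{f\,dv}{\sqrt{1+|v|^2}},\quad j_f=\int\frac{x\cdot v}rf\,dv,\quad q_f=\frac12\int\Big|\frac{x\times v}r\Big|^2\frac{f\,dv}{\sqrt{1+|v|^2}}.$$ **Parameters.** For $L\ge0$, $r>2M$ let $\Psi_L^0(r)=\sqrt{1-\frac{2M}r}\sqrt{1+\frac L{r^2}}$. Let $L_0>12M^2$ and let $s^0_{L_0}$ and $r^0_{L_0}$ be the smallest and the largest zero of $(\Psi^0_{L_0})'$ in $]2M,\infty[$. Fix $E^0$ with $\Psi^0_{L_0}(r^0_{L_0})<E^0<\min\{1,\Psi^0_{L_0}(s^0_{L_0})\}$, and let $R^0_{\min}$ and $R^0_{\max}$ be the smallest and the largest $r>s^0_{L_0}$ with $\Psi^0_{L_0}(r)=E^0$. Put $r_0=s^0_{L_0}$ and let $\eta_0>0$ with $r_0+\eta_0<R^0_{\min}$. Let $\chi\in C^\infty(\mathbb R)$, $\chi\ge0$, $\chi(s)=0$ for $s\le0$ and $\chi(s)=1$ for $s\ge\eta_0$. Let $l>-\frac12$ and let $\Phi:\mathbb R\to[0,\infty[$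 be in $L^\infty_{\mathrm{loc}}(\mathbb R)$ with $\Phi=0$ on $]-\infty,0]$ and $\Phi>0$ on some interval $]0,\alpha_0[$, $\alpha_0>0$. With $c_l=\int_0^1\frac{s^l}{\sqrt{1-s}}ds$, $d_l=\int_0^1s^l\sqrt{1-s}\,ds$ set $$G(r,y)=2\pi c_lr^{2l}e^{3y}\int_0^{1-e^{-y}\sqrt{1+L_0/r^2}}\Phi(\alpha)(1-\alpha)^2\Big(e^{2y}(1-\alpha)^2-1-\frac{L_0}{r^2}\Big)^{l+\frac12}d\alpha,$$ $$H(r,y)=2\pi d_lr^{2l}e^{y}\int_0^{1-e^{-y}\sqrt{1+L_0/r^2}}\Phi(\alpha)\Big(e^{2y}(1-\alpha)^2-1-\frac{L_0}{r^2}\Big)^{l+\frac32}d\alpha$$ if $e^{-y}\sqrt{1+L_0/r^2}<1$, and $G(r,y)=H(r,y)=0$ otherwise. For $\delta\ge0$ and a function $y$ on $]2M,\infty[$ put $\rho(r)=\delta\chi(r-r_0)G(r,y(r))$, $p(r)=\delta\chi(r-r_0)H(r,y(r))$, $m(r)=4\pi\int_{2M}^rs^2\rho(s)ds$. The *reduced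 equation* for $y\in C^1(]2M,\infty[)$ is $$y'(r)=-\frac1{1-\frac2r(M+m(r))}\Big(\frac{M+m(r)}{r^2}+4\pi rp(r)\Big)\quad(r>2M),\qquad y(4M)=\ln(\sqrt2E^0),$$ where it is understood that the denominator $1-\frac2r(M+m(r))$ does not vanish. **Statement.** The function $(\Psi^0_{L_0})'$ has exactly the two zeros $s^0_{L_0}$ and $r^0_{L_0}$ in $]2M,\infty[$; $R^0_{\min}$ and $R^0_{\max}$ are the only $r>s^0_{L_0}$ with $\Psi^0_{L_0}(r)=E^0$; and $2M<s^0_{L_0}<R^0_{\min}<r^0_{L_0}<R^0_{\max}$, $R^0_{\min}>4M$. Moreover, for every $\delta\ge0$ the following holds. 1. The reduced equation has a solution $y^\delta\in C^1(]2M,\infty[)$. It is the only solution whose density $\rho$ vanishes on $]2M,4M]$; if $L_0\le16M^2$, it is the only solution. 2. Let $\rho^\delta,p^\delta,m^\delta$ be the functions $\rho,p,m$ belonging to $y^\delta$, and let $y^0(r)=\ln E^0-\frac12\ln(1-\frac{2M}r)$. Then $2(M+m^\delta(r))<r$ and $y^\delta(r)\le y^0(r)$ for $r>2M$, with $y^\delta=y^0$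 on $]2M,R^0_{\min}]$. If $\delta>0$, neither $\rho^\delta$ nor $p^\delta$ vanishes identically. Furthermore $\rho^\delta=p^\delta=0$ on $]2M,R^0_{\min}]\cup[R^0_{\max},\infty[$. 3. The limit $y^\delta_\infty=\lim_{r\to\infty}y^\delta(r)\in]-\infty,0[$ exists, the total Vlasov mass $M^\delta=\lim_{r\to\infty}m^\delta(r)=4\pi\int_{R^0_{\min}}^{R^0_{\max}}s^2\rho^\delta(s)ds$ is finite, $2(M+M^\delta)<R^0_{\max}$, and $y^\delta_\infty=y^\delta(R^0_{\max})+\frac12\ln\big(1-\frac2{R^0_{\max}}(M+M^\delta)\big)$. 4. Put $E^\delta=e^{y^\delta_\infty}\in]0,1[$, $\mu^\delta=\ln E^\delta-y^\delta$, $\lambda^\delta(r)=-\frac12\ln\big(1-\frac2r(M+m^\delta(r))\big)$, and $$f^\delta(x,v)=\delta\,\chi(r-r_0)\,\varphi(E,L),\quad\varphi(E,L)=\Phi\Big(1-\frac E{E^\delta}\Big)(L-L_0)_+^l,\quad E=e^{\mu^\delta(r)}\sqrt{1+|v|^2},\quad L=|x\times v|^2,$$ where $(L-L_0)_+^l=0$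 for $L\le L_0$. Then $(f^\delta,\mu^\delta,\lambda^\delta)$ is a static solution of the Einstein–Vlasov system with Schwarzschild singularity of mass $M$; in particular $f^\delta$ is compactly supported. Its density and pressure are $\rho_{f^\delta}=\rho^\delta$, $p_{f^\delta}=p^\delta$. Moreover $f^\delta=\delta\varphi(E,L)$ wherever $f^\delta>0$, and $f^\delta(x,v)\neq0$ implies $R^0_{\min}\le|x|\le R^0_{\max}$. -/

import Mathlib

noncomputable section

namespace EVShell

open MeasureTheory Filter Topology Set

/-! ### The static, spherically symmetric Einstein–Vlasov system with a Schwarzschild singularity -/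

/-- Euclidean three-space, for positions `x` and (non-canonical) momenta `v`. -/
abbrev E3 : Type := EuclideanSpace ℝ (Fin 3)

/-- The radial momentum `w = x · v / r`. -/
def radMom (x v : E3) : ℝ := inner ℝ x v / ‖x‖

/-- The squared angular momentum `L = |x × v|²`. -/
def angMom (x v : E3) : ℝ :=
  ‖(WithLp.toLp 2 (crossProduct (WithLp.ofLp x) (WithLp.ofLp v)) : E3)‖ ^ 2

/-- The energy density `ρ_f(x)`. -/
def rhoOf (f : E3 → E3 → ℝ) (x : E3) : ℝ :=
  ∫ v : E3, Real.sqrt (1 + ‖v‖ ^ 2) * f x v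

/-- The radial pressure `p_f(x)`. -/
def pOf (f : E3 → E3 → ℝ) (x : E3) : ℝ :=
  ∫ v : E3, radMom x v ^ 2 * f x v / Real.sqrt (1 + ‖v‖ ^ 2)

/-- The current `j_f(x)`. -/
def jOf (f : E3 → E3 → ℝ) (x : E3) : ℝ :=
  ∫ v : E3, radMom x v * f x v

/-- The tangential pressure `q_f(x)`; here `|x × v / r|² = L / r²`. -/
def qOf (f : E3 → E3 → ℝ) (x : E3) : ℝ :=
  (1 / 2) * ∫ v : E3, (angMom x v / ‖x‖ ^ 2) * f x v / Real.sqrt (1 + ‖v‖ ^ 2)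

/-- The point at distance `r` from the origin on the first coordinate axis. -/
def axisPt (r : ℝ) : E3 := EuclideanSpace.single 0 r

/-- `(X, V)` is, on the time interval `[a, b]`, a characteristic curve in `{r > 2M}` of the
stationary Vlasov equation
`e^{μ-λ} v/√(1+|v|²) · ∂ₓf - e^{μ-λ} μ' √(1+|v|²) (x/r) · ∂ᵥf = 0`. -/
def IsCharacteristic (M : ℝ) (mu lam : ℝ → ℝ) (a b : ℝ) (X V : ℝ → E3) : Prop :=
  ∀ t ∈ Icc a b, 2 * M < ‖X t‖ ∧
    HasDerivWithinAt X
      ((Real.exp (mu ‖X t‖ - lam ‖X t‖) / Real.sqrt (1 + ‖V t‖ ^ 2)) • V t) (Icc a b) t ∧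
    HasDerivWithinAt V
      (-((Real.exp (mu ‖X t‖ - lam ‖X t‖) * deriv mu ‖X t‖ * Real.sqrt (1 + ‖V t‖ ^ 2))
        • ((1 / ‖X t‖) • X t))) (Icc a b) t

/-- `(f, μ, λ)` is a time-independent, spherically symmetric, asymptotically flat solution on
`{r > 2M}` of the Einstein–Vlasov system in Schwarzschild coordinates with a Schwarzschild
singularity of mass `M`. All time derivatives in the system vanish. The field equations hold in the
classical sense, and the Vlasov equation holds in the sense that `f` is constant along its
characteristics. -/
structure IsStaticSolution (M : ℝ) (f : E3 → E3 → ℝ) (mu lam : ℝ → ℝ) : Prop where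
  nonneg : ∀ x v, 0 ≤ f x v
  symm : ∀ A : E3 ≃ₗᵢ[ℝ] E3, LinearMap.det (A.toLinearEquiv : E3 →ₗ[ℝ] E3) = 1 →
    ∀ x v, 2 * M < ‖x‖ → f (A x) (A v) = f x v
  compactSupport : HasCompactSupport (Function.uncurry f)
  support_subset : tsupport (Function.uncurry f) ⊆ {z : E3 × E3 | 2 * M < ‖z.1‖}
  /-- This makes all four defining integrals of the matter quantities converge. -/
  integrable : ∀ x, 2 * M < ‖x‖ → Integrable (fun v : E3 => Real.sqrt (1 + ‖v‖ ^ 2) * f x v)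
  mu_reg : ContDiffOn ℝ 2 mu (Ioi (2 * M))
  lam_reg : ContDiffOn ℝ 1 lam (Ioi (2 * M))
  vlasov : ∀ (a b : ℝ) (X V : ℝ → E3), a ≤ b → IsCharacteristic M mu lam a b X V →
    f (X b) (V b) = f (X a) (V a)
  field1 : ∀ x : E3, 2 * M < ‖x‖ →
    Real.exp (-2 * lam ‖x‖) * (2 * ‖x‖ * deriv lam ‖x‖ - 1) + 1
      = 8 * Real.pi * ‖x‖ ^ 2 * rhoOf f x
  field2 : ∀ x : E3, 2 * M < ‖x‖ →
    Real.exp (-2 * lam ‖x‖) * (2 * ‖x‖ * deriv mu ‖x‖ + 1) - 1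
      = 8 * Real.pi * ‖x‖ ^ 2 * pOf f x
  field3 : ∀ x : E3, 2 * M < ‖x‖ →
    0 = -4 * Real.pi * ‖x‖ * Real.exp (lam ‖x‖ + mu ‖x‖) * jOf f x
  field4 : ∀ x : E3, 2 * M < ‖x‖ →
    Real.exp (-2 * lam ‖x‖) * (deriv (deriv mu) ‖x‖
        + (deriv mu ‖x‖ - deriv lam ‖x‖) * (deriv mu ‖x‖ + 1 / ‖x‖))
      = 8 * Real.pi * qOf f x
  /-- No trapped surface outside `r = 2M`. -/
  untrapped : ∀ r, 2 * M < r →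
    M + 4 * Real.pi * ∫ s in (2 * M)..r, rhoOf f (axisPt s) * s ^ 2 < r / 2
  mu_flat : Tendsto mu atTop (𝓝 0)
  lam_flat : Tendsto lam atTop (𝓝 0)
  horizon : Tendsto (fun r => Real.exp (-2 * lam r)) (𝓝[>] (2 * M)) (𝓝 0)

/-! ### The effective potential of the Schwarzschild spacetime -/

/-- `Ψ_L⁰(r) = √(1 - 2M/r) √(1 + L/r²)`, considered for `r > 2M`. -/
def effPot (M L r : ℝ) : ℝ := Real.sqrt (1 - 2 * M / r) * Real.sqrt (1 + L / r ^ 2)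

/-- The zeros of `(Ψ_L⁰)'` on `]2M, ∞[`; for `L > 12M²` there are exactly two. -/
def critSet (M L : ℝ) : Set ℝ := {r | 2 * M < r ∧ deriv (effPot M L) r = 0}

/-- The smaller zero `s_L⁰` of `(Ψ_L⁰)'`. -/
def sCrit (M L : ℝ) : ℝ := sInf (critSet M L)

/-- The larger zero `r_L⁰` of `(Ψ_L⁰)'`. -/
def rCrit (M L : ℝ) : ℝ := sSup (critSet M L)

/-- The radii `r > s_L⁰` with `Ψ_L⁰(r) = E`; for `L > 12M²` and
`Ψ_L⁰(r_L⁰) < E < min {1, Ψ_L⁰(s_L⁰)}` there are exactly two. -/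
def levelSet (M E L : ℝ) : Set ℝ := {r | sCrit M L < r ∧ effPot M L r = E}

/-- `r_-⁰(E, L)`. -/
def rMinus (M E L : ℝ) : ℝ := sInf (levelSet M E L)

/-- `r_+⁰(E, L)`. -/
def rPlus (M E L : ℝ) : ℝ := sSup (levelSet M E L)

/-! ### The ansatz and the reduced equation -/

/-- The positive-part power `s_+^l`, which vanishes for `s ≤ 0` (also when `l ≤ 0`). -/
def posPow (s l : ℝ) : ℝ := if 0 < s then s ^ l else 0

/-- `φ(E, L) = Φ(1 - E/E_cut) (L - L₀)_+^l`. -/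
def eos (Φ : ℝ → ℝ) (l L0 Ecut E L : ℝ) : ℝ := Φ (1 - E / Ecut) * posPow (L - L0) l

/-- The particle energy `E(x, v) = e^{μ(r)} √(1 + |v|²)`. -/
def energy (mu : ℝ → ℝ) (x v : E3) : ℝ := Real.exp (mu ‖x‖) * Real.sqrt (1 + ‖v‖ ^ 2)

/-- `c_l = ∫₀¹ s^l / √(1 - s) ds`. -/
def cConst (l : ℝ) : ℝ := ∫ s in (0 : ℝ)..1, s ^ l / Real.sqrt (1 - s)

/-- `d_l = ∫₀¹ s^l √(1 - s) ds`. -/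
def dConst (l : ℝ) : ℝ := ∫ s in (0 : ℝ)..1, s ^ l * Real.sqrt (1 - s)

/-- The function `G(r, y)`. -/
def G (Φ : ℝ → ℝ) (l L0 r y : ℝ) : ℝ :=
  if Real.exp (-y) * Real.sqrt (1 + L0 / r ^ 2) < 1 then
    2 * Real.pi * cConst l * r ^ (2 * l) * Real.exp (3 * y) *
      ∫ α in (0 : ℝ)..(1 - Real.exp (-y) * Real.sqrt (1 + L0 / r ^ 2)),
        Φ α * (1 - α) ^ 2 *
          (Real.exp (2 * y) * (1 - α) ^ 2 - 1 - L0 / r ^ 2) ^ (l + 1 / 2)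
  else 0

/-- The function `H(r, y)`. -/
def H (Φ : ℝ → ℝ) (l L0 r y : ℝ) : ℝ :=
  if Real.exp (-y) * Real.sqrt (1 + L0 / r ^ 2) < 1 then
    2 * Real.pi * dConst l * r ^ (2 * l) * Real.exp y *
      ∫ α in (0 : ℝ)..(1 - Real.exp (-y) * Real.sqrt (1 + L0 / r ^ 2)),
        Φ α * (Real.exp (2 * y) * (1 - α) ^ 2 - 1 - L0 / r ^ 2) ^ (l + 3 / 2)
  else 0

/-- `ρ(r) = δ χ(r - r₀) G(r, y(r))` with `r₀ = s_{L₀}⁰`. -/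
def rhoRed (M : ℝ) (χ Φ : ℝ → ℝ) (l L0 δ : ℝ) (y : ℝ → ℝ) (r : ℝ) : ℝ :=
  δ * χ (r - sCrit M L0) * G Φ l L0 r (y r)

/-- `p(r) = δ χ(r - r₀) H(r, y(r))` with `r₀ = s_{L₀}⁰`. -/
def pRed (M : ℝ) (χ Φ : ℝ → ℝ) (l L0 δ : ℝ) (y : ℝ → ℝ) (r : ℝ) : ℝ :=
  δ * χ (r - sCrit M L0) * H Φ l L0 r (y r)

/-- `m(r) = 4π ∫_{2M}^r s² ρ(s) ds`. -/
def mRed (M : ℝ) (χ Φ : ℝ → ℝ) (l L0 δ : ℝ) (y : ℝ → ℝ) (r : ℝ) : ℝ :=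
  4 * Real.pi * ∫ s in (2 * M)..r, s ^ 2 * rhoRed M χ Φ l L0 δ y s

/-- `y ∈ C¹(]2M, ∞[)` solves
`y' = -(1 - (2/r)(M + m))⁻¹ ((M + m)/r² + 4π r p)`, `y(4M) = ln(√2 E⁰)`, on `]2M, ∞[`.
That the right-hand side is defined, i.e. that its denominator does not vanish, is part of
this. -/
def IsReducedSolution (M : ℝ) (χ Φ : ℝ → ℝ) (l L0 E0 δ : ℝ) (y : ℝ → ℝ) : Prop :=
  ContDiffOn ℝ 1 y (Ioi (2 * M)) ∧
  y (4 * M) = Real.log (Real.sqrt 2 * E0) ∧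
  ∀ r, 2 * M < r →
    1 - 2 / r * (M + mRed M χ Φ l L0 δ y r) ≠ 0 ∧
    HasDerivAt y
      (-(1 / (1 - 2 / r * (M + mRed M χ Φ l L0 δ y r)) *
        ((M + mRed M χ Φ l L0 δ y r) / r ^ 2
          + 4 * Real.pi * r * pRed M χ Φ l L0 δ y r))) r

/-- The solution `y⁰` of the reduced equation in the case `δ = 0`:
`y⁰(r) = ln E⁰ - ½ ln(1 - 2M/r)`. -/
def yVac (M E0 r : ℝ) : ℝ := Real.log E0 - 1 / 2 * Real.log (1 - 2 * M / r)

/-- `μ(r) = ln E_cut - y(r)`. -/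
def muOf (Ecut : ℝ) (y : ℝ → ℝ) (r : ℝ) : ℝ := Real.log Ecut - y r

/-- `λ(r) = -½ ln(1 - (2/r)(M + m(r)))`. -/
def lamOf (M : ℝ) (m : ℝ → ℝ) (r : ℝ) : ℝ := -(1 / 2) * Real.log (1 - 2 / r * (M + m r))

/-- The ansatz `f(x, v) = δ χ(r - r₀) φ(E(x, v), L(x, v))` with `r₀ = s_{L₀}⁰`. -/
def ansatz (M : ℝ) (χ Φ : ℝ → ℝ) (l L0 δ Ecut : ℝ) (mu : ℝ → ℝ) (x v : E3) : ℝ :=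
  δ * χ (‖x‖ - sCrit M L0) * eos Φ l L0 Ecut (energy mu x v) (angMom x v)

end EVShell

end

noncomputable section

namespace EVShell

open MeasureTheory Filter Topology Set

section

/-! ### Critical points and level sets of the effective potential -/

/-! In terms of `D = r - 2(M + m)` the reduced equation is the system `y' = 1/(2r) - (1/2 +
4πr²p)/D`, `D' = 1 - 8πr²ρ`. Matter sits at `(r, y)` only if `e^{-y}√(1 + L₀/r²) < 1`. For the
vacuum solution the left side equals `Ψ_{L₀}⁰(r)/E⁰`, which beyond `s_{L₀}⁰` is below `1` exactly on
`]R_min, R_max[`. Since `p ≥ 0` and `D ≤ r - 2M`, comparison gives `y ≤ y⁰`, so matter is confined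
to that interval, while the cut-off `χ` removes everything below `s_{L₀}⁰`. Hence only the compact
interval `[R_min, R_max]` needs an existence theorem; on both sides the solution continues as a
Schwarzschild solution (`exists_isShellSolution`).

On the compact interval the danger is `D → 0` (`exists_radial_solution`). There `-y' ≥ M/(bD)` with
`b = R_max`, and `8πr²ρ ≤ K` as long as `y` stays below its initial value, so `log D - (Kb/M) y` is
nondecreasing. This bounds `D` below while `y ≥ 0`; once `y ≤ 0` there is no matter left and `D`
grows. The argument runs on a truncated system with a bounded, Lipschitz right-hand side. Lipschitz
dependence of `G` and `H` on `y` is not obvious, as `Φ` is merely bounded and the exponent `l + 1/2`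
may be below `1`; the substitution `u = e^y(1 - α)` moves the dependence into a limit of integration
(`abs_shellInt_sub_le`). The same Lipschitz bounds give uniqueness (`solution_unique`).

For the kinetic part, momentum space is described by `u = √(1 + |v|²)` and `τ = |x × v|²/r²`. The
`τ`-integral is a beta integral and the `u`-integral is the energy integral in `G` and `H`
(`integral_momIntegrand`); this identifies the density and both pressures of the ansatz. Energy and
angular momentum are conserved along characteristics, and `φ(E, L)` vanishes for `s_{L₀}⁰ ≤ r ≤
R_min`, so a characteristic carrying a nonzero value of `φ` cannot cross the region where `χ` varies
(`shellDist_characteristic`). The first two field equations are the reduced equation rewritten. The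
one with `μ''` needs `p'`, which the relations between `c_l`, `c_{l+1}` and `d_l` turn into the
Tolman–Oppenheimer–Volkoff equation (`hasDerivAt_H`, `hasDerivAt_pRed`). -/

/-- The square of the effective potential. -/
def effPotSq (M L r : ℝ) : ℝ := (1 - 2 * M / r) * (1 + L / r ^ 2)

theorem effPot_eq_sqrt {M L r : ℝ} (hM : 0 < M) (hr : 2 * M < r) :
    effPot M L r = Real.sqrt (effPotSq M L r) := by
  have h0 : 0 < r := by linarith
  have h1 : 0 ≤ 1 - 2 * M / r := by
    rw [sub_nonneg, div_le_one h0]; exact hr.le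
  rw [effPot, effPotSq, Real.sqrt_mul h1]

theorem effPotSq_pos {M L r : ℝ} (hM : 0 < M) (hL : 0 ≤ L) (hr : 2 * M < r) :
    0 < effPotSq M L r := by
  have h0 : 0 < r := by linarith
  have h1 : 0 < 1 - 2 * M / r := by
    rw [sub_pos, div_lt_one h0]; exact hr
  have h2 : 0 < 1 + L / r ^ 2 := by positivity
  exact mul_pos h1 h2

theorem effPot_nonneg (M L r : ℝ) : 0 ≤ effPot M L r := by unfold effPot; positivity

theorem effPot_sq {M L r : ℝ} (hM : 0 < M) (hL : 0 ≤ L) (hr : 2 * M < r) :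
    effPot M L r ^ 2 = effPotSq M L r := by
  rw [effPot_eq_sqrt hM hr, Real.sq_sqrt (effPotSq_pos hM hL hr).le]

theorem hasDerivAt_effPotSq {M L r : ℝ} (hr : 0 < r) :
    HasDerivAt (effPotSq M L) (2 * (M * r ^ 2 - L * r + 3 * M * L) / r ^ 4) r := by
  have h1 : HasDerivAt (fun r : ℝ => 2 * M / r) (-(2 * M) / r ^ 2) r := by
    have := (hasDerivAt_inv hr.ne').const_mul (2 * M)
    exact this.congr_deriv (by field_simp)
  have h2 : HasDerivAt (fun r : ℝ => L / r ^ 2) (-(2 * L) / r ^ 3) r := by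
    have := ((hasDerivAt_pow 2 r).inv (by positivity)).const_mul L
    exact this.congr_deriv (by push_cast; field_simp)
  have := (h1.const_sub 1).mul (h2.const_add 1)
  exact this.congr_deriv (by field_simp; ring)

theorem hasDerivAt_effPot {M L r : ℝ} (hM : 0 < M) (hL : 0 ≤ L) (hr : 2 * M < r) :
    HasDerivAt (effPot M L)
      (2 * (M * r ^ 2 - L * r + 3 * M * L) / r ^ 4 / (2 * Real.sqrt (effPotSq M L r))) r := by
  have h := (hasDerivAt_effPotSq (M := M) (L := L) (by linarith : 0 < r)).sqrt
    (effPotSq_pos hM hL hr).ne'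
  refine h.congr_of_eventuallyEq ?_
  filter_upwards [Ioi_mem_nhds hr] with x hx
  exact effPot_eq_sqrt hM hx

/-- The critical radii are the two roots of `M r² - L r + 3ML`. -/
theorem exists_critSet_eq {M L : ℝ} (hM : 0 < M) (hL : 12 * M ^ 2 < L) :
    ∃ s t : ℝ, 2 * M < s ∧ s < t ∧ s + t = L / M ∧ s * t = 3 * L ∧ critSet M L = {s, t} := by
  have hL0 : 0 < L := by nlinarith [sq_nonneg M]
  have hq : 0 < L ^ 2 - 12 * M ^ 2 * L := by nlinarith
  set q := Real.sqrt (L ^ 2 - 12 * M ^ 2 * L) with hqdef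
  have hqp : 0 < q := Real.sqrt_pos.2 hq
  have hqs : q ^ 2 = L ^ 2 - 12 * M ^ 2 * L := Real.sq_sqrt hq.le
  have hsum : (L - q) / (2 * M) + (L + q) / (2 * M) = L / M := by field_simp; ring
  have hprod : (L - q) / (2 * M) * ((L + q) / (2 * M)) = 3 * L := by
    field_simp
    linear_combination -hqs
  have hlt : (L - q) / (2 * M) < (L + q) / (2 * M) := by gcongr; linarith
  have h2M : 2 * M < (L - q) / (2 * M) := by
    rw [lt_div_iff₀ (by positivity)]
    -- After squaring this reads `L² - 12M²L < L² - 8M²L + 16M⁴`.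
    have : q < L - 4 * M ^ 2 := by
      apply lt_of_pow_lt_pow_left₀ 2 (by nlinarith [sq_nonneg M])
      rw [hqs]
      nlinarith [sq_nonneg M, pow_pos hM 4, mul_pos hL0 (pow_pos hM 2)]
    linarith
  refine ⟨_, _, h2M, hlt, hsum, hprod, ?_⟩
  set s := (L - q) / (2 * M)
  set t := (L + q) / (2 * M)
  have hpoly : ∀ r, M * r ^ 2 - L * r + 3 * M * L = M * ((r - s) * (r - t)) := by
    intro r
    have hs : M * (s + t) = L := by rw [hsum]; field_simp
    linear_combination (-M) * hprod + r * hs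
  ext r
  simp only [critSet, mem_ofPred_eq, mem_insert_iff, mem_singleton_iff]
  have key : 2 * M < r → (deriv (effPot M L) r = 0 ↔ (r = s ∨ r = t)) := by
    intro hr
    have hp := Real.sqrt_pos.2 (effPotSq_pos hM hL0.le hr)
    have hr0 : r ≠ 0 := by linarith
    rw [(hasDerivAt_effPot hM hL0.le hr).deriv, hpoly]
    simp only [div_eq_zero_iff, mul_eq_zero, sub_eq_zero, hM.ne', hr0, hp.ne', pow_eq_zero_iff,
      OfNat.ofNat_ne_zero, false_or, or_false, ne_eq, not_false_eq_true]
  constructor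
  · rintro ⟨h1, h2⟩
    exact (key h1).1 h2
  · intro h
    have hr : 2 * M < r := by rcases h with rfl | rfl <;> linarith
    exact ⟨hr, (key hr).2 h⟩

theorem crit_spec {M L : ℝ} (hM : 0 < M) (hL : 12 * M ^ 2 < L) :
    2 * M < sCrit M L ∧ sCrit M L < rCrit M L ∧ sCrit M L + rCrit M L = L / M ∧
      sCrit M L * rCrit M L = 3 * L ∧ critSet M L = {sCrit M L, rCrit M L} := by
  obtain ⟨s, t, h1, h2, h3, h4, h5⟩ := exists_critSet_eq hM hL
  have hs : sCrit M L = s := by rw [sCrit, h5, csInf_pair]; exact min_eq_left h2.le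
  have ht : rCrit M L = t := by rw [rCrit, h5, csSup_pair]; exact max_eq_right h2.le
  rw [hs, ht]
  exact ⟨h1, h2, h3, h4, h5⟩

theorem deriv_numerator_eq {M L : ℝ} (hM : 0 < M) (hL : 12 * M ^ 2 < L) (r : ℝ) :
    M * r ^ 2 - L * r + 3 * M * L = M * ((r - sCrit M L) * (r - rCrit M L)) := by
  obtain ⟨-, -, h3, h4, -⟩ := crit_spec hM hL
  have hs : M * (sCrit M L + rCrit M L) = L := by rw [h3]; field_simp
  linear_combination (-M) * h4 + r * hs

theorem effPot_strictAntiOn {M L : ℝ} (hM : 0 < M) (hL : 12 * M ^ 2 < L) :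
    StrictAntiOn (effPot M L) (Icc (sCrit M L) (rCrit M L)) := by
  obtain ⟨h1, h2, -, -, -⟩ := crit_spec hM hL
  have hL0 : 0 < L := by nlinarith [sq_nonneg M]
  apply strictAntiOn_of_deriv_neg (convex_Icc _ _)
  · intro r hr
    exact (hasDerivAt_effPot hM hL0.le (by linarith [hr.1])).continuousAt.continuousWithinAt
  · intro r hr
    rw [interior_Icc] at hr
    have hr2 : 2 * M < r := by linarith [hr.1]
    have hr0 : 0 < r := by linarith
    have hp := Real.sqrt_pos.2 (effPotSq_pos hM hL0.le hr2)
    rw [(hasDerivAt_effPot hM hL0.le hr2).deriv, deriv_numerator_eq hM hL]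
    apply div_neg_of_neg_of_pos _ (by positivity)
    apply div_neg_of_neg_of_pos _ (by positivity)
    have := mul_neg_of_pos_of_neg (sub_pos.2 hr.1) (sub_neg.2 hr.2)
    nlinarith

theorem effPot_strictMonoOn {M L : ℝ} (hM : 0 < M) (hL : 12 * M ^ 2 < L) :
    StrictMonoOn (effPot M L) (Ici (rCrit M L)) := by
  obtain ⟨h1, h2, -, -, -⟩ := crit_spec hM hL
  have hL0 : 0 < L := by nlinarith [sq_nonneg M]
  apply strictMonoOn_of_deriv_pos (convex_Ici _)
  · intro r hr
    have : rCrit M L ≤ r := hr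
    exact (hasDerivAt_effPot hM hL0.le (by linarith)).continuousAt.continuousWithinAt
  · intro r hr
    rw [interior_Ici] at hr
    have hr' : rCrit M L < r := hr
    have hr2 : 2 * M < r := by linarith
    have hr0 : 0 < r := by linarith
    have hp := Real.sqrt_pos.2 (effPotSq_pos hM hL0.le hr2)
    rw [(hasDerivAt_effPot hM hL0.le hr2).deriv, deriv_numerator_eq hM hL]
    have h3 : 0 < r - sCrit M L := by linarith
    have h4 : 0 < r - rCrit M L := by linarith
    positivity

theorem effPot_continuousOn {M L : ℝ} (hM : 0 < M) (hL : 0 ≤ L) :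
    ContinuousOn (effPot M L) (Ioi (2 * M)) := fun _ hr =>
  (hasDerivAt_effPot hM hL hr).continuousAt.continuousWithinAt

theorem tendsto_effPot_atTop (M L : ℝ) : Tendsto (effPot M L) atTop (𝓝 1) := by
  have h1 : Tendsto (fun r : ℝ => 2 * M / r) atTop (𝓝 0) := tendsto_const_nhds.div_atTop tendsto_id
  have h2 : Tendsto (fun r : ℝ => L / r ^ 2) atTop (𝓝 0) :=
    tendsto_const_nhds.div_atTop (tendsto_pow_atTop two_ne_zero)
  have := ((h1.const_sub 1).sqrt).mul ((h2.const_add 1).sqrt)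
  simp only [sub_zero, add_zero, Real.sqrt_one, mul_one] at this
  exact this

/-- The facts about the radii `r_±⁰(E, L)`. -/
theorem level_spec {M L E : ℝ} (hM : 0 < M) (hL : 12 * M ^ 2 < L)
    (hE : effPot M L (rCrit M L) < E) (hE' : E < min 1 (effPot M L (sCrit M L))) :
    levelSet M E L = {rMinus M E L, rPlus M E L} ∧ sCrit M L < rMinus M E L ∧
      rMinus M E L < rCrit M L ∧ rCrit M L < rPlus M E L ∧
      effPot M L (rMinus M E L) = E ∧ effPot M L (rPlus M E L) = E := by
  obtain ⟨h1, h2, -, -, -⟩ := crit_spec hM hL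
  have hL0 : 0 < L := by nlinarith [sq_nonneg M]
  have hanti := effPot_strictAntiOn hM hL
  have hmono := effPot_strictMonoOn hM hL
  have hcont := effPot_continuousOn hM hL0.le
  have hEs : E < effPot M L (sCrit M L) := hE'.trans_le (min_le_right _ _)
  have hE1 : E < 1 := hE'.trans_le (min_le_left _ _)
  obtain ⟨a, ha, hae⟩ : E ∈ effPot M L '' Ioo (sCrit M L) (rCrit M L) := by
    apply intermediate_value_Ioo' h2.le (hcont.mono _) ⟨hE, hEs⟩
    intro r hr; exact lt_of_lt_of_le h1 hr.1
  obtain ⟨c, hc1, hc2⟩ : ∃ c, rCrit M L < c ∧ E < effPot M L c := by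
    have := (tendsto_effPot_atTop M L).eventually (lt_mem_nhds hE1)
    obtain ⟨c, hc⟩ := ((eventually_gt_atTop (rCrit M L)).and this).exists
    exact ⟨c, hc⟩
  obtain ⟨b, hb, hbe⟩ : E ∈ effPot M L '' Ioo (rCrit M L) c := by
    apply intermediate_value_Ioo hc1.le (hcont.mono _) ⟨hE, hc2⟩
    intro r hr; exact (h1.trans h2).trans_le hr.1
  have hset : levelSet M E L = {a, b} := by
    ext r
    simp only [levelSet, mem_ofPred_eq, mem_insert_iff, mem_singleton_iff]
    constructor
    · rintro ⟨hr, hre⟩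
      rcases le_total r (rCrit M L) with hle | hle
      · left
        exact hanti.injOn ⟨hr.le, hle⟩ ⟨ha.1.le, ha.2.le⟩ (hre.trans hae.symm)
      · right
        exact hmono.injOn hle hb.1.le (hre.trans hbe.symm)
    · rintro (rfl | rfl)
      · exact ⟨ha.1, hae⟩
      · exact ⟨h2.trans hb.1, hbe⟩
  have hab : a < b := ha.2.trans hb.1
  have hma : rMinus M E L = a := by rw [rMinus, hset, csInf_pair]; exact min_eq_left hab.le
  have hpb : rPlus M E L = b := by rw [rPlus, hset, csSup_pair]; exact max_eq_right hab.le
  rw [hma, hpb]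
  exact ⟨hset, ha.1, ha.2, hb.1, hae, hbe⟩

theorem le_effPot_of_le_rMinus {M L E r : ℝ} (hM : 0 < M) (hL : 12 * M ^ 2 < L)
    (hE : effPot M L (rCrit M L) < E) (hE' : E < min 1 (effPot M L (sCrit M L)))
    (hr : sCrit M L ≤ r) (hr' : r ≤ rMinus M E L) : E ≤ effPot M L r := by
  obtain ⟨-, h2, h3, -, h5, -⟩ := level_spec hM hL hE hE'
  have := (effPot_strictAntiOn hM hL).antitoneOn ⟨hr, hr'.trans h3.le⟩ ⟨h2.le, h3.le⟩ hr'
  rwa [h5] at this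

theorem le_effPot_of_rPlus_le {M L E r : ℝ} (hM : 0 < M) (hL : 12 * M ^ 2 < L)
    (hE : effPot M L (rCrit M L) < E) (hE' : E < min 1 (effPot M L (sCrit M L)))
    (hr : rPlus M E L ≤ r) : E ≤ effPot M L r := by
  obtain ⟨-, h2, h3, h4, -, h6⟩ := level_spec hM hL hE hE'
  have := (effPot_strictMonoOn hM hL).monotoneOn h4.le (h4.le.trans hr) hr
  rwa [h6] at this

theorem effPot_lt_of_mem_Ioo {M L E r : ℝ} (hM : 0 < M) (hL : 12 * M ^ 2 < L)
    (hE : effPot M L (rCrit M L) < E) (hE' : E < min 1 (effPot M L (sCrit M L)))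
    (hr : r ∈ Ioo (rMinus M E L) (rPlus M E L)) : effPot M L r < E := by
  obtain ⟨-, h2, h3, h4, h5, h6⟩ := level_spec hM hL hE hE'
  rcases le_total r (rCrit M L) with h | h
  · rw [← h5]
    exact effPot_strictAntiOn hM hL ⟨h2.le, h3.le⟩ ⟨(h2.trans hr.1).le, h⟩ hr.1
  · conv_rhs => rw [← h6]
    exact effPot_strictMonoOn hM hL h h4.le hr.2

/-- At `r = 4M` the quadratic `M r² - L r + 3ML` equals `M(16M² - L) ≥ 0`, so `4M` is not strictly
between its roots; their sum `L/M > 12M` puts the larger root beyond `4M`. -/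
theorem four_mul_le_sCrit {M L : ℝ} (hM : 0 < M) (hL : 12 * M ^ 2 < L) (h : L ≤ 16 * M ^ 2) :
    4 * M ≤ sCrit M L := by
  obtain ⟨h1, h2, h3, h4, -⟩ := crit_spec hM hL
  by_contra! hlt
  have e := deriv_numerator_eq hM hL (4 * M)
  have hsum : M * (sCrit M L + rCrit M L) = L := by rw [h3]; field_simp
  have ht : 4 * M < rCrit M L := by nlinarith
  have := mul_neg_of_pos_of_neg (sub_pos.2 hlt) (sub_neg.2 ht)
  nlinarith

/-- For `L > 16M²` the squared potential at `4M` is `½(1 + L/(16M²)) > 1 > E²`, and `4M` lies left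
of the minimum, so the potential has not yet dropped to `E` there. The other case is the position of
`s_L⁰`. This puts the initial radius `4M` of the reduced equation into the vacuum region. -/
theorem four_mul_lt_rMinus {M L E : ℝ} (hM : 0 < M) (hL : 12 * M ^ 2 < L)
    (hE : effPot M L (rCrit M L) < E) (hE' : E < min 1 (effPot M L (sCrit M L))) :
    4 * M < rMinus M E L := by
  obtain ⟨h1, h2, h3, h4, -⟩ := crit_spec hM hL
  obtain ⟨-, k2, k3, k4, k5, k6⟩ := level_spec hM hL hE hE'
  have hL0 : 0 < L := by nlinarith [sq_nonneg M]
  have hE1 : E < 1 := hE'.trans_le (min_le_left _ _)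
  rcases le_or_gt L (16 * M ^ 2) with h | h
  · exact (four_mul_le_sCrit hM hL h).trans_lt k2
  · by_contra! hle
    have ht : 4 * M < rCrit M L := by
      have hsum : M * (sCrit M L + rCrit M L) = L := by rw [h3]; field_simp
      nlinarith
    have hlt : effPot M L (4 * M) ≤ E := by
      rw [← k5]
      exact (effPot_strictAntiOn hM hL).antitoneOn ⟨k2.le, k3.le⟩ ⟨k2.le.trans hle, ht.le⟩ hle
    have hsq : effPot M L (4 * M) ^ 2 < 1 := by
      have := effPot_nonneg M L (4 * M)
      nlinarith
    rw [effPot_sq hM hL0.le (by linarith), effPotSq] at hsq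
    have e1 : 2 * M / (4 * M) = 1 / 2 := by field_simp; norm_num
    have e2 : 1 < L / (4 * M) ^ 2 := by
      rw [lt_div_iff₀ (by positivity)]; linarith
    rw [e1] at hsq
    linarith

end

section

/-! ### Positive-part powers -/

theorem posPow_nonneg (s k : ℝ) : 0 ≤ posPow s k := by
  unfold posPow; split_ifs with h
  · exact Real.rpow_nonneg h.le _
  · exact le_rfl

theorem posPow_of_pos {s : ℝ} (hs : 0 < s) (k : ℝ) : posPow s k = s ^ k := if_pos hs

theorem posPow_of_nonpos {s : ℝ} (hs : s ≤ 0) (k : ℝ) : posPow s k = 0 := if_neg hs.not_gt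

theorem posPow_pos {s : ℝ} (hs : 0 < s) (k : ℝ) : 0 < posPow s k := by
  rw [posPow_of_pos hs]; positivity

theorem posPow_eq_max {k : ℝ} (hk : 0 < k) (s : ℝ) : posPow s k = (max s 0) ^ k := by
  rcases lt_or_ge 0 s with h | h
  · rw [posPow_of_pos h, max_eq_left h.le]
  · rw [posPow_of_nonpos h, max_eq_right h, Real.zero_rpow hk.ne']

theorem continuous_posPow {k : ℝ} (hk : 0 < k) : Continuous (fun s => posPow s k) := by
  simp_rw [posPow_eq_max hk]
  exact (continuous_id.max continuous_const).rpow_const (fun _ => Or.inr hk.le)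

theorem posPow_mono {k : ℝ} (hk : 0 < k) : Monotone (fun s => posPow s k) := by
  intro s t hst
  simp only [posPow_eq_max hk]
  exact Real.rpow_le_rpow (le_max_right _ _) (max_le_max_right _ hst) hk.le

theorem posPow_add_one {s : ℝ} (k : ℝ) : posPow s (k + 1) = s * posPow s k := by
  rcases lt_or_ge 0 s with h | h
  · rw [posPow_of_pos h, posPow_of_pos h, Real.rpow_add_one h.ne', mul_comm]
  · rw [posPow_of_nonpos h, posPow_of_nonpos h, mul_zero]

/-- At `s = 0` the difference quotient is `s_+^{k-1}` itself, which tends to `0` because `k - 1 >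
0`. -/
theorem hasDerivAt_posPow {k : ℝ} (hk : 1 < k) (s : ℝ) :
    HasDerivAt (fun s => posPow s k) (k * posPow s (k - 1)) s := by
  rcases lt_trichotomy 0 s with h | h | h
  · rw [posPow_of_pos h]
    refine (Real.hasDerivAt_rpow_const (Or.inl h.ne')).congr_of_eventuallyEq ?_
    filter_upwards [Ioi_mem_nhds h] with t ht
    exact posPow_of_pos ht k
  · subst h
    rw [posPow_of_nonpos le_rfl, mul_zero]
    have h0 : HasDerivAt (fun s : ℝ => posPow s (k - 1) * s)
        (posPow 0 (k - 1)) 0 := by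
      rw [hasDerivAt_iff_tendsto_slope]
      have hc := (continuous_posPow (sub_pos.2 hk)).tendsto 0
      refine (hc.mono_left nhdsWithin_le_nhds).congr' ?_
      filter_upwards [self_mem_nhdsWithin] with t ht
      have ht' : t ≠ 0 := ht
      simp only [slope, vsub_eq_sub, smul_eq_mul, sub_zero, mul_zero]
      field_simp
    rw [posPow_of_nonpos le_rfl] at h0
    convert h0 using 2 with s
    have := posPow_add_one (s := s) (k - 1)
    rw [sub_add_cancel] at this
    rw [this, mul_comm]
  · rw [posPow_of_nonpos h.le, mul_zero]
    refine (hasDerivAt_const s (0 : ℝ)).congr_of_eventuallyEq ?_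
    filter_upwards [Iio_mem_nhds h] with t ht
    exact posPow_of_nonpos (le_of_lt ht) k

/-! ### The beta constants -/

/-- The integrand is the norm of that of the complex beta integral with real parameters. -/
theorem integrableOn_beta {p q : ℝ} (hp : -1 < p) (hq : -1 < q) :
    IntervalIntegrable (fun s : ℝ => s ^ p * (1 - s) ^ q) volume 0 1 := by
  have h := (Complex.betaIntegral_convergent (u := ((p + 1 : ℝ) : ℂ)) (v := ((q + 1 : ℝ) : ℂ))
    (by simp only [Complex.ofReal_re]; linarith) (by simp only [Complex.ofReal_re]; linarith)).norm
  rw [intervalIntegrable_iff_integrableOn_Ioo_of_le zero_le_one] at h ⊢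
  refine h.congr_fun (fun s hs => ?_) measurableSet_Ioo
  have h1 : 0 < 1 - s := sub_pos.2 hs.2
  simp only [norm_mul]
  have e1 : (1 : ℂ) - s = ((1 - s : ℝ) : ℂ) := by push_cast; rfl
  rw [e1, Complex.norm_cpow_eq_rpow_re_of_pos hs.1, Complex.norm_cpow_eq_rpow_re_of_pos h1]
  simp

theorem cConst_eq_beta (l : ℝ) : cConst l = ∫ s in (0 : ℝ)..1, s ^ l * (1 - s) ^ (-(1 / 2) : ℝ) := by
  unfold cConst
  refine intervalIntegral.integral_congr (fun s hs => ?_)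
  rw [uIcc_of_le zero_le_one] at hs
  rw [Real.rpow_neg (sub_nonneg.2 hs.2), Real.sqrt_eq_rpow, div_eq_mul_inv]

theorem dConst_eq_beta (l : ℝ) : dConst l = ∫ s in (0 : ℝ)..1, s ^ l * (1 - s) ^ (1 / 2 : ℝ) := by
  unfold dConst
  simp_rw [Real.sqrt_eq_rpow]

theorem integrable_cConst {l : ℝ} (hl : -(1 / 2) < l) :
    IntervalIntegrable (fun s : ℝ => s ^ l * (1 - s) ^ (-(1 / 2) : ℝ)) volume 0 1 :=
  integrableOn_beta (by linarith) (by norm_num)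

theorem integrable_dConst {l : ℝ} (hl : -(1 / 2) < l) :
    IntervalIntegrable (fun s : ℝ => s ^ l * (1 - s) ^ (1 / 2 : ℝ)) volume 0 1 :=
  integrableOn_beta (by linarith) (by norm_num)

/-- Uses `(s^l - s^{l+1})(1 - s)^{-1/2} = s^l (1 - s)^{1/2}`. -/
theorem cConst_sub {l : ℝ} (hl : -(1 / 2) < l) : cConst l - cConst (l + 1) = dConst l := by
  rw [cConst_eq_beta, cConst_eq_beta, dConst_eq_beta, ← intervalIntegral.integral_sub
    (integrable_cConst hl) (integrable_cConst (by linarith))]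
  refine intervalIntegral.integral_congr_Ioo_of_le zero_le_one (fun s hs => ?_)
  have h1 : 0 < 1 - s := sub_pos.2 hs.2
  rw [Real.rpow_add_one hs.1.ne', show (1 / 2 : ℝ) = -(1 / 2) + 1 by norm_num,
    Real.rpow_add_one h1.ne']
  norm_num
  ring

/-- Integrates the derivative of `2 s^{l+1} √(1 - s)`, which vanishes at both ends. Together with
`cConst_sub` this expresses all constants through `d_l`, as the derivative of the pressure requires.
-/
theorem cConst_succ {l : ℝ} (hl : -(1 / 2) < l) :
    cConst (l + 1) = 2 * (l + 1) * dConst l := by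
  have hl1 : 0 < l + 1 := by linarith
  have hi1 := (integrable_dConst hl).const_mul (2 * (l + 1))
  have hi2 := integrable_cConst (l := l + 1) (by linarith)
  have h := intervalIntegral.integral_eq_sub_of_hasDerivAt_of_le (a := 0) (b := 1)
    (f := fun s : ℝ => 2 * (s ^ (l + 1) * (1 - s) ^ (1 / 2 : ℝ)))
    (f' := fun s : ℝ => 2 * (l + 1) * (s ^ l * (1 - s) ^ (1 / 2 : ℝ))
      - s ^ (l + 1) * (1 - s) ^ (-(1 / 2) : ℝ)) zero_le_one
    (by
      apply Continuous.continuousOn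
      apply continuous_const.mul
      exact (continuous_id.rpow_const (fun _ => Or.inr hl1.le)).mul
        ((continuous_const.sub continuous_id).rpow_const (fun _ => Or.inr (by norm_num))))
    (by
      intro s hs
      have h1 : 0 < 1 - s := sub_pos.2 hs.2
      have d1 := Real.hasDerivAt_rpow_const (x := s) (p := l + 1) (Or.inl hs.1.ne')
      have d2 := ((hasDerivAt_id s).const_sub 1).rpow_const (p := (1 / 2 : ℝ)) (Or.inl h1.ne')
      refine ((d1.mul d2).const_mul 2).congr_deriv ?_
      rw [add_sub_cancel_right, show (1 / 2 : ℝ) - 1 = -(1 / 2) by norm_num]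
      simp only [id]
      ring)
    (hi1.sub hi2)
  rw [intervalIntegral.integral_sub hi1 hi2, intervalIntegral.integral_const_mul,
    ← dConst_eq_beta, ← cConst_eq_beta] at h
  simp only [sub_self, Real.zero_rpow (show (1 / 2 : ℝ) ≠ 0 by norm_num), mul_zero,
    Real.zero_rpow hl1.ne', zero_mul] at h
  linarith

theorem cConst_eq {l : ℝ} (hl : -(1 / 2) < l) : cConst l = 2 * (l + 3 / 2) * dConst l := by
  have h1 := cConst_sub hl
  have h2 := cConst_succ hl
  linarith

theorem dConst_pos {l : ℝ} (hl : -(1 / 2) < l) : 0 < dConst l := by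
  rw [dConst_eq_beta]
  refine intervalIntegral.intervalIntegral_pos_of_pos_on (integrable_dConst hl)
    (fun s hs => ?_) zero_lt_one
  have h1 : 0 < 1 - s := sub_pos.2 hs.2
  have h2 := hs.1
  positivity

theorem cConst_pos {l : ℝ} (hl : -(1 / 2) < l) : 0 < cConst l := by
  rw [cConst_eq hl]
  have := dConst_pos hl
  have : 0 < l + 3 / 2 := by linarith
  positivity

end

section

/-! ### The energy integrals -/

/-- The properties of the energy profile `Φ` on the unit interval that are used below. -/
structure IsProfile (Φ : ℝ → ℝ) (C : ℝ) : Prop where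
  nonneg : ∀ α, 0 ≤ Φ α
  zero : ∀ α, α ≤ 0 → Φ α = 0
  meas : AEStronglyMeasurable Φ (volume.restrict (uIoc (0 : ℝ) 1))
  bound_nonneg : 0 ≤ C
  bound : ∀ᵐ α, α ∈ uIoc (0 : ℝ) 1 → Φ α ≤ C
  pos : ∃ α0 : ℝ, 0 < α0 ∧ ∀ α ∈ Ioo 0 α0, 0 < Φ α

/-- Only `0 < α < 1` ever matters: `α = 1 - E/E_cut` is below `1` for positive energies, and `Φ`
vanishes for `α ≤ 0`. One essential bound on `[0, 1]` thus replaces local boundedness. -/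
theorem exists_isProfile {Φ : ℝ → ℝ} (hΦ_nonneg : ∀ α, 0 ≤ Φ α)
    (hΦ_loc : ∀ K : Set ℝ, IsCompact K → MemLp Φ ⊤ (volume.restrict K))
    (hΦ_zero : ∀ α, α ≤ 0 → Φ α = 0)
    (hΦ_pos : ∃ α0 : ℝ, 0 < α0 ∧ ∀ α ∈ Ioo 0 α0, 0 < Φ α) : ∃ C, IsProfile Φ C := by
  have h := hΦ_loc (Icc 0 1) isCompact_Icc
  have hsub : uIoc (0 : ℝ) 1 ⊆ Icc 0 1 := by
    rw [uIoc_of_le zero_le_one]; exact Ioc_subset_Icc_self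
  refine ⟨(eLpNorm Φ ⊤ (volume.restrict (Icc 0 1))).toReal, hΦ_nonneg, hΦ_zero,
    h.1.mono_measure (Measure.restrict_mono hsub le_rfl), ENNReal.toReal_nonneg, ?_, hΦ_pos⟩
  have hb := ae_le_eLpNormEssSup (f := Φ) (μ := volume.restrict (Icc (0 : ℝ) 1))
  rw [ae_restrict_iff' measurableSet_Icc] at hb
  filter_upwards [hb] with α hα hmem
  have h1 := hα (hsub hmem)
  rw [← eLpNorm_exponent_top] at h1
  have h2 := (ENNReal.toReal_le_toReal (by simp) h.2.ne).2 h1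
  rwa [toReal_enorm, Real.norm_of_nonneg (hΦ_nonneg α)] at h2

/-- `e^{2y} (1 - α)² - b`, which is `u² - b` for the momentum variable `u = e^y (1 - α)`. -/
def excess (b y α : ℝ) : ℝ := Real.exp (2 * y) * (1 - α) ^ 2 - b

/-- The integrals `∫₀¹ Φ(α) (1 - α)^β (e^{2y} (1 - α)² - b)_+^k dα`. -/
def shellInt (Φ : ℝ → ℝ) (β : ℕ) (k b y : ℝ) : ℝ :=
  ∫ α in (0 : ℝ)..1, Φ α * (1 - α) ^ β * posPow (excess b y α) k

theorem exp_two_mul_mul_sq (y a : ℝ) :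
    Real.exp (2 * y) * a ^ 2 = (Real.exp y * a) ^ 2 := by
  rw [mul_pow, ← Real.exp_nat_mul]; norm_num

/-- Translates the positive part in `shellInt` into the upper limit of integration in `G` and `H`.
-/
theorem excess_pos_iff {b y α : ℝ} (hα : α ≤ 1) (hb : 0 ≤ b) :
    0 < excess b y α ↔ α < 1 - Real.exp (-y) * Real.sqrt b := by
  have h3 : Real.exp (-y) * Real.exp y = 1 := by rw [← Real.exp_add]; simp
  have hp := Real.exp_pos y
  have hn := Real.exp_pos (-y)
  have hX : 0 ≤ Real.exp y * (1 - α) := by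
    have : 0 ≤ 1 - α := by linarith
    positivity
  rw [excess, exp_two_mul_mul_sq, sub_pos, ← Real.sqrt_lt hb hX]
  constructor
  · intro h
    have := mul_lt_mul_of_pos_left h hn
    rw [← mul_assoc, h3] at this
    linarith
  · intro h
    have h' : Real.exp (-y) * Real.sqrt b < 1 - α := by linarith
    have := mul_lt_mul_of_pos_left h' hp
    rw [← mul_assoc, mul_comm (Real.exp y), h3] at this
    linarith

theorem excess_nonpos {b y α : ℝ} (hb : 0 ≤ b) (hα : α ∈ Icc (0 : ℝ) 1)
    (h : 1 ≤ Real.exp (-y) * Real.sqrt b) : excess b y α ≤ 0 := by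
  by_contra! hc
  have := (excess_pos_iff hα.2 hb).1 hc
  linarith [hα.1]

theorem posPow_excess_le {b y Y k α : ℝ} (hk : 0 < k) (hb : 0 ≤ b) (hy : y ≤ Y)
    (hα : α ∈ Icc (0 : ℝ) 1) : posPow (excess b y α) k ≤ Real.exp (2 * Y * k) := by
  have h1 : excess b y α ≤ Real.exp (2 * Y) := by
    have e1 : Real.exp (2 * y) ≤ Real.exp (2 * Y) := Real.exp_le_exp.2 (by linarith)
    have e2 : (1 - α) ^ 2 ≤ 1 := by nlinarith [hα.1, hα.2]
    have e3 := Real.exp_pos (2 * y)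
    unfold excess
    nlinarith
  calc posPow (excess b y α) k ≤ posPow (Real.exp (2 * Y)) k := posPow_mono hk h1
    _ = Real.exp (2 * Y * k) := by rw [posPow_of_pos (Real.exp_pos _), ← Real.exp_mul]

theorem continuous_excess (b y : ℝ) : Continuous (excess b y) := by
  unfold excess; fun_prop

variable {Φ : ℝ → ℝ} {C : ℝ}

theorem IsProfile.integrand_meas (hΦ : IsProfile Φ C) (β : ℕ) {k : ℝ} (hk : 0 < k) (b y : ℝ) :
    AEStronglyMeasurable (fun α => Φ α * (1 - α) ^ β * posPow (excess b y α) k)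
      (volume.restrict (uIoc (0 : ℝ) 1)) := by
  have h1 : Continuous (fun α : ℝ => (1 - α) ^ β) := by fun_prop
  have h2 := (continuous_posPow hk).comp (continuous_excess b y)
  exact (hΦ.meas.mul h1.aestronglyMeasurable).mul h2.aestronglyMeasurable

theorem IsProfile.integrand_bound (hΦ : IsProfile Φ C) (β : ℕ) {k : ℝ} (hk : 0 < k) (Y : ℝ) :
    ∀ᵐ α, α ∈ uIoc (0 : ℝ) 1 → ∀ b y, 0 ≤ b → y ≤ Y →
      ‖Φ α * (1 - α) ^ β * posPow (excess b y α) k‖ ≤ C * Real.exp (2 * Y * k) := by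
  filter_upwards [hΦ.bound] with α hα hmem b y hb hy
  have hmem' := hmem
  rw [uIoc_of_le zero_le_one] at hmem'
  have h1 : 0 ≤ 1 - α := by linarith [hmem'.2]
  have h2 : (1 - α) ^ β ≤ 1 := pow_le_one₀ h1 (by linarith [hmem'.1])
  have h3 := posPow_excess_le hk hb hy ⟨hmem'.1.le, hmem'.2⟩
  have h4 := posPow_nonneg (excess b y α) k
  have h5 := hΦ.nonneg α
  rw [Real.norm_of_nonneg (by positivity)]
  refine mul_le_mul ?_ h3 h4 hΦ.bound_nonneg
  calc Φ α * (1 - α) ^ β ≤ C * 1 := mul_le_mul (hα hmem) h2 (by positivity) hΦ.bound_nonneg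
    _ = C := mul_one C

theorem IsProfile.integrand_integrable (hΦ : IsProfile Φ C) (β : ℕ) {k b : ℝ} (hk : 0 < k)
    (hb : 0 ≤ b) (y : ℝ) :
    IntervalIntegrable (fun α => Φ α * (1 - α) ^ β * posPow (excess b y α) k) volume 0 1 := by
  refine (intervalIntegrable_const (c := C * Real.exp (2 * y * k))).mono_fun'
    (hΦ.integrand_meas β hk b y) ?_
  rw [EventuallyLE, ae_restrict_iff' measurableSet_uIoc]
  filter_upwards [hΦ.integrand_bound β hk y] with α hα hmem
  exact hα hmem b y hb le_rfl

theorem IsProfile.integrand_nonneg (hΦ : IsProfile Φ C) (β : ℕ) (k b y : ℝ) {α : ℝ} (hα : α ≤ 1) :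
    0 ≤ Φ α * (1 - α) ^ β * posPow (excess b y α) k := by
  have h1 : 0 ≤ 1 - α := by linarith
  exact mul_nonneg (mul_nonneg (hΦ.nonneg α) (by positivity)) (posPow_nonneg _ _)

theorem shellInt_nonneg (hΦ : IsProfile Φ C) (β : ℕ) (k b y : ℝ) : 0 ≤ shellInt Φ β k b y :=
  intervalIntegral.integral_nonneg zero_le_one fun _ hα => hΦ.integrand_nonneg β k b y hα.2

theorem shellInt_le (hΦ : IsProfile Φ C) (β : ℕ) {k b y Y : ℝ} (hk : 0 < k) (hb : 0 ≤ b)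
    (hy : y ≤ Y) : shellInt Φ β k b y ≤ C * Real.exp (2 * Y * k) := by
  have h := intervalIntegral.norm_integral_le_of_norm_le_const_ae (a := 0) (b := 1)
    (f := fun α => Φ α * (1 - α) ^ β * posPow (excess b y α) k) (C := C * Real.exp (2 * Y * k))
    (by filter_upwards [hΦ.integrand_bound β hk Y] with α hα hmem using hα hmem b y hb hy)
  simp only [sub_zero, abs_one, mul_one] at h
  exact (le_abs_self _).trans h

theorem shellInt_eq_zero {β : ℕ} {k b y : ℝ} (hb : 0 ≤ b)
    (h : 1 ≤ Real.exp (-y) * Real.sqrt b) : shellInt Φ β k b y = 0 := by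
  unfold shellInt
  refine (intervalIntegral.integral_congr (g := fun _ => (0 : ℝ)) fun α hα => ?_).trans
    intervalIntegral.integral_zero
  rw [uIcc_of_le zero_le_one] at hα
  beta_reduce
  rw [posPow_of_nonpos (excess_nonpos hb hα h), mul_zero]

theorem shellInt_pos (hΦ : IsProfile Φ C) (β : ℕ) {k b y : ℝ} (hk : 0 < k) (hb : 0 ≤ b)
    (h : Real.exp (-y) * Real.sqrt b < 1) : 0 < shellInt Φ β k b y := by
  obtain ⟨α0, hα0, hpos⟩ := hΦ.pos
  set T := 1 - Real.exp (-y) * Real.sqrt b with hT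
  have hT0 : 0 < T := by linarith
  have hT1 : T ≤ 1 := by have : 0 ≤ Real.exp (-y) * Real.sqrt b := by positivity
                         linarith
  -- Below `α0` the profile is positive, below `T` the excess is; on `]0, ε[` both hold.
  set ε := min α0 T
  have hε : 0 < ε := lt_min hα0 hT0
  have hε1 : ε ≤ 1 := (min_le_right _ _).trans hT1
  have hint := hΦ.integrand_integrable β hk hb y
  have hi1 := hint.mono_set (c := 0) (d := ε) (by
    rw [uIcc_of_le hε.le, uIcc_of_le zero_le_one]; exact Icc_subset_Icc le_rfl hε1)
  have hi2 := hint.mono_set (c := ε) (d := 1) (by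
    rw [uIcc_of_le hε1, uIcc_of_le zero_le_one]; exact Icc_subset_Icc hε.le le_rfl)
  unfold shellInt
  rw [← intervalIntegral.integral_add_adjacent_intervals hi1 hi2]
  refine add_pos_of_pos_of_nonneg ?_ ?_
  · refine intervalIntegral.intervalIntegral_pos_of_pos_on hi1 (fun α hα => ?_) hε
    have h1 : α < T := hα.2.trans_le (min_le_right _ _)
    have h2 : 0 < 1 - α := by linarith
    have h3 := hpos α ⟨hα.1, hα.2.trans_le (min_le_left _ _)⟩
    have h4 := posPow_pos ((excess_pos_iff (by linarith) hb).2 h1) k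
    positivity
  · exact intervalIntegral.integral_nonneg hε1 fun α hα => hΦ.integrand_nonneg β k b y hα.2

theorem continuousAt_shellInt (hΦ : IsProfile Φ C) (β : ℕ) {k : ℝ} (hk : 0 < k) (p : ℝ × ℝ)
    (hp : 0 < p.1) : ContinuousAt (fun p : ℝ × ℝ => shellInt Φ β k p.1 p.2) p := by
  unfold shellInt
  have hev : ∀ᶠ q : ℝ × ℝ in 𝓝 p, 0 ≤ q.1 ∧ q.2 ≤ p.2 + 1 := by
    have h1 := (continuous_fst.tendsto p).eventually (lt_mem_nhds hp)
    have h2 := (continuous_snd.tendsto p).eventually (gt_mem_nhds (lt_add_one p.2))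
    filter_upwards [h1, h2] with q hq1 hq2 using ⟨hq1.le, hq2.le⟩
  refine intervalIntegral.continuousAt_of_dominated_interval
    (bound := fun _ => C * Real.exp (2 * (p.2 + 1) * k))
    (Eventually.of_forall fun q => hΦ.integrand_meas β hk q.1 q.2) ?_ intervalIntegrable_const ?_
  · filter_upwards [hev] with q hq
    filter_upwards [hΦ.integrand_bound β hk (p.2 + 1)] with α hα hmem
    exact hα hmem q.1 q.2 hq.1 hq.2
  · refine ae_of_all _ fun α _ => ?_
    have hc : Continuous fun q : ℝ × ℝ => excess q.1 q.2 α := by unfold excess; fun_prop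
    exact (continuous_const.mul ((continuous_posPow hk).comp hc)).continuousAt

/-- The integral `shellInt` for the constant profile, after the substitution `u = e^y (1 - α)`. -/
theorem integral_posPow_excess (k b y : ℝ) :
    ∫ α in (0 : ℝ)..1, posPow (excess b y α) k =
      Real.exp (-y) * ∫ u in (0 : ℝ)..Real.exp y, posPow (u ^ 2 - b) k := by
  have h1 := intervalIntegral.integral_comp_sub_left (a := 0) (b := 1)
    (fun x => posPow ((Real.exp y * x) ^ 2 - b) k) 1
  have h2 := intervalIntegral.integral_comp_mul_left (a := 0) (b := 1)
    (fun u => posPow (u ^ 2 - b) k) (Real.exp_pos y).ne'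
  simp only [sub_self, sub_zero, mul_zero, mul_one, smul_eq_mul] at h1 h2
  rw [Real.exp_neg, ← h2, ← h1]
  refine intervalIntegral.integral_congr fun α _ => ?_
  simp only [excess, exp_two_mul_mul_sq]

/-- In the form `e^{-y} ∫₀^{e^y}` the prefactor decreases with `y`, so only the added piece `[e^y,
e^z]` can raise the value. It contributes at most the bound of the integrand times `e^{-z}(e^z -
e^y) ≤ z - y`. No derivative of the power is taken, so exponents below `1` are harmless. -/
theorem integral_posPow_excess_sub_le {k b y z Y : ℝ} (hk : 0 < k) (hb : 0 ≤ b) (hyz : y ≤ z)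
    (hz : z ≤ Y) :
    (∫ α in (0 : ℝ)..1, posPow (excess b z α) k) - ∫ α in (0 : ℝ)..1, posPow (excess b y α) k
      ≤ Real.exp (2 * Y * k) * (z - y) := by
  rw [integral_posPow_excess, integral_posPow_excess]
  have hc : Continuous fun u : ℝ => posPow (u ^ 2 - b) k :=
    (continuous_posPow hk).comp (by fun_prop)
  have hi : ∀ c d : ℝ, IntervalIntegrable (fun u : ℝ => posPow (u ^ 2 - b) k) volume c d :=
    fun c d => hc.intervalIntegrable c d
  have hexp : Real.exp y ≤ Real.exp z := Real.exp_le_exp.2 hyz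
  have hsplit := intervalIntegral.integral_add_adjacent_intervals
    (hi 0 (Real.exp y)) (hi (Real.exp y) (Real.exp z))
  have hB : ∀ u ∈ Icc (Real.exp y) (Real.exp z), posPow (u ^ 2 - b) k ≤ Real.exp (2 * Y * k) := by
    intro u hu
    have hu0 : 0 ≤ u := (Real.exp_pos y).le.trans hu.1
    have h1 : u ^ 2 - b ≤ Real.exp (2 * Y) := by
      have h2 : u ≤ Real.exp Y := hu.2.trans (Real.exp_le_exp.2 hz)
      have h3 : Real.exp (2 * Y) = Real.exp Y ^ 2 := by rw [← Real.exp_nat_mul]; norm_num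
      rw [h3]
      nlinarith
    calc posPow (u ^ 2 - b) k ≤ posPow (Real.exp (2 * Y)) k := posPow_mono hk h1
      _ = Real.exp (2 * Y * k) := by rw [posPow_of_pos (Real.exp_pos _), ← Real.exp_mul]
  have h4 : ∫ u in Real.exp y..Real.exp z, posPow (u ^ 2 - b) k ≤
      Real.exp (2 * Y * k) * (Real.exp z - Real.exp y) := by
    have := intervalIntegral.integral_mono_on hexp (hi _ _) intervalIntegrable_const hB
    rw [intervalIntegral.integral_const, smul_eq_mul] at this
    linarith
  have h5 : 0 ≤ ∫ u in (0 : ℝ)..Real.exp y, posPow (u ^ 2 - b) k :=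
    intervalIntegral.integral_nonneg (Real.exp_pos y).le fun u _ => posPow_nonneg _ _
  have h6 : Real.exp (-z) ≤ Real.exp (-y) := Real.exp_le_exp.2 (by linarith)
  have h7 : Real.exp (-z) * (Real.exp z - Real.exp y) ≤ z - y := by
    have e1 : Real.exp (-z) * (Real.exp z - Real.exp y) = 1 - Real.exp (y - z) := by
      rw [mul_sub, ← Real.exp_add, ← Real.exp_add]; simp [sub_eq_neg_add]
    have := Real.add_one_le_exp (y - z)
    linarith
  have hpz := Real.exp_pos (-z)
  have hpB := Real.exp_pos (2 * Y * k)
  rw [← hsplit]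
  nlinarith [mul_le_mul_of_nonneg_left h4 hpz.le, mul_le_mul_of_nonneg_left h7 hpB.le,
    mul_nonneg (sub_nonneg.2 h6) h5]

theorem excess_mono {b y z α : ℝ} (h : y ≤ z) : excess b y α ≤ excess b z α := by
  unfold excess
  gcongr

/-- `shellInt` is Lipschitz in `y`, although its integrand need not be. -/
theorem abs_shellInt_sub_le (hΦ : IsProfile Φ C) (β : ℕ) {k b y z Y : ℝ} (hk : 0 < k) (hb : 0 ≤ b)
    (hy : y ≤ Y) (hz : z ≤ Y) :
    |shellInt Φ β k b z - shellInt Φ β k b y| ≤ C * Real.exp (2 * Y * k) * |z - y| := by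
  wlog hyz : y ≤ z generalizing y z
  · rw [abs_sub_comm, abs_sub_comm z y]
    exact this hz hy (le_of_not_ge hyz)
  have hiz := hΦ.integrand_integrable β hk hb z
  have hiy := hΦ.integrand_integrable β hk hb y
  have hc : ∀ w, IntervalIntegrable (fun α => posPow (excess b w α) k) volume 0 1 := fun w =>
    ((continuous_posPow hk).comp (continuous_excess b w)).intervalIntegrable 0 1
  have hcz := hc z
  have hcy := hc y
  have hmono : ∀ α, posPow (excess b y α) k ≤ posPow (excess b z α) k := fun α =>
    posPow_mono hk (excess_mono hyz)
  have h1 : shellInt Φ β k b z - shellInt Φ β k b y =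
      ∫ α in (0 : ℝ)..1, Φ α * (1 - α) ^ β *
        (posPow (excess b z α) k - posPow (excess b y α) k) := by
    unfold shellInt
    rw [← intervalIntegral.integral_sub hiz hiy]
    simp_rw [mul_sub]
  have h0 : 0 ≤ shellInt Φ β k b z - shellInt Φ β k b y := by
    rw [h1]
    refine intervalIntegral.integral_nonneg zero_le_one fun α hα => ?_
    have : 0 ≤ 1 - α := by linarith [hα.2]
    exact mul_nonneg (mul_nonneg (hΦ.nonneg α) (by positivity)) (sub_nonneg.2 (hmono α))
  rw [abs_of_nonneg h0, abs_of_nonneg (sub_nonneg.2 hyz), h1]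
  -- The difference of the powers is nonnegative, so the weight may be replaced by its bound `C`;
  -- what remains is the estimate for a constant profile.
  calc _ ≤ ∫ α in (0 : ℝ)..1, C * (posPow (excess b z α) k - posPow (excess b y α) k) := by
        refine intervalIntegral.integral_mono_ae_restrict zero_le_one ?_ ?_ ?_
        · simpa only [mul_sub] using hiz.sub hiy
        · exact (hcz.sub hcy).const_mul C
        · rw [EventuallyLE, ae_restrict_iff' measurableSet_Icc]
          -- The comparison of integrals is over the closed interval, whereas the bound on `Φ` is
          -- given on the half-open one.
          have h0 : ∀ᵐ α : ℝ, α ≠ 0 := by simp [ae_iff]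
          filter_upwards [hΦ.bound, h0] with α hα hα0 hmem
          have hmem' : α ∈ uIoc (0 : ℝ) 1 := by
            rw [uIoc_of_le zero_le_one]
            exact ⟨lt_of_le_of_ne hmem.1 hα0.symm, hmem.2⟩
          have h1 : 0 ≤ 1 - α := by linarith [hmem.2]
          have h2 : (1 - α) ^ β ≤ 1 := pow_le_one₀ h1 (by linarith [hmem.1])
          refine mul_le_mul_of_nonneg_right ?_ (sub_nonneg.2 (hmono α))
          calc Φ α * (1 - α) ^ β ≤ C * 1 :=
                mul_le_mul (hα hmem') h2 (by positivity) hΦ.bound_nonneg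
            _ = C := mul_one C
    _ = C * ((∫ α in (0 : ℝ)..1, posPow (excess b z α) k)
          - ∫ α in (0 : ℝ)..1, posPow (excess b y α) k) := by
        rw [intervalIntegral.integral_const_mul, intervalIntegral.integral_sub hcz hcy]
    _ ≤ C * (Real.exp (2 * Y * k) * (z - y)) :=
        mul_le_mul_of_nonneg_left (integral_posPow_excess_sub_le hk hb hyz hz) hΦ.bound_nonneg
    _ = _ := by ring

/-- Differentiation of `shellInt` along a `C¹` curve. -/
theorem hasDerivAt_shellInt (hΦ : IsProfile Φ C) {k : ℝ} (hk : 1 < k) {b y b' y' : ℝ → ℝ} {r : ℝ}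
    (hb : ∀ᶠ x in 𝓝 r, HasDerivAt b (b' x) x) (hy : ∀ᶠ x in 𝓝 r, HasDerivAt y (y' x) x)
    (hb' : ContinuousAt b' r) (hy' : ContinuousAt y' r) (hbr : 0 < b r) :
    HasDerivAt (fun x => shellInt Φ 0 k (b x) (y x))
      (k * (2 * y' r * Real.exp (2 * y r) * shellInt Φ 2 (k - 1) (b r) (y r)
        - b' r * shellInt Φ 0 (k - 1) (b r) (y r))) r := by
  have hk0 : 0 < k := by linarith
  -- A positive exponent after differentiation keeps the derivative bounded. In the application `k =
  -- l + 3/2`, and the condition becomes `l > -1/2`.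
  have hk1 : 0 < k - 1 := by linarith
  set Y := y r + 1
  set A := |y' r| + 1
  set B := |b' r| + 1
  have hev : ∀ᶠ x in 𝓝 r, HasDerivAt b (b' x) x ∧ HasDerivAt y (y' x) x ∧ y x ≤ Y ∧ 0 ≤ b x ∧
      |y' x| ≤ A ∧ |b' x| ≤ B := by
    have e1 := hy.self_of_nhds.continuousAt.tendsto.eventually (gt_mem_nhds (lt_add_one (y r)))
    have e2 := hb.self_of_nhds.continuousAt.tendsto.eventually (lt_mem_nhds hbr)
    have e3 := hy'.abs.tendsto.eventually (gt_mem_nhds (lt_add_one (|y' r|)))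
    have e4 := hb'.abs.tendsto.eventually (gt_mem_nhds (lt_add_one (|b' r|)))
    filter_upwards [hb, hy, e1, e2, e3, e4] with x h1 h2 h3 h4 h5 h6
    exact ⟨h1, h2, h3.le, h4.le, h5.le, h6.le⟩
  have hd := intervalIntegral.hasDerivAt_integral_of_dominated_loc_of_deriv_le (a := 0) (b := 1)
    (μ := volume)
    (F := fun x α => Φ α * (1 - α) ^ 0 * posPow (excess (b x) (y x) α) k)
    (F' := fun x α => k * (2 * y' x * Real.exp (2 * y x) *
        (Φ α * (1 - α) ^ 2 * posPow (excess (b x) (y x) α) (k - 1))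
        - b' x * (Φ α * (1 - α) ^ 0 * posPow (excess (b x) (y x) α) (k - 1))))
    (bound := fun _ => k * (2 * A * Real.exp (2 * Y) * (C * Real.exp (2 * Y * (k - 1)))
      + B * (C * Real.exp (2 * Y * (k - 1)))))
    hev
    (Eventually.of_forall fun x => hΦ.integrand_meas 0 hk0 (b x) (y x))
    (hΦ.integrand_integrable 0 hk0 hbr.le (y r))
    (((hΦ.integrand_meas 2 hk1 (b r) (y r)).const_mul _ |>.sub
      ((hΦ.integrand_meas 0 hk1 (b r) (y r)).const_mul _)).const_mul _)
    (by
      filter_upwards [hΦ.integrand_bound 2 hk1 Y, hΦ.integrand_bound 0 hk1 Y]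
        with α h2 h0 hmem x hx
      obtain ⟨-, -, hxy, hxb, hxA, hxB⟩ := hx
      have g2 := h2 hmem (b x) (y x) hxb hxy
      have g0 := h0 hmem (b x) (y x) hxb hxy
      have hE : Real.exp (2 * y x) ≤ Real.exp (2 * Y) := Real.exp_le_exp.2 (by linarith)
      rw [norm_mul, Real.norm_of_nonneg hk0.le]
      refine mul_le_mul_of_nonneg_left ((norm_sub_le _ _).trans (add_le_add ?_ ?_)) hk0.le
      · rw [norm_mul, norm_mul, norm_mul, Real.norm_of_nonneg (Real.exp_pos _).le,
          Real.norm_of_nonneg zero_le_two, Real.norm_eq_abs (y' x)]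
        gcongr
      · rw [norm_mul, Real.norm_eq_abs (b' x)]
        gcongr)
    intervalIntegrable_const
    (by
      refine ae_of_all _ fun α _ x hx => ?_
      obtain ⟨hxb, hxy, -⟩ := hx
      have e1 : HasDerivAt (fun x => excess (b x) (y x) α)
          (Real.exp (2 * y x) * (2 * y' x) * (1 - α) ^ 2 - b' x) x :=
        (((hxy.const_mul 2).exp).mul_const _).sub hxb
      have e2 := ((hasDerivAt_posPow hk _).comp x e1).const_mul (Φ α * (1 - α) ^ 0)
      refine e2.congr_deriv ?_
      ring)
  refine hd.2.congr_deriv ?_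
  rw [intervalIntegral.integral_const_mul, intervalIntegral.integral_sub
    ((hΦ.integrand_integrable 2 hk1 hbr.le _).const_mul _)
    ((hΦ.integrand_integrable 0 hk1 hbr.le _).const_mul _),
    intervalIntegral.integral_const_mul, intervalIntegral.integral_const_mul]
  rfl

end

section

/-! ### The functions `G` and `H` -/

/-- Beyond the cut-off the positive part is zero. Trading the moving limit of integration for a
positive part makes continuity and differentiation in the parameters accessible to dominated
convergence. -/
theorem integral_cutoff_eq_shellInt (Φ : ℝ → ℝ) (C : ℝ) (hΦ : IsProfile Φ C) (β : ℕ) {k b y : ℝ}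
    (hk : 0 < k) (hb : 0 ≤ b) (h : Real.exp (-y) * Real.sqrt b < 1) :
    ∫ α in (0 : ℝ)..(1 - Real.exp (-y) * Real.sqrt b),
      Φ α * (1 - α) ^ β * (Real.exp (2 * y) * (1 - α) ^ 2 - b) ^ k = shellInt Φ β k b y := by
  set T := 1 - Real.exp (-y) * Real.sqrt b with hT
  have hT0 : 0 < T := by linarith
  have hT1 : T ≤ 1 := by
    have : 0 ≤ Real.exp (-y) * Real.sqrt b := by positivity
    linarith
  have hint := hΦ.integrand_integrable β hk hb y
  have hi1 := hint.mono_set (c := 0) (d := T) (by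
    rw [uIcc_of_le hT0.le, uIcc_of_le zero_le_one]; exact Icc_subset_Icc le_rfl hT1)
  have hi2 := hint.mono_set (c := T) (d := 1) (by
    rw [uIcc_of_le hT1, uIcc_of_le zero_le_one]; exact Icc_subset_Icc hT0.le le_rfl)
  unfold shellInt
  rw [← intervalIntegral.integral_add_adjacent_intervals hi1 hi2]
  have h2 : ∫ α in T..1, Φ α * (1 - α) ^ β * posPow (excess b y α) k = 0 := by
    refine (intervalIntegral.integral_congr (g := fun _ => (0 : ℝ)) fun α hα => ?_).trans
      intervalIntegral.integral_zero
    rw [uIcc_of_le hT1] at hα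
    beta_reduce
    rw [posPow_of_nonpos, mul_zero]
    by_contra! hc
    exact absurd ((excess_pos_iff hα.2 hb).1 hc) (not_lt.2 hα.1)
  rw [h2, add_zero]
  refine intervalIntegral.integral_congr_Ioo_of_le hT0.le fun α hα => ?_
  rw [posPow_of_pos ((excess_pos_iff (by linarith [hα.2]) hb).2 hα.2)]
  rfl

variable {Φ : ℝ → ℝ} {C : ℝ}

theorem G_eq (hΦ : IsProfile Φ C) {l L0 r y : ℝ} (hl : -(1 / 2) < l) (hL0 : 0 ≤ L0) :
    G Φ l L0 r y = 2 * Real.pi * cConst l * r ^ (2 * l) * Real.exp (3 * y) *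
      shellInt Φ 2 (l + 1 / 2) (1 + L0 / r ^ 2) y := by
  have hb : 0 ≤ 1 + L0 / r ^ 2 := by positivity
  unfold G
  split_ifs with h
  · rw [← integral_cutoff_eq_shellInt Φ C hΦ 2 (by linarith) hb h]
    simp only [sub_sub]
  · rw [shellInt_eq_zero hb (not_lt.1 h), mul_zero]

theorem H_eq (hΦ : IsProfile Φ C) {l L0 r y : ℝ} (hl : -(1 / 2) < l) (hL0 : 0 ≤ L0) :
    H Φ l L0 r y = 2 * Real.pi * dConst l * r ^ (2 * l) * Real.exp y *
      shellInt Φ 0 (l + 3 / 2) (1 + L0 / r ^ 2) y := by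
  have hb : 0 ≤ 1 + L0 / r ^ 2 := by positivity
  unfold H
  split_ifs with h
  · rw [← integral_cutoff_eq_shellInt Φ C hΦ 0 (by linarith) hb h]
    simp only [sub_sub, pow_zero, mul_one]
  · rw [shellInt_eq_zero hb (not_lt.1 h), mul_zero]

theorem G_nonneg (hΦ : IsProfile Φ C) {l L0 r y : ℝ} (hl : -(1 / 2) < l) (hL0 : 0 ≤ L0)
    (hr : 0 < r) : 0 ≤ G Φ l L0 r y := by
  rw [G_eq hΦ hl hL0]
  have h1 := shellInt_nonneg hΦ 2 (l + 1 / 2) (1 + L0 / r ^ 2) y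
  have h2 := cConst_pos hl
  positivity

theorem H_nonneg (hΦ : IsProfile Φ C) {l L0 r y : ℝ} (hl : -(1 / 2) < l) (hL0 : 0 ≤ L0)
    (hr : 0 < r) : 0 ≤ H Φ l L0 r y := by
  rw [H_eq hΦ hl hL0]
  have h1 := shellInt_nonneg hΦ 0 (l + 3 / 2) (1 + L0 / r ^ 2) y
  have h2 := dConst_pos hl
  positivity

theorem G_eq_zero {l L0 r y : ℝ} (h : 1 ≤ Real.exp (-y) * Real.sqrt (1 + L0 / r ^ 2)) :
    G Φ l L0 r y = 0 := if_neg (not_lt.2 h)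

theorem H_eq_zero {l L0 r y : ℝ} (h : 1 ≤ Real.exp (-y) * Real.sqrt (1 + L0 / r ^ 2)) :
    H Φ l L0 r y = 0 := if_neg (not_lt.2 h)

theorem G_pos (hΦ : IsProfile Φ C) {l L0 r y : ℝ} (hl : -(1 / 2) < l) (hL0 : 0 ≤ L0)
    (hr : 0 < r) (h : Real.exp (-y) * Real.sqrt (1 + L0 / r ^ 2) < 1) : 0 < G Φ l L0 r y := by
  rw [G_eq hΦ hl hL0]
  have h1 := shellInt_pos hΦ 2 (k := l + 1 / 2) (b := 1 + L0 / r ^ 2) (by linarith)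
    (by positivity) h
  have h2 := cConst_pos hl
  positivity

theorem H_pos (hΦ : IsProfile Φ C) {l L0 r y : ℝ} (hl : -(1 / 2) < l) (hL0 : 0 ≤ L0)
    (hr : 0 < r) (h : Real.exp (-y) * Real.sqrt (1 + L0 / r ^ 2) < 1) : 0 < H Φ l L0 r y := by
  rw [H_eq hΦ hl hL0]
  have h1 := shellInt_pos hΦ 0 (k := l + 3 / 2) (b := 1 + L0 / r ^ 2) (by linarith)
    (by positivity) h
  have h2 := dConst_pos hl
  positivity

/-- No matter is present where `y` is non-positive. -/
theorem one_le_of_nonpos {L0 r y : ℝ} (hL0 : 0 ≤ L0) (hy : y ≤ 0) :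
    1 ≤ Real.exp (-y) * Real.sqrt (1 + L0 / r ^ 2) := by
  have h1 : 1 ≤ Real.exp (-y) := Real.one_le_exp (by linarith)
  have h2 : 1 ≤ Real.sqrt (1 + L0 / r ^ 2) := Real.one_le_sqrt.2 (by
    have : 0 ≤ L0 / r ^ 2 := by positivity
    linarith)
  nlinarith

theorem continuousAt_weight_mul_exp_mul_shellInt (hΦ : IsProfile Φ C) (β : ℕ) {k l L0 a c : ℝ}
    (hk : 0 < k) (hL0 : 0 ≤ L0) (p : ℝ × ℝ) (hp : 0 < p.1) :
    ContinuousAt (fun p : ℝ × ℝ => a * p.1 ^ (2 * l) * Real.exp (c * p.2) *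
      shellInt Φ β k (1 + L0 / p.1 ^ 2) p.2) p := by
  have h1 : ContinuousAt (fun p : ℝ × ℝ => p.1 ^ (2 * l)) p :=
    continuousAt_fst.rpow_const (Or.inl hp.ne')
  have h2 : ContinuousAt (fun p : ℝ × ℝ => Real.exp (c * p.2)) p := by fun_prop
  have h3 : ContinuousAt (fun p : ℝ × ℝ => ((1 + L0 / p.1 ^ 2, p.2) : ℝ × ℝ)) p := by
    have : p.1 ^ 2 ≠ 0 := by positivity
    fun_prop (disch := assumption)
  have hpos : 0 < 1 + L0 / p.1 ^ 2 := by positivity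
  have h4 := ContinuousAt.comp (f := fun p : ℝ × ℝ => ((1 + L0 / p.1 ^ 2, p.2) : ℝ × ℝ)) (x := p)
    (continuousAt_shellInt hΦ β hk (1 + L0 / p.1 ^ 2, p.2) hpos) h3
  exact ((continuousAt_const.mul h1).mul h2).mul h4

theorem continuousAt_G (hΦ : IsProfile Φ C) {l L0 : ℝ} (hl : -(1 / 2) < l) (hL0 : 0 ≤ L0)
    (p : ℝ × ℝ) (hp : 0 < p.1) : ContinuousAt (fun p : ℝ × ℝ => G Φ l L0 p.1 p.2) p := by
  simp_rw [G_eq hΦ hl hL0]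
  exact continuousAt_weight_mul_exp_mul_shellInt hΦ 2 (by linarith) hL0 p hp

theorem continuousAt_H (hΦ : IsProfile Φ C) {l L0 : ℝ} (hl : -(1 / 2) < l) (hL0 : 0 ≤ L0)
    (p : ℝ × ℝ) (hp : 0 < p.1) : ContinuousAt (fun p : ℝ × ℝ => H Φ l L0 p.1 p.2) p := by
  simp_rw [H_eq hΦ hl hL0]
  have := continuousAt_weight_mul_exp_mul_shellInt (k := l + 3 / 2) (l := l) (c := 1)
    (a := 2 * Real.pi * dConst l) hΦ 0 (by linarith) hL0 p hp
  simpa only [one_mul] using this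

/-- Locally uniform bounds for `exp (c y) * shellInt` and its Lipschitz constant in `y`. -/
theorem exp_mul_shellInt_lipschitz (hΦ : IsProfile Φ C) (β : ℕ) {k c : ℝ} (hk : 0 < k)
    (hc : 0 ≤ c) (Y : ℝ) : ∃ B, 0 ≤ B ∧ ∀ b y z, 0 ≤ b → y ≤ Y → z ≤ Y →
      |Real.exp (c * y) * shellInt Φ β k b y| ≤ B ∧
      |Real.exp (c * z) * shellInt Φ β k b z - Real.exp (c * y) * shellInt Φ β k b y|
        ≤ B * |z - y| := by
  set S := C * Real.exp (2 * Y * k)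
  set X := Real.exp (c * Y)
  have hS : 0 ≤ S := mul_nonneg hΦ.bound_nonneg (Real.exp_pos _).le
  have hX : 0 ≤ X := (Real.exp_pos _).le
  have hexp : ∀ y, y ≤ Y → Real.exp (c * y) ≤ X := fun y hy =>
    Real.exp_le_exp.2 (mul_le_mul_of_nonneg_left hy hc)
  have hlip : ∀ y z, y ≤ Y → z ≤ Y → |Real.exp (c * z) - Real.exp (c * y)| ≤ X * c * |z - y| := by
    intro y z hy hz
    wlog hyz : y ≤ z generalizing y z
    · rw [abs_sub_comm, abs_sub_comm z y]
      exact this z y hz hy (le_of_not_ge hyz)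
    have h1 : Real.exp (c * y) ≤ Real.exp (c * z) :=
      Real.exp_le_exp.2 (mul_le_mul_of_nonneg_left hyz hc)
    rw [abs_of_nonneg (sub_nonneg.2 h1), abs_of_nonneg (sub_nonneg.2 hyz)]
    have h2 := Real.add_one_le_exp (c * y - c * z)
    have h3 : Real.exp (c * y) = Real.exp (c * z) * Real.exp (c * y - c * z) := by
      rw [← Real.exp_add]; ring_nf
    have h4 := hexp z hz
    have h5 := Real.exp_pos (c * z)
    have h6 : 0 ≤ c * (z - y) := mul_nonneg hc (sub_nonneg.2 hyz)
    rw [h3]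
    nlinarith [mul_le_mul_of_nonneg_right h4 h6]
  refine ⟨X * S + X * c * S, by positivity, fun b y z hb hy hz => ?_⟩
  have sy0 := shellInt_nonneg hΦ β k b y
  have sy := shellInt_le hΦ β hk hb hy
  have ey := Real.exp_pos (c * y)
  have ez := Real.exp_pos (c * z)
  constructor
  · rw [abs_of_nonneg (by positivity)]
    calc _ ≤ X * S := mul_le_mul (hexp y hy) sy sy0 hX
      _ ≤ _ := le_add_of_nonneg_right (by positivity)
  · have e : Real.exp (c * z) * shellInt Φ β k b z - Real.exp (c * y) * shellInt Φ β k b y =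
        Real.exp (c * z) * (shellInt Φ β k b z - shellInt Φ β k b y) +
        (Real.exp (c * z) - Real.exp (c * y)) * shellInt Φ β k b y := by ring
    rw [e]
    refine (abs_add_le _ _).trans ?_
    rw [abs_mul, abs_mul, abs_of_pos ez, abs_of_nonneg sy0, add_mul]
    have h1 := abs_shellInt_sub_le hΦ β hk hb hy hz
    have h2 := hlip y z hy hz
    refine add_le_add ?_ ?_
    · calc _ ≤ X * (S * |z - y|) := mul_le_mul (hexp z hz) h1 (abs_nonneg _) hX
        _ = _ := by ring
    · calc _ ≤ X * c * |z - y| * S := mul_le_mul h2 sy sy0 (by positivity)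
        _ = _ := by ring

theorem weight_mul_lipschitz {w : ℝ → ℝ} {F : ℝ → ℝ → ℝ} {a b : ℝ} {Y : ℝ}
    (hw : ContinuousOn w (Icc a b))
    (hF : ∃ B, 0 ≤ B ∧ ∀ r y z, y ≤ Y → z ≤ Y → |F r y| ≤ B ∧ |F r z - F r y| ≤ B * |z - y|) :
    ∃ K, 0 ≤ K ∧ ∀ r ∈ Icc a b, ∀ y z, y ≤ Y → z ≤ Y →
      |w r * F r y| ≤ K ∧ |w r * F r z - w r * F r y| ≤ K * |z - y| := by
  obtain ⟨W, hW⟩ := isCompact_Icc.exists_bound_of_continuousOn hw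
  obtain ⟨B, hB, hF⟩ := hF
  refine ⟨|W| * B, by positivity, fun r hr y z hy hz => ?_⟩
  have h1 : |w r| ≤ |W| := (hW r hr).trans (le_abs_self _)
  obtain ⟨h2, h3⟩ := hF r y z hy hz
  constructor
  · rw [abs_mul]
    exact mul_le_mul h1 h2 (abs_nonneg _) (abs_nonneg _)
  · rw [← mul_sub, abs_mul, mul_assoc]
    exact mul_le_mul h1 h3 (abs_nonneg _) (abs_nonneg _)

theorem G_lipschitz (hΦ : IsProfile Φ C) {l L0 a b : ℝ} (hl : -(1 / 2) < l) (hL0 : 0 ≤ L0)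
    {w : ℝ → ℝ} (hw : ContinuousOn w (Icc a b)) (ha : 0 < a) (Y : ℝ) :
    ∃ K, 0 ≤ K ∧ ∀ r ∈ Icc a b, ∀ y z, y ≤ Y → z ≤ Y →
      |w r * G Φ l L0 r y| ≤ K ∧ |w r * G Φ l L0 r z - w r * G Φ l L0 r y| ≤ K * |z - y| := by
  obtain ⟨B, hB, h⟩ := exp_mul_shellInt_lipschitz hΦ 2 (k := l + 1 / 2) (c := 3) (by linarith)
    (by norm_num) Y
  have hw' : ContinuousOn (fun r : ℝ => w r * (2 * Real.pi * cConst l * r ^ (2 * l))) (Icc a b) := by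
    refine hw.mul (continuousOn_const.mul (continuousOn_id.rpow_const fun r hr => Or.inl ?_))
    exact (ha.trans_le hr.1).ne'
  obtain ⟨K, hK, hKb⟩ := weight_mul_lipschitz hw'
    (F := fun r y => Real.exp (3 * y) * shellInt Φ 2 (l + 1 / 2) (1 + L0 / r ^ 2) y) (Y := Y)
    ⟨B, hB, fun r y z hy hz => h (1 + L0 / r ^ 2) y z (by positivity) hy hz⟩
  refine ⟨K, hK, fun r hr y z hy hz => ?_⟩
  have := hKb r hr y z hy hz
  simp only [G_eq hΦ hl hL0]
  simpa only [mul_assoc] using this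

theorem H_lipschitz (hΦ : IsProfile Φ C) {l L0 a b : ℝ} (hl : -(1 / 2) < l) (hL0 : 0 ≤ L0)
    {w : ℝ → ℝ} (hw : ContinuousOn w (Icc a b)) (ha : 0 < a) (Y : ℝ) :
    ∃ K, 0 ≤ K ∧ ∀ r ∈ Icc a b, ∀ y z, y ≤ Y → z ≤ Y →
      |w r * H Φ l L0 r y| ≤ K ∧ |w r * H Φ l L0 r z - w r * H Φ l L0 r y| ≤ K * |z - y| := by
  obtain ⟨B, hB, h⟩ := exp_mul_shellInt_lipschitz hΦ 0 (k := l + 3 / 2) (c := 1) (by linarith)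
    (by norm_num) Y
  have hw' : ContinuousOn (fun r : ℝ => w r * (2 * Real.pi * dConst l * r ^ (2 * l))) (Icc a b) := by
    refine hw.mul (continuousOn_const.mul (continuousOn_id.rpow_const fun r hr => Or.inl ?_))
    exact (ha.trans_le hr.1).ne'
  obtain ⟨K, hK, hKb⟩ := weight_mul_lipschitz hw'
    (F := fun r y => Real.exp (1 * y) * shellInt Φ 0 (l + 3 / 2) (1 + L0 / r ^ 2) y) (Y := Y)
    ⟨B, hB, fun r y z hy hz => h (1 + L0 / r ^ 2) y z (by positivity) hy hz⟩
  refine ⟨K, hK, fun r hr y z hy hz => ?_⟩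
  have := hKb r hr y z hy hz
  simp only [H_eq hΦ hl hL0]
  simpa only [mul_assoc, one_mul] using this

end

section

/-! ### Momentum integrals in the variables `u = √(1 + |v|²)` and `τ = |x × v|² / r²` -/

open scoped ENNReal

theorem angMom_eq (x v : E3) : angMom x v = ‖x‖ ^ 2 * ‖v‖ ^ 2 - (inner ℝ x v) ^ 2 := by
  unfold angMom
  simp only [EuclideanSpace.real_norm_sq_eq, cross_apply, PiLp.inner_apply, Fin.sum_univ_three]
  simp
  ring

theorem lintegral_Ioi_sq (h : ℝ → ℝ≥0∞) :
    ∫⁻ s in Ioi (0 : ℝ), h s = ∫⁻ q in Ioi (0 : ℝ), ENNReal.ofReal (2 * q) * h (q ^ 2) := by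
  have himg : (fun q : ℝ => q ^ 2) '' Ioi 0 = Ioi 0 := by
    ext s
    constructor
    · rintro ⟨q, hq, rfl⟩
      exact pow_pos (show (0 : ℝ) < q from hq) 2
    · intro hs
      exact ⟨Real.sqrt s, Real.sqrt_pos.2 hs, Real.sq_sqrt (le_of_lt hs)⟩
  have hinj : InjOn (fun q : ℝ => q ^ 2) (Ioi 0) := fun p hp q hq hpq =>
    (pow_left_inj₀ (le_of_lt hp) (le_of_lt hq) two_ne_zero).1 hpq
  have := lintegral_image_eq_lintegral_abs_deriv_mul (f := fun q : ℝ => q ^ 2)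
    (f' := fun q => 2 * q) measurableSet_Ioi
    (fun q _ => by simpa using (hasDerivAt_pow 2 q).hasDerivWithinAt) hinj h
  rw [himg] at this
  rw [this]
  refine setLIntegral_congr_fun measurableSet_Ioi fun q hq => ?_
  have hq' : 0 < q := hq
  rw [abs_of_pos (by positivity)]

/-- Radial integration in the plane. -/
theorem lintegral_plane_radial {h : ℝ → ℝ≥0∞} (hh : Measurable h) :
    ∫⁻ p : ℝ × ℝ, h (p.1 ^ 2 + p.2 ^ 2) = ENNReal.ofReal Real.pi * ∫⁻ s in Ioi (0 : ℝ), h s := by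
  rw [← lintegral_comp_polarCoord_symm, lintegral_Ioi_sq, polarCoord_target]
  have h1 : ∀ p : ℝ × ℝ, ENNReal.ofReal p.1 • h ((polarCoord.symm p).1 ^ 2 +
      (polarCoord.symm p).2 ^ 2) = ENNReal.ofReal p.1 * h (p.1 ^ 2) := by
    intro p
    have : (polarCoord.symm p).1 ^ 2 + (polarCoord.symm p).2 ^ 2 = p.1 ^ 2 := by
      simp only [polarCoord_symm_apply]
      linear_combination p.1 ^ 2 * Real.sin_sq_add_cos_sq p.2
    rw [this, smul_eq_mul]
  simp_rw [h1]
  rw [Measure.volume_eq_prod, ← Measure.prod_restrict, lintegral_prod _ (by fun_prop)]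
  simp only [lintegral_const, Measure.restrict_apply MeasurableSet.univ, univ_inter,
    Real.volume_Ioo]
  rw [lintegral_mul_const _ (by fun_prop), mul_comm]
  simp_rw [ENNReal.ofReal_mul (zero_le_two (α := ℝ)), mul_assoc]
  rw [lintegral_const_mul _ (by fun_prop), ← mul_assoc, ← ENNReal.ofReal_mul (by positivity)]
  congr 2
  ring

theorem lintegral_comp_sq {h : ℝ → ℝ≥0∞} :
    ∫⁻ w : ℝ, h (w ^ 2) = 2 * ∫⁻ w in Ioi (0 : ℝ), h (w ^ 2) := by
  have h1 : ∫⁻ w in Iic (0 : ℝ), h (w ^ 2) = ∫⁻ w in Ioi (0 : ℝ), h (w ^ 2) := by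
    have hm := (Measure.measurePreserving_neg (volume : Measure ℝ)).setLIntegral_comp_preimage_emb
      (MeasurableEquiv.neg ℝ).measurableEmbedding (fun w => h (w ^ 2)) (Iio 0)
    rw [← restrict_Iio_eq_restrict_Iic, ← hm]
    simp
  rw [← lintegral_add_compl (fun w : ℝ => h (w ^ 2)) (measurableSet_Iic (a := (0 : ℝ))),
    compl_Iic, h1, two_mul]

/-- The density of the variables `(u, τ)`; it vanishes for `τ ≥ u² - 1`. -/
def momDensity (u τ : ℝ) : ℝ := u / Real.sqrt (u ^ 2 - 1 - τ)

theorem measurable_momDensity : Measurable fun p : ℝ × ℝ => momDensity p.1 p.2 := by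
  unfold momDensity
  fun_prop

/-- Substitution `u = √(1 + w² + τ)`, for which `dw = (u/w) du` with `w = √(u² - 1 - τ)`. -/
theorem lintegral_radial_momentum {τ : ℝ} (hτ : 0 < τ) (k : ℝ → ℝ≥0∞) :
    ∫⁻ w in Ioi (0 : ℝ), k (Real.sqrt (1 + (w ^ 2 + τ))) =
      ∫⁻ u in Ioi (0 : ℝ), ENNReal.ofReal (momDensity u τ) * k u := by
  set c := Real.sqrt (1 + τ)
  have hc0 : 0 < c := Real.sqrt_pos.2 (by linarith)
  have hcs : c ^ 2 = 1 + τ := Real.sq_sqrt (by linarith)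
  set φ : ℝ → ℝ := fun w => Real.sqrt (1 + (w ^ 2 + τ)) with hφ
  have hφs : ∀ w, φ w ^ 2 = 1 + (w ^ 2 + τ) := fun w => Real.sq_sqrt (by positivity)
  have hφp : ∀ w, 0 < φ w := fun w => Real.sqrt_pos.2 (by positivity)
  have himg : φ '' Ioi 0 = Ioi c := by
    ext u
    constructor
    · rintro ⟨w, hw, rfl⟩
      have hw' : 0 < w := hw
      exact Real.sqrt_lt_sqrt (by linarith) (by nlinarith)
    · intro hu
      have hu' : c < u := hu
      have h1 : 0 < u ^ 2 - 1 - τ := by nlinarith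
      refine ⟨Real.sqrt (u ^ 2 - 1 - τ), Real.sqrt_pos.2 h1, ?_⟩
      simp only [hφ]
      rw [Real.sq_sqrt h1.le, show 1 + (u ^ 2 - 1 - τ + τ) = u ^ 2 by ring]
      exact Real.sqrt_sq (by linarith)
  have hinj : InjOn φ (Ioi 0) := by
    intro p hp q hq hpq
    have h1 := hφs p
    have h2 := hφs q
    rw [hpq] at h1
    exact (pow_left_inj₀ (le_of_lt hp) (le_of_lt hq) two_ne_zero).1 (by linarith)
  have hcv := lintegral_image_eq_lintegral_abs_deriv_mul (f := φ)
    (f' := fun w => w / φ w) (s := Ioi 0) measurableSet_Ioi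
    (fun w _ => by
      have h1 : HasDerivAt (fun w : ℝ => 1 + (w ^ 2 + τ)) (2 * w) w := by
        simpa using ((hasDerivAt_pow 2 w).add_const τ).const_add 1
      have h2 := h1.sqrt (by positivity)
      refine (h2.congr_deriv ?_).hasDerivWithinAt
      exact mul_div_mul_left w (φ w) two_ne_zero) hinj
    (fun u => ENNReal.ofReal (momDensity u τ) * k u)
  rw [himg] at hcv
  -- For `0 < u ≤ c` the square root in the density is `0`, and division by `0` gives `0`; the range
  -- of `u` can therefore be all of `]0, ∞[`, independent of `τ`.
  have hsub : ∫⁻ u in Ioi (0 : ℝ), ENNReal.ofReal (momDensity u τ) * k u =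
      ∫⁻ u in Ioi c, ENNReal.ofReal (momDensity u τ) * k u := by
    rw [← lintegral_indicator measurableSet_Ioi, ← lintegral_indicator measurableSet_Ioi]
    refine lintegral_congr fun u => ?_
    by_cases hu : c < u
    · rw [indicator_of_mem (show u ∈ Ioi (0 : ℝ) from hc0.trans hu),
        indicator_of_mem (show u ∈ Ioi c from hu)]
    · rw [indicator_of_notMem (show u ∉ Ioi c from hu)]
      by_cases hu0 : 0 < u
      · have h1 : u ^ 2 - 1 - τ ≤ 0 := by nlinarith [not_lt.1 hu]
        rw [indicator_of_mem (show u ∈ Ioi (0 : ℝ) from hu0), momDensity,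
          Real.sqrt_eq_zero_of_nonpos h1, div_zero, ENNReal.ofReal_zero, zero_mul]
      · exact indicator_of_notMem (show u ∉ Ioi (0 : ℝ) from hu0) _
  rw [hsub, hcv]
  refine setLIntegral_congr_fun measurableSet_Ioi fun w hw => ?_
  have hw' : 0 < w := hw
  have hp := hφp w
  rw [← mul_assoc, ← ENNReal.ofReal_mul (abs_nonneg _), abs_of_pos (by positivity), momDensity,
    hφs, show 1 + (w ^ 2 + τ) - 1 - τ = w ^ 2 by ring, Real.sqrt_sq hw'.le,
    div_mul_div_cancel₀ hp.ne', div_self hw'.ne', ENNReal.ofReal_one, one_mul]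

theorem measurePreserving_coords :
    MeasurePreserving (fun v : E3 => (v 0, (v 1, v 2))) volume
      (volume : Measure (ℝ × (ℝ × ℝ))) := by
  have h1 := PiLp.volume_preserving_ofLp (ι := Fin 3)
  have h2 := volume_preserving_piFinSuccAbove (fun _ : Fin 3 => ℝ) 0
  have h3 := (MeasurePreserving.id (volume : Measure ℝ)).prod (volume_preserving_finTwoArrow ℝ)
  exact (h3.comp h2).comp h1

/-- Two vectors of equal length are exchanged by the reflection in the hyperplane orthogonal to
their difference. Orientation is irrelevant for volume integrals. -/
theorem exists_isometry_axis (x : E3) : ∃ A : E3 ≃ₗᵢ[ℝ] E3, A (axisPt ‖x‖) = x := by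
  refine ⟨(Submodule.span ℝ {axisPt ‖x‖ - x})ᗮ.reflection, Submodule.reflection_sub ?_⟩
  simp [axisPt]

/-- The momentum variables `(u, τ)` at the point `x`. -/
def velMap (x v : E3) : ℝ × ℝ := (Real.sqrt (1 + ‖v‖ ^ 2), angMom x v / ‖x‖ ^ 2)

theorem measurable_velMap (x : E3) : Measurable (velMap x) := by
  unfold velMap
  simp_rw [angMom_eq]
  fun_prop

/-- With `x` moved to the first axis, `v 0` is the radial momentum and `τ = v 1² + v 2²`. Polar
coordinates in the transverse plane give the factor `π`, the two signs of the radial momentum the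
factor `2`. -/
theorem lintegral_velMap {x : E3} (hx : x ≠ 0) {g : ℝ × ℝ → ℝ≥0∞} (hg : Measurable g) :
    ∫⁻ v : E3, g (velMap x v) = ENNReal.ofReal (2 * Real.pi) *
      ∫⁻ τ in Ioi (0 : ℝ), ∫⁻ u in Ioi (0 : ℝ), ENNReal.ofReal (momDensity u τ) * g (u, τ) := by
  have hr : 0 < ‖x‖ := norm_pos_iff.2 hx
  obtain ⟨A, hA⟩ := exists_isometry_axis x
  have h1 : ∀ v : E3, velMap x (A v) =
      (Real.sqrt (1 + (v 0 ^ 2 + (v 1 ^ 2 + v 2 ^ 2))), v 1 ^ 2 + v 2 ^ 2) := by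
    intro v
    have hin : inner ℝ x (A v) = ‖x‖ * v 0 := by
      conv_lhs => rw [← hA]
      rw [A.inner_map_map, axisPt, EuclideanSpace.inner_single_left]
      simp
    have hn : ‖v‖ ^ 2 = v 0 ^ 2 + (v 1 ^ 2 + v 2 ^ 2) := by
      rw [EuclideanSpace.real_norm_sq_eq, Fin.sum_univ_three, add_assoc]
    simp only [velMap, angMom_eq, A.norm_map, hin, hn]
    congr 1
    field_simp
    ring
  have h0 := A.measurePreserving.lintegral_comp (hg.comp (measurable_velMap x))
  simp only [Function.comp_apply, h1] at h0
  rw [← h0]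
  have h2 := measurePreserving_coords.lintegral_comp
    (f := fun p : ℝ × (ℝ × ℝ) => g (Real.sqrt (1 + (p.1 ^ 2 + (p.2.1 ^ 2 + p.2.2 ^ 2))),
      p.2.1 ^ 2 + p.2.2 ^ 2)) (by fun_prop)
  rw [h2, Measure.volume_eq_prod, lintegral_prod _ (by fun_prop)]
  have h3 : ∀ w : ℝ, ∫⁻ p : ℝ × ℝ, g (Real.sqrt (1 + (w ^ 2 + (p.1 ^ 2 + p.2 ^ 2))),
      p.1 ^ 2 + p.2 ^ 2) = ENNReal.ofReal Real.pi *
        ∫⁻ τ in Ioi (0 : ℝ), g (Real.sqrt (1 + (w ^ 2 + τ)), τ) := fun w =>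
    lintegral_plane_radial (h := fun τ => g (Real.sqrt (1 + (w ^ 2 + τ)), τ)) (by fun_prop)
  simp_rw [h3]
  rw [lintegral_const_mul _ (Measurable.lintegral_prod_right' (f := fun p : ℝ × ℝ =>
    g (Real.sqrt (1 + (p.1 ^ 2 + p.2)), p.2)) (by fun_prop)), lintegral_lintegral_swap (by fun_prop)]
  have h4 : ∀ τ ∈ Ioi (0 : ℝ), ∫⁻ w : ℝ, g (Real.sqrt (1 + (w ^ 2 + τ)), τ) =
      2 * ∫⁻ u in Ioi (0 : ℝ), ENNReal.ofReal (momDensity u τ) * g (u, τ) := by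
    intro τ hτ
    rw [lintegral_comp_sq (h := fun s => g (Real.sqrt (1 + (s + τ)), τ)),
      lintegral_radial_momentum hτ (fun u => g (u, τ))]
  rw [setLIntegral_congr_fun measurableSet_Ioi h4, lintegral_const_mul' _ _ (by simp),
    ← mul_assoc, ENNReal.ofReal_mul zero_le_two, mul_comm (ENNReal.ofReal Real.pi)]
  simp

/-- The measure on the quadrant `u, τ > 0` that is the image of Lebesgue measure on momentum space,
up to the factor `2π` and the density. -/
def quadrant : Measure (ℝ × ℝ) := (volume.restrict (Ioi 0)).prod (volume.restrict (Ioi 0))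

theorem map_velMap {x : E3} (hx : x ≠ 0) :
    Measure.map (velMap x) volume = quadrant.withDensity
      (fun p => ENNReal.ofReal (2 * Real.pi) * ENNReal.ofReal (momDensity p.1 p.2)) := by
  refine Measure.ext fun s hs => ?_
  have hd : Measurable fun p : ℝ × ℝ => ENNReal.ofReal (momDensity p.1 p.2) :=
    measurable_momDensity.ennreal_ofReal
  have h1 := lintegral_velMap hx (g := s.indicator 1) (measurable_one.indicator hs)
  have h2 : ∫⁻ v : E3, s.indicator 1 (velMap x v) = Measure.map (velMap x) volume s := by
    rw [← lintegral_map (measurable_one.indicator hs) (measurable_velMap x),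
      lintegral_indicator_one hs]
  rw [← h2, h1, withDensity_apply _ hs, ← lintegral_indicator hs]
  have h3 : ∀ p : ℝ × ℝ, s.indicator (fun p : ℝ × ℝ => ENNReal.ofReal (2 * Real.pi) *
      ENNReal.ofReal (momDensity p.1 p.2)) p = ENNReal.ofReal (2 * Real.pi) *
      (ENNReal.ofReal (momDensity p.1 p.2) * s.indicator 1 p) := by
    intro p
    by_cases hp : p ∈ s <;> simp [hp]
  simp_rw [h3]
  have hm : Measurable fun p : ℝ × ℝ =>
      ENNReal.ofReal (momDensity p.1 p.2) * s.indicator 1 p :=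
    hd.mul (measurable_one.indicator hs)
  rw [lintegral_const_mul _ hm, quadrant, lintegral_prod_symm _ hm.aemeasurable]

theorem map_velMap_absolutelyContinuous {x : E3} (hx : x ≠ 0) :
    Measure.map (velMap x) volume ≪ quadrant := by
  rw [map_velMap hx]
  exact withDensity_absolutelyContinuous _ _

/-- The profile `Φ` is only almost everywhere measurable, so the formula is transferred through the
image measure of `velMap x`, which is absolutely continuous with respect to `quadrant`. The order of
integration is chosen so that `τ` can be integrated first. -/
theorem lintegral_velMap_ae {x : E3} (hx : x ≠ 0) {g : ℝ × ℝ → ℝ≥0∞}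
    (hg : AEMeasurable g quadrant) :
    ∫⁻ v : E3, g (velMap x v) = ENNReal.ofReal (2 * Real.pi) *
      ∫⁻ u in Ioi (0 : ℝ), ∫⁻ τ in Ioi (0 : ℝ), ENNReal.ofReal (momDensity u τ) * g (u, τ) := by
  have hd : Measurable fun p : ℝ × ℝ => ENNReal.ofReal (momDensity p.1 p.2) :=
    measurable_momDensity.ennreal_ofReal
  rw [← lintegral_map' (hg.mono_ac (map_velMap_absolutelyContinuous hx))
    (measurable_velMap x).aemeasurable, map_velMap hx,
    lintegral_withDensity_eq_lintegral_mul₀ (hd.const_mul _).aemeasurable hg]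
  simp only [Pi.mul_apply, mul_assoc]
  have hm : AEMeasurable (fun p : ℝ × ℝ => ENNReal.ofReal (momDensity p.1 p.2) * g p) quadrant :=
    hd.aemeasurable.mul hg
  rw [lintegral_const_mul'' _ hm, quadrant, lintegral_prod _ hm]

end

section

/-! ### Evaluation of the momentum integrals -/

open scoped ENNReal

theorem momDensity_nonneg {u : ℝ} (hu : 0 ≤ u) (τ : ℝ) : 0 ≤ momDensity u τ := by
  unfold momDensity; positivity

/-- The factor `(u² - 1 - τ)^j` is a power of the squared radial momentum: `j = 1` for the radial
pressure, `j = 0` for the density and the tangential pressure. -/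
theorem momDensity_mul_pow (u τ : ℝ) (j : ℕ) :
    momDensity u τ * (u ^ 2 - 1 - τ) ^ j = u * posPow (u ^ 2 - 1 - τ) (j - 1 / 2) := by
  unfold momDensity
  rcases lt_or_ge 0 (u ^ 2 - 1 - τ) with h | h
  · rw [posPow_of_pos h, Real.rpow_sub h, Real.rpow_natCast, Real.sqrt_eq_rpow]
    ring
  · rw [Real.sqrt_eq_zero_of_nonpos h, posPow_of_nonpos h]
    simp

/-- Both factors are nonzero only for `τ` between `t0 = L₀/r²` and `t0 + a`. The substitution `τ =
t0 + a s` gives `r²τ - L₀ = r² a s` and `u² - 1 - τ = a(1 - s)`, hence a beta integral times powers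
of `r` and `a`. -/
theorem lintegral_angular {r L0 u k σ : ℝ} (hr : 0 < r) (hL0 : 0 ≤ L0) (hk : -1 < k)
    (hσ : -1 < σ) :
    ∫⁻ τ in Ioi (0 : ℝ), ENNReal.ofReal (posPow (r ^ 2 * τ - L0) k * posPow (u ^ 2 - 1 - τ) σ) =
      ENNReal.ofReal (r ^ (2 * k) * (∫ s in (0 : ℝ)..1, s ^ k * (1 - s) ^ σ) *
        posPow (u ^ 2 - (1 + L0 / r ^ 2)) (k + σ + 1)) := by
  set a := u ^ 2 - (1 + L0 / r ^ 2) with ha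
  set t0 := L0 / r ^ 2 with ht0
  have ht0n : 0 ≤ t0 := by positivity
  have hL : L0 = r ^ 2 * t0 := by rw [ht0]; field_simp
  have hr2 : 0 < r ^ 2 := by positivity
  have hzero : ∀ τ, τ ∉ Ioo t0 (t0 + a) →
      posPow (r ^ 2 * τ - L0) k * posPow (u ^ 2 - 1 - τ) σ = 0 := by
    intro τ hτ
    by_cases h1 : t0 < τ
    · have h2 : u ^ 2 - 1 - τ ≤ 0 := by
        have : ¬ τ < t0 + a := fun h => hτ ⟨h1, h⟩
        linarith
      rw [posPow_of_nonpos h2, mul_zero]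
    · have h2 : r ^ 2 * τ - L0 ≤ 0 := by
        rw [hL]
        nlinarith [not_lt.1 h1]
      rw [posPow_of_nonpos h2, zero_mul]
  have hset : ∫⁻ τ in Ioi (0 : ℝ), ENNReal.ofReal
        (posPow (r ^ 2 * τ - L0) k * posPow (u ^ 2 - 1 - τ) σ) =
      ∫⁻ τ in Ioo t0 (t0 + a), ENNReal.ofReal
        (posPow (r ^ 2 * τ - L0) k * posPow (u ^ 2 - 1 - τ) σ) := by
    rw [← lintegral_indicator measurableSet_Ioi, ← lintegral_indicator measurableSet_Ioo]
    refine lintegral_congr fun τ => ?_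
    by_cases hτ : τ ∈ Ioo t0 (t0 + a)
    · rw [indicator_of_mem hτ, indicator_of_mem (show τ ∈ Ioi (0 : ℝ) from ht0n.trans_lt hτ.1)]
    · rw [indicator_of_notMem hτ]
      refine indicator_apply_eq_zero.2 fun _ => ?_
      rw [hzero τ hτ, ENNReal.ofReal_zero]
  rw [hset]
  rcases lt_or_ge 0 a with hapos | haneg
  · have himg : (fun s : ℝ => a * s + t0) '' Ioo 0 1 = Ioo t0 (t0 + a) := by
      rw [image_affine_Ioo hapos]
      simp [add_comm]
    have hinj : InjOn (fun s : ℝ => a * s + t0) (Ioo 0 1) := fun p _ q _ hpq => by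
      have : a * p = a * q := by simpa using hpq
      exact mul_left_cancel₀ hapos.ne' this
    have hcv := lintegral_image_eq_lintegral_abs_deriv_mul (f := fun s : ℝ => a * s + t0)
      (f' := fun _ => a) measurableSet_Ioo
      (fun s _ => by
        simpa using (((hasDerivAt_id s).const_mul a).add_const t0).hasDerivWithinAt) hinj
      (fun τ => ENNReal.ofReal (posPow (r ^ 2 * τ - L0) k * posPow (u ^ 2 - 1 - τ) σ))
    rw [himg] at hcv
    have hcongr : ∀ s ∈ Ioo (0 : ℝ) 1, ENNReal.ofReal |a| * ENNReal.ofReal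
        (posPow (r ^ 2 * (a * s + t0) - L0) k * posPow (u ^ 2 - 1 - (a * s + t0)) σ) =
        ENNReal.ofReal (r ^ (2 * k) * a ^ (k + σ + 1)) *
          ENNReal.ofReal (s ^ k * (1 - s) ^ σ) := by
      intro s hs
      have h1s : 0 < 1 - s := sub_pos.2 hs.2
      have hs0 := hs.1
      rw [← ENNReal.ofReal_mul (abs_nonneg _), ← ENNReal.ofReal_mul (by positivity)]
      congr 1
      have e1 : r ^ 2 * (a * s + t0) - L0 = r ^ 2 * a * s := by rw [hL]; ring
      have e2 : u ^ 2 - 1 - (a * s + t0) = a * (1 - s) := by rw [ha]; ring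
      rw [e1, e2, posPow_of_pos (by positivity), posPow_of_pos (by positivity),
        Real.mul_rpow (by positivity) hs0.le, Real.mul_rpow hr2.le hapos.le,
        Real.mul_rpow hapos.le h1s.le, Real.rpow_add_one hapos.ne', Real.rpow_add hapos,
        abs_of_pos hapos, Real.rpow_mul hr.le]
      norm_num
      ring
    rw [hcv, setLIntegral_congr_fun measurableSet_Ioo hcongr,
      lintegral_const_mul' _ _ ENNReal.ofReal_ne_top]
    have hint := integrableOn_beta hk hσ
    rw [intervalIntegrable_iff_integrableOn_Ioo_of_le zero_le_one] at hint
    rw [← ofReal_integral_eq_lintegral_ofReal hint, ← ENNReal.ofReal_mul (by positivity),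
      posPow_of_pos hapos, intervalIntegral.integral_of_le zero_le_one, integral_Ioc_eq_integral_Ioo]
    · congr 1
      ring
    · rw [EventuallyLE, ae_restrict_iff' measurableSet_Ioo]
      refine ae_of_all _ fun s hs => ?_
      have h1s : 0 < 1 - s := sub_pos.2 hs.2
      have hs0 := hs.1
      simp only [Pi.zero_apply]
      positivity
  · rw [posPow_of_nonpos haneg, mul_zero, ENNReal.ofReal_zero, Ioo_eq_empty (by linarith)]
    simp

variable {Φ : ℝ → ℝ} {C : ℝ}

/-- Substitution `u = e^y(1 - α)`. It maps `u > 0` to `α < 1`, and `α ≤ 0` contributes nothing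
because `Φ` vanishes there. -/
theorem lintegral_energy (hΦ : IsProfile Φ C) (β : ℕ) {k b : ℝ} (hk : 0 < k) (hb : 0 ≤ b)
    (y : ℝ) :
    ∫⁻ u in Ioi (0 : ℝ), ENNReal.ofReal (Φ (1 - Real.exp (-y) * u) * u ^ β *
      posPow (u ^ 2 - b) k) =
      ENNReal.ofReal (Real.exp y ^ (β + 1) * shellInt Φ β k b y) := by
  have hY := Real.exp_pos y
  have hYY : Real.exp (-y) * Real.exp y = 1 := by rw [← Real.exp_add]; simp
  set f : ℝ → ℝ := fun α => Real.exp y * (1 - α) with hf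
  have himg : f '' Iio 1 = Ioi 0 := by
    ext u
    constructor
    · rintro ⟨α, hα, rfl⟩
      exact mul_pos hY (sub_pos.2 hα)
    · intro hu
      refine ⟨1 - Real.exp (-y) * u, ?_, ?_⟩
      · have : 0 < Real.exp (-y) * u := mul_pos (Real.exp_pos _) hu
        exact sub_lt_self _ this
      · simp only [hf]
        linear_combination u * hYY
  have hinj : InjOn f (Iio 1) := fun p _ q _ hpq => by
    have := mul_left_cancel₀ hY.ne' hpq
    linarith
  have hcv := lintegral_image_eq_lintegral_abs_deriv_mul (f := f)
    (f' := fun _ => -Real.exp y) measurableSet_Iio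
    (fun s _ => by
      simpa using (((hasDerivAt_id s).const_sub 1).const_mul (Real.exp y)).hasDerivWithinAt) hinj
    (fun u => ENNReal.ofReal (Φ (1 - Real.exp (-y) * u) * u ^ β * posPow (u ^ 2 - b) k))
  rw [himg] at hcv
  have hcongr : ∀ α, ENNReal.ofReal |-Real.exp y| * ENNReal.ofReal
      (Φ (1 - Real.exp (-y) * f α) * f α ^ β * posPow (f α ^ 2 - b) k) =
      ENNReal.ofReal (Real.exp y ^ (β + 1)) *
        ENNReal.ofReal (Φ α * (1 - α) ^ β * posPow (excess b y α) k) := by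
    intro α
    have e1 : 1 - Real.exp (-y) * f α = α := by
      simp only [hf]
      linear_combination (α - 1) * hYY
    rw [← ENNReal.ofReal_mul (abs_nonneg _), ← ENNReal.ofReal_mul (by positivity), e1, abs_neg,
      abs_of_pos hY, excess, exp_two_mul_mul_sq]
    congr 1
    simp only [hf, mul_pow]
    ring
  rw [hcv]
  simp_rw [hcongr]
  rw [lintegral_const_mul' _ _ ENNReal.ofReal_ne_top, ENNReal.ofReal_mul (by positivity)]
  congr 1
  have hset : ∫⁻ α in Iio (1 : ℝ), ENNReal.ofReal (Φ α * (1 - α) ^ β * posPow (excess b y α) k) =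
      ∫⁻ α in Ioo (0 : ℝ) 1, ENNReal.ofReal (Φ α * (1 - α) ^ β * posPow (excess b y α) k) := by
    rw [← lintegral_indicator measurableSet_Iio, ← lintegral_indicator measurableSet_Ioo]
    refine lintegral_congr fun α => ?_
    by_cases h1 : α < 1
    · rw [indicator_of_mem (show α ∈ Iio (1 : ℝ) from h1)]
      by_cases h0 : 0 < α
      · rw [indicator_of_mem (show α ∈ Ioo (0 : ℝ) 1 from ⟨h0, h1⟩)]
      · rw [indicator_of_notMem (show α ∉ Ioo (0 : ℝ) 1 from fun h => h0 h.1),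
          hΦ.zero α (not_lt.1 h0)]
        simp
    · rw [indicator_of_notMem (show α ∉ Iio (1 : ℝ) from h1),
        indicator_of_notMem (show α ∉ Ioo (0 : ℝ) 1 from fun h => h1 h.2)]
  have hint := hΦ.integrand_integrable β hk hb y
  rw [intervalIntegrable_iff_integrableOn_Ioo_of_le zero_le_one] at hint
  rw [hset, ← ofReal_integral_eq_lintegral_ofReal hint, shellInt,
    intervalIntegral.integral_of_le zero_le_one, integral_Ioc_eq_integral_Ioo]
  rw [EventuallyLE, ae_restrict_iff' measurableSet_Ioo]
  exact ae_of_all _ fun α hα => hΦ.integrand_nonneg β k b y hα.2.le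

/-- Almost everywhere measurability survives composition with `u ↦ 1 - cu` because this map is
nonsingular. For `u > 0` its values lie below `1`, where `Φ` is either measurable by assumption or
zero. -/
theorem IsProfile.aemeasurable_comp (hΦ : IsProfile Φ C) {c : ℝ} (hc : 0 < c) :
    AEMeasurable (fun u => Φ (1 - c * u)) (volume.restrict (Ioi 0)) := by
  have h1 : AEMeasurable Φ (volume.restrict (Iio 1)) := by
    have hsub : Iio (1 : ℝ) ⊆ Iic 0 ∪ uIoc 0 1 := by
      intro α hα
      rw [uIoc_of_le zero_le_one]
      rcases le_or_gt α 0 with h | h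
      · exact Or.inl h
      · exact Or.inr ⟨h, le_of_lt hα⟩
    refine AEMeasurable.mono_measure ?_ (Measure.restrict_mono hsub le_rfl)
    refine aemeasurable_union_iff.2 ⟨?_, hΦ.meas.aemeasurable⟩
    refine (aemeasurable_const (b := (0 : ℝ))).congr ?_
    rw [EventuallyEq, ae_restrict_iff' measurableSet_Iic]
    exact ae_of_all _ fun α hα => (hΦ.zero α hα).symm
  have h2 := (aemeasurable_indicator_iff measurableSet_Iio).2 h1
  have hq1 : Measure.QuasiMeasurePreserving (fun u : ℝ => c * u) volume volume := by
    refine ⟨by fun_prop, ?_⟩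
    rw [Real.map_volume_mul_left hc.ne']
    exact Measure.smul_absolutelyContinuous
  have hq := (Measure.measurePreserving_sub_left (volume : Measure ℝ) 1).quasiMeasurePreserving.comp hq1
  have h3 := (h2.comp_quasiMeasurePreserving hq).restrict (s := Ioi 0)
  refine h3.congr ?_
  rw [EventuallyEq, ae_restrict_iff' measurableSet_Ioi]
  refine ae_of_all _ fun u hu => ?_
  have : 0 < c * u := mul_pos hc hu
  exact indicator_of_mem (show 1 - c * u ∈ Iio (1 : ℝ) from sub_lt_self _ this) Φ

theorem radMom_sq_eq {x v : E3} (hx : x ≠ 0) :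
    radMom x v ^ 2 = (velMap x v).1 ^ 2 - 1 - (velMap x v).2 := by
  have hr : 0 < ‖x‖ := norm_pos_iff.2 hx
  simp only [velMap, radMom, angMom_eq]
  rw [Real.sq_sqrt (by positivity)]
  field_simp
  ring

/-- The integrands of the matter quantities, in the momentum variables. -/
def momIntegrand (Φ : ℝ → ℝ) (β j : ℕ) (k L0 r y : ℝ) (p : ℝ × ℝ) : ℝ :=
  Φ (1 - Real.exp (-y) * p.1) * (p.1 ^ β / p.1) * posPow (r ^ 2 * p.2 - L0) k *
    (p.1 ^ 2 - 1 - p.2) ^ j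

theorem measurable_posPow (k : ℝ) : Measurable fun s => posPow s k := by
  unfold posPow
  exact Measurable.ite measurableSet_Ioi (measurable_id.pow_const k) measurable_const

theorem aemeasurable_momIntegrand (hΦ : IsProfile Φ C) (β j : ℕ) (k L0 r y : ℝ) :
    AEMeasurable (momIntegrand Φ β j k L0 r y) quadrant := by
  have h1 : AEMeasurable (fun p : ℝ × ℝ => Φ (1 - Real.exp (-y) * p.1)) quadrant :=
    (hΦ.aemeasurable_comp (Real.exp_pos (-y))).comp_quasiMeasurePreserving
      Measure.quasiMeasurePreserving_fst
  have h2 : Measurable fun p : ℝ × ℝ => p.1 ^ β / p.1 := by fun_prop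
  have h3 : Measurable fun p : ℝ × ℝ => posPow (r ^ 2 * p.2 - L0) k :=
    (measurable_posPow k).comp (by fun_prop)
  have h4 : Measurable fun p : ℝ × ℝ => (p.1 ^ 2 - 1 - p.2) ^ j := by fun_prop
  exact ((h1.mul h2.aemeasurable).mul h3.aemeasurable).mul h4.aemeasurable

theorem momIntegrand_nonneg (hΦ : IsProfile Φ C) (β j : ℕ) (k L0 r y : ℝ) {x : E3} (hx : x ≠ 0)
    (v : E3) : 0 ≤ momIntegrand Φ β j k L0 r y (velMap x v) := by
  have h1 : 0 ≤ (velMap x v).1 := Real.sqrt_nonneg _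
  have h2 : 0 ≤ (velMap x v).1 ^ 2 - 1 - (velMap x v).2 := by
    rw [← radMom_sq_eq hx]; positivity
  have h3 := hΦ.nonneg (1 - Real.exp (-y) * (velMap x v).1)
  have h4 := posPow_nonneg (r ^ 2 * (velMap x v).2 - L0) k
  unfold momIntegrand
  positivity

/-- The factor `u` of the momentum density cancels the quotient in `u^β/u`; then `lintegral_angular`
and `lintegral_energy` apply in turn. The triple `(β, j, k)` is `(2, 0, l)` for `ρ`, `(0, 1, l)` for
`p`, and `(0, 0, l)`, `(0, 0, l + 1)` for the two parts of `q`. -/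
theorem integral_momIntegrand (hΦ : IsProfile Φ C) (β j : ℕ) {k L0 : ℝ} (y : ℝ)
    (hk : -(1 / 2) < k) (hL0 : 0 ≤ L0) {x : E3} (hx : x ≠ 0) :
    Integrable (fun v => momIntegrand Φ β j k L0 ‖x‖ y (velMap x v)) ∧
    ∫ v, momIntegrand Φ β j k L0 ‖x‖ y (velMap x v) =
      2 * Real.pi * (‖x‖ ^ (2 * k) * (∫ s in (0 : ℝ)..1, s ^ k * (1 - s) ^ ((j : ℝ) - 1 / 2)) *
        (Real.exp y ^ (β + 1) * shellInt Φ β (k + j + 1 / 2) (1 + L0 / ‖x‖ ^ 2) y)) := by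
  have hr : 0 < ‖x‖ := norm_pos_iff.2 hx
  set r := ‖x‖
  set B := ∫ s in (0 : ℝ)..1, s ^ k * (1 - s) ^ ((j : ℝ) - 1 / 2)
  have hj : (0 : ℝ) ≤ j := Nat.cast_nonneg j
  have hB : 0 ≤ B := by
    refine intervalIntegral.integral_nonneg zero_le_one fun s hs => ?_
    exact mul_nonneg (Real.rpow_nonneg hs.1 _) (Real.rpow_nonneg (sub_nonneg.2 hs.2) _)
  set S := shellInt Φ β (k + j + 1 / 2) (1 + L0 / r ^ 2) y
  have hS : 0 ≤ S := shellInt_nonneg hΦ _ _ _ _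
  have hg := aemeasurable_momIntegrand hΦ β j k L0 r y
  have h0 := momIntegrand_nonneg hΦ β j k L0 r y hx
  have hlin : ∫⁻ v : E3, ENNReal.ofReal (momIntegrand Φ β j k L0 r y (velMap x v)) =
      ENNReal.ofReal (2 * Real.pi * (r ^ (2 * k) * B * (Real.exp y ^ (β + 1) * S))) := by
    rw [lintegral_velMap_ae hx hg.ennreal_ofReal]
    have hinner : ∀ u ∈ Ioi (0 : ℝ), ∫⁻ τ in Ioi (0 : ℝ), ENNReal.ofReal (momDensity u τ) *
        ENNReal.ofReal (momIntegrand Φ β j k L0 r y (u, τ)) =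
        ENNReal.ofReal (r ^ (2 * k) * B) * ENNReal.ofReal (Φ (1 - Real.exp (-y) * u) * u ^ β *
          posPow (u ^ 2 - (1 + L0 / r ^ 2)) (k + j + 1 / 2)) := by
      intro u hu
      have hu' : 0 < u := hu
      have hΦu := hΦ.nonneg (1 - Real.exp (-y) * u)
      have e1 : ∀ τ, ENNReal.ofReal (momDensity u τ) *
          ENNReal.ofReal (momIntegrand Φ β j k L0 r y (u, τ)) =
          ENNReal.ofReal (Φ (1 - Real.exp (-y) * u) * u ^ β) * ENNReal.ofReal
            (posPow (r ^ 2 * τ - L0) k * posPow (u ^ 2 - 1 - τ) (j - 1 / 2)) := by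
        intro τ
        rw [← ENNReal.ofReal_mul (momDensity_nonneg hu'.le τ),
          ← ENNReal.ofReal_mul (by positivity)]
        congr 1
        have e2 := momDensity_mul_pow u τ j
        unfold momIntegrand
        simp only
        calc _ = Φ (1 - Real.exp (-y) * u) * (u ^ β / u) * posPow (r ^ 2 * τ - L0) k *
              (momDensity u τ * (u ^ 2 - 1 - τ) ^ j) := by ring
          _ = _ := by
            rw [e2]
            field_simp
      simp_rw [e1]
      rw [lintegral_const_mul' _ _ ENNReal.ofReal_ne_top,
        lintegral_angular hr hL0 (by linarith) (by linarith), ← ENNReal.ofReal_mul (by positivity),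
        ← ENNReal.ofReal_mul (by positivity), show k + ((j : ℝ) - 1 / 2) + 1 = k + j + 1 / 2 by ring]
      congr 1
      ring
    rw [setLIntegral_congr_fun measurableSet_Ioi hinner,
      lintegral_const_mul' _ _ ENNReal.ofReal_ne_top,
      lintegral_energy hΦ β (by linarith) (by positivity), ← ENNReal.ofReal_mul (by positivity),
      ← ENNReal.ofReal_mul (by positivity)]
  have hmeas : AEStronglyMeasurable (fun v => momIntegrand Φ β j k L0 r y (velMap x v)) volume :=
    ((hg.mono_ac (map_velMap_absolutelyContinuous hx)).comp_measurable
      (measurable_velMap x)).aestronglyMeasurable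
  constructor
  · refine ⟨hmeas, ?_⟩
    rw [hasFiniteIntegral_iff_ofReal (ae_of_all _ h0), hlin]
    exact ENNReal.ofReal_lt_top
  · rw [integral_eq_lintegral_of_nonneg_ae (ae_of_all _ h0) hmeas, hlin,
      ENNReal.toReal_ofReal (by positivity)]

end

section

/-! ### The radial differential equation on a compact interval -/

theorem monotoneOn_of_hasDerivWithinAt_Icc {f f' : ℝ → ℝ} {a b : ℝ}
    (hf : ∀ t ∈ Icc a b, HasDerivWithinAt f (f' t) (Icc a b) t) (h0 : ∀ t ∈ Icc a b, 0 ≤ f' t) :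
    MonotoneOn f (Icc a b) := by
  have hd : ∀ t ∈ Ioo a b, HasDerivAt f (f' t) t := fun t ht =>
    (hf t (Ioo_subset_Icc_self ht)).hasDerivAt (Icc_mem_nhds ht.1 ht.2)
  refine monotoneOn_of_deriv_nonneg (convex_Icc a b) (fun t ht => (hf t ht).continuousWithinAt) ?_ ?_
  · intro t ht
    rw [interior_Icc] at ht
    exact (hd t ht).differentiableAt.differentiableWithinAt
  · intro t ht
    rw [interior_Icc] at ht
    rw [(hd t ht).deriv]
    exact h0 t (Ioo_subset_Icc_self ht)

/-- The right-hand side of the equation for `(y, D)`, where `D = r - 2 (M + m)`; here `p` and `ρ`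
carry the weights `4πr²` and `8πr²`. -/
def radialField (p ρ : ℝ → ℝ → ℝ) (r : ℝ) (z : ℝ × ℝ) : ℝ × ℝ :=
  (1 / (2 * r) - (1 / 2 + p r z.1) / z.2, 1 - ρ r z.1)

/-- Bounds for a matter term on `[a, b]` and `y ≤ Y`, and its Lipschitz property in `y`. -/
def IsMatterBound (p : ℝ → ℝ → ℝ) (a b Y K : ℝ) : Prop :=
  0 ≤ K ∧ ∀ r ∈ Icc a b, ∀ y z, y ≤ Y → z ≤ Y → |p r y| ≤ K ∧ |p r z - p r y| ≤ K * |z - y|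

variable {p ρ : ℝ → ℝ → ℝ} {a b Y K : ℝ}

theorem norm_radialField_le (ha : 0 < a) (hp : IsMatterBound p a b Y K)
    (hρ : IsMatterBound ρ a b Y K) {ε : ℝ} (hε : 0 < ε) {r : ℝ} (hr : r ∈ Icc a b) {z : ℝ × ℝ}
    (h1 : z.1 ≤ Y) (h2 : ε ≤ z.2) :
    ‖radialField p ρ r z‖ ≤ 1 / (2 * a) + (1 / 2 + K) / ε + (1 + K) := by
  have hK := hp.1
  have hr0 : 0 < r := ha.trans_le hr.1
  have hz2 : 0 < z.2 := hε.trans_le h2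
  have hpb := (hp.2 r hr z.1 z.1 h1 h1).1
  have hρb := (hρ.2 r hr z.1 z.1 h1 h1).1
  have e1 : |1 / (2 * r) - (1 / 2 + p r z.1) / z.2| ≤ 1 / (2 * a) + (1 / 2 + K) / ε := by
    refine (abs_sub _ _).trans (add_le_add ?_ ?_)
    · rw [abs_of_pos (by positivity)]
      exact one_div_le_one_div_of_le (by positivity) (by linarith [hr.1])
    · rw [abs_div, abs_of_pos hz2]
      refine div_le_div₀ (by positivity) ?_ hε h2
      refine (abs_add_le _ _).trans ?_
      rw [abs_of_pos (by norm_num : (0 : ℝ) < 1 / 2)]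
      linarith
  have e2 : |1 - ρ r z.1| ≤ 1 + K := by
    refine (abs_sub _ _).trans ?_
    rw [abs_one]
    linarith
  have e3 : 0 ≤ 1 / (2 * a) + (1 / 2 + K) / ε := by positivity
  rw [Prod.norm_def]
  refine max_le ?_ ?_
  · exact e1.trans (by linarith)
  · exact e2.trans (by linarith)

theorem lipschitzOnWith_radialField (hp : IsMatterBound p a b Y K)
    (hρ : IsMatterBound ρ a b Y K) {ε : ℝ} (hε : 0 < ε) :
    ∃ K' : NNReal, ∀ r ∈ Icc a b,
      LipschitzOnWith K' (radialField p ρ r) {z : ℝ × ℝ | z.1 ≤ Y ∧ ε ≤ z.2} := by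
  have hK := hp.1
  set A := K / ε + (1 / 2 + K) / ε ^ 2 + K with hA
  have hA0 : 0 ≤ A := by positivity
  refine ⟨A.toNNReal, fun r hr => LipschitzOnWith.of_dist_le_mul fun z hz w hw => ?_⟩
  rw [Real.coe_toNNReal _ hA0]
  obtain ⟨hz1, hz2⟩ := hz
  obtain ⟨hw1, hw2⟩ := hw
  have hz2' : 0 < z.2 := hε.trans_le hz2
  have hw2' : 0 < w.2 := hε.trans_le hw2
  have d1 : |z.1 - w.1| ≤ dist z w := by
    rw [Prod.dist_eq, ← Real.dist_eq]; exact le_max_left _ _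
  have d2 : |z.2 - w.2| ≤ dist z w := by
    rw [Prod.dist_eq, ← Real.dist_eq]; exact le_max_right _ _
  have hd0 : 0 ≤ dist z w := dist_nonneg
  obtain ⟨hpw, hpzw⟩ := hp.2 r hr w.1 z.1 hw1 hz1
  obtain ⟨-, hρzw⟩ := hρ.2 r hr w.1 z.1 hw1 hz1
  rw [Prod.dist_eq]
  refine max_le ?_ ?_
  · rw [Real.dist_eq]
    simp only [radialField]
    have e : 1 / (2 * r) - (1 / 2 + p r z.1) / z.2 - (1 / (2 * r) - (1 / 2 + p r w.1) / w.2) =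
        -((p r z.1 - p r w.1) / z.2) + (1 / 2 + p r w.1) * (z.2 - w.2) / (z.2 * w.2) := by
      field_simp
      ring
    rw [e]
    refine (abs_add_le _ _).trans ?_
    have t1 : |-((p r z.1 - p r w.1) / z.2)| ≤ K / ε * dist z w := by
      rw [abs_neg, abs_div, abs_of_pos hz2', div_mul_eq_mul_div]
      exact div_le_div₀ (by positivity)
        (hpzw.trans (mul_le_mul_of_nonneg_left d1 hK)) hε hz2
    have t2 : |(1 / 2 + p r w.1) * (z.2 - w.2) / (z.2 * w.2)| ≤
        (1 / 2 + K) / ε ^ 2 * dist z w := by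
      rw [abs_div, abs_mul, abs_of_pos (mul_pos hz2' hw2'), div_mul_eq_mul_div]
      refine div_le_div₀ (by positivity) ?_ (by positivity) (by nlinarith)
      refine mul_le_mul ?_ d2 (abs_nonneg _) (by positivity)
      refine (abs_add_le _ _).trans ?_
      rw [abs_of_pos (by norm_num : (0 : ℝ) < 1 / 2)]
      linarith
    have t3 : 0 ≤ K * dist z w := by positivity
    have t4 : A * dist z w = K / ε * dist z w + (1 / 2 + K) / ε ^ 2 * dist z w + K * dist z w := by
      rw [hA]; ring
    linarith
  · rw [Real.dist_eq]
    simp only [radialField]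
    have e : 1 - ρ r z.1 - (1 - ρ r w.1) = -(ρ r z.1 - ρ r w.1) := by ring
    rw [e, abs_neg]
    have t1 : K * |z.1 - w.1| ≤ K * dist z w := mul_le_mul_of_nonneg_left d1 hK
    have t2 : 0 ≤ (K / ε + (1 / 2 + K) / ε ^ 2) * dist z w := by positivity
    rw [hA, add_mul]
    linarith

/-- Truncation of the state to `y ≤ Y`, `ε ≤ D ≤ d`. -/
def truncState (Y ε d : ℝ) (z : ℝ × ℝ) : ℝ × ℝ := (min z.1 Y, max ε (min z.2 d))

theorem lipschitzWith_truncState (Y ε d : ℝ) : LipschitzWith 1 (truncState Y ε d) := by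
  have h1 : LipschitzWith 1 fun z : ℝ × ℝ => min z.1 Y := LipschitzWith.prod_fst.min_const Y
  have h2 : LipschitzWith 1 fun z : ℝ × ℝ => max ε (min z.2 d) :=
    (LipschitzWith.prod_snd.min_const d).const_max ε
  have := h1.prodMk h2
  rw [max_self] at this
  exact this

/-- After truncation the field is bounded by one constant and Lipschitz on the whole plane, so
Picard–Lindelöf reaches across `[a, b]` at once, in a ball of radius bound times length. -/
theorem exists_truncated_solution (hab : a ≤ b) (ha : 0 < a)
    (hpc : ∀ y, ContinuousOn (fun r => p r y) (Icc a b))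
    (hρc : ∀ y, ContinuousOn (fun r => ρ r y) (Icc a b))
    (hp : IsMatterBound p a b Y K) (hρ : IsMatterBound ρ a b Y K) {ε : ℝ} (hε : 0 < ε)
    {d : ℝ → ℝ} (hd : Continuous d) (z0 : ℝ × ℝ) :
    ∃ z : ℝ → ℝ × ℝ, z a = z0 ∧ ∀ r ∈ Icc a b,
      HasDerivWithinAt z (radialField p ρ r (truncState Y ε (d r) (z r))) (Icc a b) r := by
  have hK := hp.1
  obtain ⟨K', hK'⟩ := lipschitzOnWith_radialField hp hρ hε
  set L := 1 / (2 * a) + (1 / 2 + K) / ε + (1 + K) with hL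
  have hL0 : 0 ≤ L := by positivity
  have hmem : ∀ r z, truncState Y ε (d r) z ∈ {z : ℝ × ℝ | z.1 ≤ Y ∧ ε ≤ z.2} := fun r z =>
    ⟨min_le_right _ _, le_max_left _ _⟩
  have hPL : IsPicardLindelof (fun r z => radialField p ρ r (truncState Y ε (d r) z))
      (⟨a, le_rfl, hab⟩ : Icc a b) z0 (L.toNNReal * (b - a).toNNReal) 0 L.toNNReal K' := by
    refine ⟨fun r hr => ?_, fun z _ => ?_, fun r hr z _ => ?_, ?_⟩
    · have := (hK' r hr).comp (lipschitzWith_truncState Y ε (d r)).lipschitzOnWith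
        (s := Metric.closedBall z0 ↑(L.toNNReal * (b - a).toNNReal)) (fun z _ => hmem r z)
      rw [mul_one] at this
      exact this
    · have hD : Continuous fun r => max ε (min z.2 (d r)) := by fun_prop
      have h0 : ∀ r ∈ Icc a b, max ε (min z.2 (d r)) ≠ 0 := fun r _ =>
        (hε.trans_le (le_max_left _ _)).ne'
      have hr0 : ∀ r ∈ Icc a b, 2 * r ≠ 0 := fun r hr => by
        have := ha.trans_le hr.1
        positivity
      simp only [radialField, truncState]
      refine ContinuousOn.prodMk ?_ (continuousOn_const.sub (hρc _))
      refine (continuousOn_const.div (by fun_prop) hr0).sub ?_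
      exact (continuousOn_const.add (hpc _)).div hD.continuousOn h0
    · rw [Real.coe_toNNReal _ hL0]
      exact norm_radialField_le ha hp hρ hε hr (hmem r z).1 (hmem r z).2
    · simp [hab]
  exact hPL.exists_eq_forall_mem_Icc_hasDerivWithinAt₀

/-- A primitive of `1 / max t ε`, equal to `log (t / ε)` for `t ≥ ε`. -/
def truncLog (ε t : ℝ) : ℝ := ∫ s in ε..t, (max s ε)⁻¹

theorem hasDerivAt_truncLog {ε : ℝ} (hε : 0 < ε) (t : ℝ) :
    HasDerivAt (truncLog ε) (max t ε)⁻¹ t := by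
  have hc : Continuous fun s : ℝ => (max s ε)⁻¹ :=
    (continuous_id.max continuous_const).inv₀ fun s => (hε.trans_le (le_max_right _ _)).ne'
  exact intervalIntegral.integral_hasDerivAt_right (hc.intervalIntegrable _ _)
    (hc.stronglyMeasurableAtFilter _ _) hc.continuousAt

theorem truncLog_of_le {ε t : ℝ} (hε : 0 < ε) (ht : ε ≤ t) : truncLog ε t = Real.log (t / ε) := by
  rw [truncLog, ← integral_inv_of_pos hε (hε.trans_le ht)]
  refine intervalIntegral.integral_congr fun s hs => ?_
  rw [uIcc_of_le ht] at hs
  rw [max_eq_left hs.1]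

theorem le_of_truncLog_nonneg {ε t : ℝ} (hε : 0 < ε) (h : 0 ≤ truncLog ε t) : ε ≤ t := by
  by_contra! hlt
  have hmono : StrictMono (truncLog ε) := strictMono_of_deriv_pos fun s => by
    rw [(hasDerivAt_truncLog hε s).deriv]
    exact inv_pos.2 (hε.trans_le (le_max_right _ _))
  have h1 := hmono hlt
  rw [truncLog_of_le hε le_rfl, div_self hε.ne', Real.log_one] at h1
  linarith

/-- Existence on a compact interval: the denominator stays positive, since a small denominator makes
`y` decrease until there is no matter left. -/
theorem exists_radial_solution {M : ℝ} (hM : 0 < M) (ha : 2 * M < a) (hab : a ≤ b) (hY : 0 < Y)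
    (hpc : ∀ y, ContinuousOn (fun r => p r y) (Icc a b))
    (hρc : ∀ y, ContinuousOn (fun r => ρ r y) (Icc a b))
    (hp : IsMatterBound p a b Y K) (hρ : IsMatterBound ρ a b Y K)
    (hp0 : ∀ r ∈ Icc a b, ∀ y, 0 ≤ p r y) (hρ0 : ∀ r ∈ Icc a b, ∀ y, 0 ≤ ρ r y)
    (hρz : ∀ r ∈ Icc a b, ∀ y, y ≤ 0 → ρ r y = 0) :
    ∃ y D : ℝ → ℝ, y a = Y ∧ D a = a - 2 * M ∧ ∀ r ∈ Icc a b, 0 < D r ∧ D r ≤ r - 2 * M ∧ y r ≤ Y ∧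
      HasDerivWithinAt y (1 / (2 * r) - (1 / 2 + p r (y r)) / D r) (Icc a b) r ∧
      HasDerivWithinAt D (1 - ρ r (y r)) (Icc a b) r := by
  have hK := hp.1
  have ha0 : 0 < a := by linarith
  have hb0 : 0 < b := ha0.trans_le hab
  set c := K * b / M with hc
  have hc0 : 0 ≤ c := by positivity
  -- Chosen so that `log(D/ε) - c y` equals `0` at `r = a`, where `D = a - 2M` and `y = Y`.
  set ε := (a - 2 * M) * Real.exp (-(c * Y)) with hεdef
  have haM : 0 < a - 2 * M := by linarith
  have hε : 0 < ε := by positivity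
  have hεa : ε ≤ a - 2 * M := by
    have : Real.exp (-(c * Y)) ≤ 1 := Real.exp_le_one_iff.2 (by
      have : 0 ≤ c * Y := by positivity
      linarith)
    nlinarith
  obtain ⟨z, hz0, hz⟩ := exists_truncated_solution hab ha0 hpc hρc hp hρ hε
    (d := fun r => r - 2 * M) (by fun_prop) (Y, a - 2 * M)
  set y : ℝ → ℝ := fun r => (z r).1
  set D : ℝ → ℝ := fun r => (z r).2
  set T : ℝ → ℝ := fun r => max ε (min (D r) (r - 2 * M)) with hT
  have hya : y a = Y := by simp [y, hz0]
  have hDa : D a = a - 2 * M := by simp [D, hz0]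
  have hTε : ∀ r, ε ≤ T r := fun r => le_max_left _ _
  have hT0 : ∀ r, 0 < T r := fun r => hε.trans_le (hTε r)
  have hTr : ∀ r ∈ Icc a b, T r ≤ r - 2 * M := fun r hr =>
    max_le (hεa.trans (by linarith [hr.1])) (min_le_right _ _)
  have hy' : ∀ r ∈ Icc a b, HasDerivWithinAt y
      (1 / (2 * r) - (1 / 2 + p r (min (y r) Y)) / T r) (Icc a b) r := fun r hr =>
    (ContinuousLinearMap.fst ℝ ℝ ℝ).hasFDerivAt.comp_hasDerivWithinAt r (hz r hr)
  have hD' : ∀ r ∈ Icc a b, HasDerivWithinAt D (1 - ρ r (min (y r) Y)) (Icc a b) r := fun r hr =>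
    (ContinuousLinearMap.snd ℝ ℝ ℝ).hasFDerivAt.comp_hasDerivWithinAt r (hz r hr)
  -- The truncation `T ≤ r - 2M` from above is what gives this bound before `D ≤ r - 2M` is known:
  -- the excess over `M/(rT)` has numerator `(r - 2M - T)/2 + r p ≥ 0`.
  have hyneg : ∀ r ∈ Icc a b, M / (b * T r) ≤
      -(1 / (2 * r) - (1 / 2 + p r (min (y r) Y)) / T r) := by
    intro r hr
    have hr0 : 0 < r := ha0.trans_le hr.1
    have hp1 := hp0 r hr (min (y r) Y)
    have h1 := hTr r hr
    have h2 := hT0 r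
    have h3 : M / (b * T r) ≤ M / (r * T r) := by
      have := hr.2
      gcongr
    have h4 : -(1 / (2 * r) - (1 / 2 + p r (min (y r) Y)) / T r) - M / (r * T r) =
        ((r - 2 * M - T r) / 2 + r * p r (min (y r) Y)) / (r * T r) := by
      field_simp
      ring
    have h5 : 0 ≤ ((r - 2 * M - T r) / 2 + r * p r (min (y r) Y)) / (r * T r) := by
      have : 0 ≤ r - 2 * M - T r := by linarith
      positivity
    linarith
  have hyanti : MonotoneOn (fun r => -y r) (Icc a b) :=
    monotoneOn_of_hasDerivWithinAt_Icc (fun r hr => (hy' r hr).neg) fun r hr => by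
      have h1 := hyneg r hr
      have h2 : 0 ≤ M / (b * T r) := by
        have := hT0 r
        positivity
      linarith
  have hyY : ∀ r ∈ Icc a b, y r ≤ Y := fun r hr => by
    have := hyanti ⟨le_rfl, hab⟩ hr hr.1
    simp only [hya] at this
    linarith
  have hDle : ∀ r ∈ Icc a b, D r ≤ r - 2 * M := fun r hr => by
    have hm := monotoneOn_of_hasDerivWithinAt_Icc (f := fun r => r - D r)
      (fun r hr => (hasDerivWithinAt_id r _).sub (hD' r hr))
      (fun r hr => by have := hρ0 r hr (min (y r) Y); linarith)
    have := hm ⟨le_rfl, hab⟩ hr hr.1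
    simp only [hDa] at this
    linarith
  -- The possible decrease of `log D` is at rate at most `K/T`, which `-c y'` compensates because `c
  -- M/b = K`. Thus `log(D/ε) ≥ c y`, with the truncated logarithm standing in until `D ≥ ε` is
  -- known.
  have hQ : ∀ r ∈ Icc a b, 0 ≤ y r → ε ≤ D r := by
    have hmono := monotoneOn_of_hasDerivWithinAt_Icc (f := fun r => truncLog ε (D r) - c * y r)
      (fun r hr => ((hasDerivAt_truncLog hε (D r)).comp_hasDerivWithinAt r (hD' r hr)).sub
        ((hy' r hr).const_mul c)) (fun r hr => by
        have h1 : max (D r) ε = T r := by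
          simp only [hT]
          rw [min_eq_left (hDle r hr), max_comm]
        rw [h1]
        have h2 := mul_le_mul_of_nonneg_left (hyneg r hr) hc0
        have h3 : c * (M / (b * T r)) = K * (T r)⁻¹ := by
          have := hT0 r
          rw [hc]
          field_simp
        have h4 := (hρ.2 r hr (min (y r) Y) (min (y r) Y) (min_le_right _ _) (min_le_right _ _)).1
        have h5 : 0 < (T r)⁻¹ := inv_pos.2 (hT0 r)
        have h6 := (le_abs_self _).trans h4
        nlinarith)
    intro r hr hyr
    have h1 := hmono ⟨le_rfl, hab⟩ hr hr.1
    simp only [hya, hDa] at h1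
    have h2 : truncLog ε (a - 2 * M) = c * Y := by
      rw [truncLog_of_le hε hεa, hεdef, Real.exp_neg]
      rw [show (a - 2 * M) / ((a - 2 * M) * (Real.exp (c * Y))⁻¹) = Real.exp (c * Y) by
        field_simp, Real.log_exp]
    refine le_of_truncLog_nonneg hε ?_
    have h3 : 0 ≤ c * y r := mul_nonneg hc0 hyr
    linarith
  have hDε : ∀ r ∈ Icc a b, ε ≤ D r := by
    intro r hr
    rcases le_or_gt 0 (y r) with h | h
    · exact hQ r hr h
    -- `y` passes through `0` at some `q` before `r`; from `q` on the density vanishes and `D' = 1`,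
    -- so the bound at `q` persists.
    · have hcont : ContinuousOn y (Icc a r) := fun t ht =>
        ((hy' t ⟨ht.1, ht.2.trans hr.2⟩).continuousWithinAt).mono (Icc_subset_Icc_right hr.2)
      obtain ⟨q, hq, hq0⟩ := intermediate_value_Icc' hr.1 hcont ⟨h.le, hya ▸ hY.le⟩
      have hsub : Icc q r ⊆ Icc a b := Icc_subset_Icc hq.1 hr.2
      have hm := monotoneOn_of_hasDerivWithinAt_Icc (f := D) (a := q) (b := r)
        (fun t ht => (hD' t (hsub ht)).mono hsub) (fun t ht => by
          have h1 := hyanti (hsub ⟨le_rfl, hq.2⟩) (hsub ht) ht.1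
          simp only [hq0] at h1
          have h2 : y t ≤ 0 := by linarith
          rw [hρz t (hsub ht) _ ((min_le_left _ _).trans h2)]
          norm_num)
      exact (hQ q (hsub ⟨le_rfl, hq.2⟩) hq0.ge).trans (hm ⟨le_rfl, hq.2⟩ ⟨hq.2, le_rfl⟩ hq.2)
  refine ⟨y, D, hya, hDa, fun r hr => ⟨hε.trans_le (hDε r hr), hDle r hr, hyY r hr, ?_, ?_⟩⟩
  · have h1 := hy' r hr
    have h2 : T r = D r := by
      simp only [hT]
      rw [min_eq_left (hDle r hr), max_eq_right (hDε r hr)]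
    rwa [h2, min_eq_left (hyY r hr)] at h1
  · have h1 := hD' r hr
    rwa [min_eq_left (hyY r hr)] at h1

end

section

/-! ### The parameters of the shell and the vacuum solution -/

/-- The standing assumptions on the parameters. -/
structure ShellData (M L0 E0 η0 : ℝ) (χ Φ : ℝ → ℝ) (l δ C : ℝ) : Prop where
  M_pos : 0 < M
  L0_gt : 12 * M ^ 2 < L0
  E0_gt : effPot M L0 (rCrit M L0) < E0
  E0_lt : E0 < min 1 (effPot M L0 (sCrit M L0))
  η0_pos : 0 < η0
  η0_lt : sCrit M L0 + η0 < rMinus M E0 L0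
  χ_smooth : ContDiff ℝ (⊤ : ℕ∞) χ
  χ_nonneg : ∀ s, 0 ≤ χ s
  χ_zero : ∀ s, s ≤ 0 → χ s = 0
  χ_one : ∀ s, η0 ≤ s → χ s = 1
  l_gt : -(1 / 2) < l
  profile : IsProfile Φ C
  δ_nonneg : 0 ≤ δ

/-- The density `δ χ(r - r₀) G(r, y)` as a function of `(r, y)`. -/
def rhoAt (M : ℝ) (χ Φ : ℝ → ℝ) (l L0 δ r y : ℝ) : ℝ := δ * χ (r - sCrit M L0) * G Φ l L0 r y

/-- The pressure `δ χ(r - r₀) H(r, y)` as a function of `(r, y)`. -/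
def pAt (M : ℝ) (χ Φ : ℝ → ℝ) (l L0 δ r y : ℝ) : ℝ := δ * χ (r - sCrit M L0) * H Φ l L0 r y

theorem contDiffOn_one_of_hasDerivAt {f f' : ℝ → ℝ} {s : Set ℝ} (hs : IsOpen s)
    (h : ∀ x ∈ s, HasDerivAt f (f' x) x) (hc : ContinuousOn f' s) : ContDiffOn ℝ 1 f s := by
  rw [contDiffOn_one_iff_derivWithin hs.uniqueDiffOn]
  refine ⟨fun x hx => (h x hx).differentiableAt.differentiableWithinAt, hc.congr fun x hx => ?_⟩
  rw [derivWithin_of_isOpen hs hx, (h x hx).deriv]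

theorem eqOn_of_hasDerivWithinAt_Icc {f g f' : ℝ → ℝ} {a b : ℝ}
    (hf : ∀ t ∈ Icc a b, HasDerivWithinAt f (f' t) (Icc a b) t)
    (hg : ∀ t ∈ Icc a b, HasDerivWithinAt g (f' t) (Icc a b) t) {c : ℝ} (hc : c ∈ Icc a b)
    (h : f c = g c) : EqOn f g (Icc a b) := by
  have h1 := monotoneOn_of_hasDerivWithinAt_Icc (fun t ht => (hf t ht).sub (hg t ht))
    (fun t _ => (sub_self _).ge)
  have h2 := monotoneOn_of_hasDerivWithinAt_Icc (fun t ht => (hg t ht).sub (hf t ht))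
    (fun t _ => (sub_self _).ge)
  intro t ht
  rcases le_total c t with hct | hct
  · have e1 := h1 hc ht hct
    have e2 := h2 hc ht hct
    simp only [Pi.sub_apply] at e1 e2
    linarith
  · have e1 := h1 ht hc hct
    have e2 := h2 ht hc hct
    simp only [Pi.sub_apply] at e1 e2
    linarith

theorem hasDerivAt_integral_of_continuousOn {f : ℝ → ℝ} {s : Set ℝ} (hs : IsOpen s)
    (hconn : s.OrdConnected) (hf : ContinuousOn f s) {a r : ℝ} (ha : a ∈ s) (hr : r ∈ s) :
    HasDerivAt (fun r => ∫ t in a..r, f t) (f r) r :=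
  intervalIntegral.integral_hasDerivAt_right
    ((hf.mono (hconn.uIcc_subset ha hr)).intervalIntegrable)
    (hf.stronglyMeasurableAtFilter hs r hr) (hf.continuousAt (hs.mem_nhds hr))

/-- The right-hand side of the reduced equation in terms of `D = r - 2 (M + m)`. -/
theorem reduced_rhs_eq {M m r p : ℝ} (hr : r ≠ 0) (hD : r - 2 * (M + m) ≠ 0) :
    -(1 / (1 - 2 / r * (M + m)) * ((M + m) / r ^ 2 + 4 * Real.pi * r * p)) =
      1 / (2 * r) - (1 / 2 + 4 * Real.pi * r ^ 2 * p) / (r - 2 * (M + m)) := by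
  have e : 1 - 2 / r * (M + m) = (r - 2 * (M + m)) / r := by field_simp
  rw [e]
  field_simp
  ring

namespace ShellData

variable {M L0 E0 η0 : ℝ} {χ Φ : ℝ → ℝ} {l δ C : ℝ}

theorem L0_pos (h : ShellData M L0 E0 η0 χ Φ l δ C) : 0 < L0 := by
  nlinarith [h.L0_gt, sq_nonneg M]

theorem E0_pos (h : ShellData M L0 E0 η0 χ Φ l δ C) : 0 < E0 :=
  (effPot_nonneg _ _ _).trans_lt h.E0_gt

theorem sCrit_gt (h : ShellData M L0 E0 η0 χ Φ l δ C) : 2 * M < sCrit M L0 :=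
  (crit_spec h.M_pos h.L0_gt).1

theorem sCrit_lt (h : ShellData M L0 E0 η0 χ Φ l δ C) : sCrit M L0 < rMinus M E0 L0 :=
  (level_spec h.M_pos h.L0_gt h.E0_gt h.E0_lt).2.1

theorem rMinus_lt (h : ShellData M L0 E0 η0 χ Φ l δ C) : rMinus M E0 L0 < rPlus M E0 L0 := by
  obtain ⟨-, -, h1, h2, -⟩ := level_spec h.M_pos h.L0_gt h.E0_gt h.E0_lt
  exact h1.trans h2

theorem four_mul_lt (h : ShellData M L0 E0 η0 χ Φ l δ C) : 4 * M < rMinus M E0 L0 :=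
  four_mul_lt_rMinus h.M_pos h.L0_gt h.E0_gt h.E0_lt

theorem rMinus_gt (h : ShellData M L0 E0 η0 χ Φ l δ C) : 2 * M < rMinus M E0 L0 :=
  h.sCrit_gt.trans h.sCrit_lt

theorem rPlus_gt (h : ShellData M L0 E0 η0 χ Φ l δ C) : 2 * M < rPlus M E0 L0 :=
  h.rMinus_gt.trans h.rMinus_lt

theorem rhoAt_nonneg (h : ShellData M L0 E0 η0 χ Φ l δ C) {r : ℝ} (hr : 0 < r) (y : ℝ) :
    0 ≤ rhoAt M χ Φ l L0 δ r y :=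
  mul_nonneg (mul_nonneg h.δ_nonneg (h.χ_nonneg _)) (G_nonneg h.profile h.l_gt h.L0_pos.le hr)

theorem pAt_nonneg (h : ShellData M L0 E0 η0 χ Φ l δ C) {r : ℝ} (hr : 0 < r) (y : ℝ) :
    0 ≤ pAt M χ Φ l L0 δ r y :=
  mul_nonneg (mul_nonneg h.δ_nonneg (h.χ_nonneg _)) (H_nonneg h.profile h.l_gt h.L0_pos.le hr)

theorem continuous_cutoff (h : ShellData M L0 E0 η0 χ Φ l δ C) :
    Continuous fun r => δ * χ (r - sCrit M L0) :=
  continuous_const.mul (h.χ_smooth.continuous.comp (by fun_prop))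

theorem continuousAt_rhoAt (h : ShellData M L0 E0 η0 χ Φ l δ C) {p : ℝ × ℝ} (hp : 0 < p.1) :
    ContinuousAt (fun p : ℝ × ℝ => rhoAt M χ Φ l L0 δ p.1 p.2) p :=
  (h.continuous_cutoff.comp continuous_fst).continuousAt.mul
    (continuousAt_G h.profile h.l_gt h.L0_pos.le p hp)

theorem continuousAt_pAt (h : ShellData M L0 E0 η0 χ Φ l δ C) {p : ℝ × ℝ} (hp : 0 < p.1) :
    ContinuousAt (fun p : ℝ × ℝ => pAt M χ Φ l L0 δ p.1 p.2) p :=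
  (h.continuous_cutoff.comp continuous_fst).continuousAt.mul
    (continuousAt_H h.profile h.l_gt h.L0_pos.le p hp)

theorem continuousOn_rhoRed (h : ShellData M L0 E0 η0 χ Φ l δ C) {y : ℝ → ℝ} {s : Set ℝ}
    (hs : ∀ r ∈ s, 0 < r) (hy : ContinuousOn y s) : ContinuousOn (rhoRed M χ Φ l L0 δ y) s :=
  fun r hr => ContinuousAt.comp_continuousWithinAt
    (g := fun p : ℝ × ℝ => rhoAt M χ Φ l L0 δ p.1 p.2) (f := fun r => (r, y r))
    (h.continuousAt_rhoAt (hs r hr)) (continuousWithinAt_id.prodMk (hy r hr))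

theorem continuousOn_pRed (h : ShellData M L0 E0 η0 χ Φ l δ C) {y : ℝ → ℝ} {s : Set ℝ}
    (hs : ∀ r ∈ s, 0 < r) (hy : ContinuousOn y s) : ContinuousOn (pRed M χ Φ l L0 δ y) s :=
  fun r hr => ContinuousAt.comp_continuousWithinAt
    (g := fun p : ℝ × ℝ => pAt M χ Φ l L0 δ p.1 p.2) (f := fun r => (r, y r))
    (h.continuousAt_pAt (hs r hr)) (continuousWithinAt_id.prodMk (hy r hr))

/-- Matter bounds for the weighted density and pressure, with a common constant. -/
theorem exists_matterBound (h : ShellData M L0 E0 η0 χ Φ l δ C) {a : ℝ} (ha : 0 < a) (b Y : ℝ) :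
    ∃ K, IsMatterBound (fun r y => 4 * Real.pi * r ^ 2 * pAt M χ Φ l L0 δ r y) a b Y K ∧
      IsMatterBound (fun r y => 8 * Real.pi * r ^ 2 * rhoAt M χ Φ l L0 δ r y) a b Y K := by
  have hw : ∀ c : ℝ, ContinuousOn (fun r => c * r ^ 2 * (δ * χ (r - sCrit M L0))) (Icc a b) :=
    fun c => (Continuous.mul (by fun_prop) h.continuous_cutoff).continuousOn
  obtain ⟨K1, h1, hK1⟩ := H_lipschitz h.profile h.l_gt h.L0_pos.le (hw (4 * Real.pi)) ha Y
  obtain ⟨K2, h2, hK2⟩ := G_lipschitz h.profile h.l_gt h.L0_pos.le (hw (8 * Real.pi)) ha Y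
  refine ⟨K1 + K2, ⟨by positivity, fun r hr y z hy hz => ?_⟩,
    ⟨by positivity, fun r hr y z hy hz => ?_⟩⟩
  · have := hK1 r hr y z hy hz
    simp only [mul_assoc] at this
    simp only [pAt, mul_assoc]
    refine ⟨this.1.trans (by linarith), this.2.trans ?_⟩
    exact mul_le_mul_of_nonneg_right (by linarith) (abs_nonneg _)
  · have := hK2 r hr y z hy hz
    simp only [mul_assoc] at this
    simp only [rhoAt, mul_assoc]
    refine ⟨this.1.trans (by linarith), this.2.trans ?_⟩
    exact mul_le_mul_of_nonneg_right (by linarith) (abs_nonneg _)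

theorem exp_neg_yVac (h : ShellData M L0 E0 η0 χ Φ l δ C) {r : ℝ} (hr : 2 * M < r) :
    Real.exp (-yVac M E0 r) = Real.sqrt (1 - 2 * M / r) / E0 := by
  have h0 : 0 < r := by linarith [h.M_pos]
  have h1 : 0 < 1 - 2 * M / r := by rw [sub_pos, div_lt_one h0]; exact hr
  rw [yVac, neg_sub, Real.exp_sub, Real.exp_log h.E0_pos, Real.sqrt_eq_rpow,
    Real.rpow_def_of_pos h1, mul_comm]

/-- For `y = y⁰` the right side is `Ψ_{L₀}⁰(r)/E⁰`, and lowering `y` only increases it. -/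
theorem one_le_of_le_yVac (h : ShellData M L0 E0 η0 χ Φ l δ C) {r y : ℝ} (hr : 2 * M < r)
    (hy : y ≤ yVac M E0 r) (hE : E0 ≤ effPot M L0 r) :
    1 ≤ Real.exp (-y) * Real.sqrt (1 + L0 / r ^ 2) := by
  have h1 : 1 ≤ Real.exp (-yVac M E0 r) * Real.sqrt (1 + L0 / r ^ 2) := by
    rw [h.exp_neg_yVac hr, div_mul_eq_mul_div, one_le_div h.E0_pos]
    exact hE
  refine h1.trans (mul_le_mul_of_nonneg_right ?_ (Real.sqrt_nonneg _))
  exact Real.exp_le_exp.2 (by linarith)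

theorem lt_one_of_effPot_lt (h : ShellData M L0 E0 η0 χ Φ l δ C) {r : ℝ} (hr : 2 * M < r)
    (hE : effPot M L0 r < E0) :
    Real.exp (-yVac M E0 r) * Real.sqrt (1 + L0 / r ^ 2) < 1 := by
  rw [h.exp_neg_yVac hr, div_mul_eq_mul_div, div_lt_one h.E0_pos]
  exact hE

theorem le_effPot (h : ShellData M L0 E0 η0 χ Φ l δ C) {r : ℝ} (hs : sCrit M L0 ≤ r)
    (hr : r ∉ Ioo (rMinus M E0 L0) (rPlus M E0 L0)) : E0 ≤ effPot M L0 r := by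
  rcases le_or_gt r (rMinus M E0 L0) with h1 | h1
  · exact le_effPot_of_le_rMinus h.M_pos h.L0_gt h.E0_gt h.E0_lt hs h1
  · exact le_effPot_of_rPlus_le h.M_pos h.L0_gt h.E0_gt h.E0_lt (not_lt.1 fun h2 => hr ⟨h1, h2⟩)

/-- Below the vacuum solution there is matter only in `]R_min, R_max[`. -/
theorem matter_eq_zero (h : ShellData M L0 E0 η0 χ Φ l δ C) {r y : ℝ} (hr : 2 * M < r)
    (hy : y ≤ yVac M E0 r) (hr' : r ∉ Ioo (rMinus M E0 L0) (rPlus M E0 L0)) :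
    rhoAt M χ Φ l L0 δ r y = 0 ∧ pAt M χ Φ l L0 δ r y = 0 := by
  rcases le_or_gt (sCrit M L0) r with hs | hs
  · have := h.one_le_of_le_yVac hr hy (h.le_effPot hs hr')
    simp only [rhoAt, pAt, G_eq_zero this, H_eq_zero this, mul_zero, and_self]
  · have : χ (r - sCrit M L0) = 0 := h.χ_zero _ (by linarith)
    simp only [rhoAt, pAt, this, mul_zero, zero_mul, and_self]

theorem matter_eq_zero_of_nonpos (h : ShellData M L0 E0 η0 χ Φ l δ C) (r : ℝ) {y : ℝ}
    (hy : y ≤ 0) : rhoAt M χ Φ l L0 δ r y = 0 := by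
  rw [rhoAt, G_eq_zero (one_le_of_nonpos h.L0_pos.le hy), mul_zero]

/-- The density and the pressure vanish at the same places. -/
theorem rhoAt_eq_zero_iff (h : ShellData M L0 E0 η0 χ Φ l δ C) {r : ℝ} (hr : 0 < r) (y : ℝ) :
    rhoAt M χ Φ l L0 δ r y = 0 ↔ pAt M χ Φ l L0 δ r y = 0 := by
  unfold rhoAt pAt
  rcases lt_or_ge (Real.exp (-y) * Real.sqrt (1 + L0 / r ^ 2)) 1 with h1 | h1
  · have hG := G_pos h.profile h.l_gt h.L0_pos.le hr h1
    have hH := H_pos h.profile h.l_gt h.L0_pos.le hr h1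
    simp only [mul_eq_zero, hG.ne', hH.ne', or_false]
  · simp only [G_eq_zero h1, H_eq_zero h1, mul_zero]

theorem hasDerivAt_yVac (h : ShellData M L0 E0 η0 χ Φ l δ C) {r : ℝ} (hr : 2 * M < r) :
    HasDerivAt (yVac M E0) (1 / (2 * r) - 1 / 2 / (r - 2 * M)) r := by
  have h0 : 0 < r := by linarith [h.M_pos]
  have h1 : 0 < 1 - 2 * M / r := by rw [sub_pos, div_lt_one h0]; exact hr
  have h2 : HasDerivAt (fun r : ℝ => 2 * M / r) (-(2 * M) / r ^ 2) r := by
    have := (hasDerivAt_inv h0.ne').const_mul (2 * M)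
    exact this.congr_deriv (by field_simp)
  have h3 := ((((h2.const_sub 1).log h1.ne').const_mul (1 / 2)).const_sub (Real.log E0))
  refine h3.congr_deriv ?_
  have h4 : r - 2 * M ≠ 0 := by linarith
  have h5 : 1 - 2 * M / r = (r - 2 * M) / r := by field_simp
  rw [h5]
  field_simp
  ring

theorem yVac_four_mul (h : ShellData M L0 E0 η0 χ Φ l δ C) :
    yVac M E0 (4 * M) = Real.log (Real.sqrt 2 * E0) := by
  have hM := h.M_pos
  have e : 1 - 2 * M / (4 * M) = 2⁻¹ := by field_simp; norm_num
  rw [yVac, e, Real.log_inv, Real.log_mul (by positivity) h.E0_pos.ne', Real.log_sqrt zero_le_two]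
  ring

/-- At `R_min` the product `e^{-y⁰}√(1 + L₀/r²)` is exactly `1` and the root exceeds `1`. Positivity
of the initial value is needed in `exists_radial_solution`. -/
theorem yVac_rMinus_pos (h : ShellData M L0 E0 η0 χ Φ l δ C) :
    0 < yVac M E0 (rMinus M E0 L0) := by
  have hr := h.rMinus_gt
  have h0 : 0 < rMinus M E0 L0 := by linarith [h.M_pos]
  have hL := h.L0_pos
  obtain ⟨-, -, -, -, h5, -⟩ := level_spec h.M_pos h.L0_gt h.E0_gt h.E0_lt
  have h1 : Real.exp (-yVac M E0 (rMinus M E0 L0)) *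
      Real.sqrt (1 + L0 / rMinus M E0 L0 ^ 2) = 1 := by
    rw [h.exp_neg_yVac hr, div_mul_eq_mul_div, div_eq_one_iff_eq h.E0_pos.ne']
    exact h5
  have h2 : 1 < Real.sqrt (1 + L0 / rMinus M E0 L0 ^ 2) := by
    rw [Real.lt_sqrt zero_le_one]
    have : 0 < L0 / rMinus M E0 L0 ^ 2 := by positivity
    linarith
  by_contra! hle
  have h3 : 1 ≤ Real.exp (-yVac M E0 (rMinus M E0 L0)) := Real.one_le_exp (by linarith)
  nlinarith

end ShellData

end

section

/-! ### Existence of the solution -/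

namespace ShellData

variable {M L0 E0 η0 : ℝ} {χ Φ : ℝ → ℝ} {l δ C : ℝ}

/-- The solution on `[R_min, R_max]`, together with `D = r - 2 (M + m)`. -/
theorem exists_solution_on_shell (h : ShellData M L0 E0 η0 χ Φ l δ C) :
    ∃ y D : ℝ → ℝ, y (rMinus M E0 L0) = yVac M E0 (rMinus M E0 L0) ∧
      D (rMinus M E0 L0) = rMinus M E0 L0 - 2 * M ∧
      ∀ r ∈ Icc (rMinus M E0 L0) (rPlus M E0 L0), 0 < D r ∧ y r ≤ yVac M E0 r ∧
      HasDerivWithinAt y (1 / (2 * r) - (1 / 2 + 4 * Real.pi * r ^ 2 *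
        pAt M χ Φ l L0 δ r (y r)) / D r) (Icc (rMinus M E0 L0) (rPlus M E0 L0)) r ∧
      HasDerivWithinAt D (1 - 8 * Real.pi * r ^ 2 * rhoAt M χ Φ l L0 δ r (y r))
        (Icc (rMinus M E0 L0) (rPlus M E0 L0)) r := by
  have hM := h.M_pos
  have ha := h.rMinus_gt
  have hab := h.rMinus_lt
  set a := rMinus M E0 L0
  set b := rPlus M E0 L0
  have ha0 : 0 < a := by linarith
  obtain ⟨K, hp, hρ⟩ := h.exists_matterBound ha0 b (yVac M E0 a)
  have hpos : ∀ r ∈ Icc a b, 0 < r := fun r hr => ha0.trans_le hr.1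
  obtain ⟨y, D, hya, hDa, hsol⟩ := exists_radial_solution
    (p := fun r y => 4 * Real.pi * r ^ 2 * pAt M χ Φ l L0 δ r y)
    (ρ := fun r y => 8 * Real.pi * r ^ 2 * rhoAt M χ Φ l L0 δ r y) hM ha hab.le h.yVac_rMinus_pos
    (fun y r hr => (ContinuousAt.mul (by fun_prop)
      (ContinuousAt.comp (g := fun p : ℝ × ℝ => pAt M χ Φ l L0 δ p.1 p.2) (f := fun r => (r, y))
        (h.continuousAt_pAt (hpos r hr)) (by fun_prop))).continuousWithinAt)
    (fun y r hr => (ContinuousAt.mul (by fun_prop)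
      (ContinuousAt.comp (g := fun p : ℝ × ℝ => rhoAt M χ Φ l L0 δ p.1 p.2) (f := fun r => (r, y))
        (h.continuousAt_rhoAt (hpos r hr)) (by fun_prop))).continuousWithinAt)
    hp hρ
    (fun r hr y => mul_nonneg (by positivity) (h.pAt_nonneg (hpos r hr) y))
    (fun r hr y => mul_nonneg (by positivity) (h.rhoAt_nonneg (hpos r hr) y))
    (fun r hr y hy => by rw [h.matter_eq_zero_of_nonpos r hy, mul_zero])
  -- The vacuum equation is the same equation with `p = 0` and `D = r - 2M`; matter increases the
  -- numerator and decreases the denominator.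
  have hle : ∀ r ∈ Icc a b, y r ≤ yVac M E0 r := by
    intro r hr
    have hm := monotoneOn_of_hasDerivWithinAt_Icc (f := fun r => yVac M E0 r - y r)
      (fun t ht => (h.hasDerivAt_yVac (ha.trans_le ht.1)).hasDerivWithinAt.sub (hsol t ht).2.2.2.1)
      (fun t ht => by
        obtain ⟨hD0, hD1, -⟩ := hsol t ht
        have hp0 : 0 ≤ 4 * Real.pi * t ^ 2 * pAt M χ Φ l L0 δ t (y t) :=
          mul_nonneg (by positivity) (h.pAt_nonneg (hpos t ht) _)
        have : 1 / 2 / (t - 2 * M) ≤ (1 / 2 + 4 * Real.pi * t ^ 2 *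
            pAt M χ Φ l L0 δ t (y t)) / D t :=
          div_le_div₀ (by positivity) (by linarith) hD0 hD1
        linarith)
    have := hm ⟨le_rfl, hab.le⟩ hr hr.1
    simp only [hya] at this
    linarith
  exact ⟨y, D, hya, hDa, fun r hr => ⟨(hsol r hr).1, hle r hr, (hsol r hr).2.2.2⟩⟩

/-- The conclusion of the construction: a solution of the reduced equation with the bounds that
determine where the matter is. -/
structure IsShellSolution (M L0 E0 : ℝ) (χ Φ : ℝ → ℝ) (l δ : ℝ) (y : ℝ → ℝ) : Prop where
  solves : IsReducedSolution M χ Φ l L0 E0 δ y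
  untrapped : ∀ r, 2 * M < r → 2 * (M + mRed M χ Φ l L0 δ y r) < r
  le_yVac : ∀ r, 2 * M < r → y r ≤ yVac M E0 r
  eq_yVac : ∀ r ∈ Ioc (2 * M) (rMinus M E0 L0), y r = yVac M E0 r

/-- The matter terms of the shell solution vanish at `R_min` and `R_max`, so they extend
continuously by zero. With these given sources `D` and `y` are defined on all of `]2M, ∞[` by
integration, which avoids gluing; afterwards the sources are recognised as those generated by `y`
itself. -/
theorem exists_isShellSolution (h : ShellData M L0 E0 η0 χ Φ l δ C) :
    ∃ y, IsShellSolution M L0 E0 χ Φ l δ y := by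
  obtain ⟨y1, D1, hya, hDa, hsol⟩ := h.exists_solution_on_shell
  have hM := h.M_pos
  have ha := h.rMinus_gt
  have hab := h.rMinus_lt
  have h4 := h.four_mul_lt
  have hzero := fun r y => h.matter_eq_zero (r := r) (y := y)
  set a := rMinus M E0 L0
  set b := rPlus M E0 L0
  have ha0 : 0 < a := by linarith
  -- Clamping `r` to `[a, b]` freezes the sources at their endpoint values, which are zero.
  set c : ℝ → ℝ := fun r => max a (min r b) with hc
  have hcc : Continuous c := by fun_prop
  have hcmem : ∀ r, c r ∈ Icc a b := fun r => ⟨le_max_left _ _, max_le hab.le (min_le_right _ _)⟩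
  have hcin : ∀ r ∈ Icc a b, c r = r := fun r hr => by
    simp only [hc]; rw [min_eq_left hr.2, max_eq_right hr.1]
  have hcle : ∀ r, r ≤ a → c r = a := fun r hr =>
    max_eq_left ((min_le_left _ _).trans hr)
  have hcge : ∀ r, b ≤ r → c r = b := fun r hr => by
    simp only [hc]; rw [min_eq_right hr, max_eq_right hab.le]
  have hy1c : ContinuousOn y1 (Icc a b) := fun r hr => (hsol r hr).2.2.1.continuousWithinAt
  have hy1cc : Continuous fun r => y1 (c r) := hy1c.comp_continuous hcc hcmem
  have hend : ∀ r, r ∉ Ioo a b → rhoAt M χ Φ l L0 δ (c r) (y1 (c r)) = 0 ∧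
      pAt M χ Φ l L0 δ (c r) (y1 (c r)) = 0 := by
    intro r hr
    refine hzero _ _ (ha.trans_le (hcmem r).1) (hsol _ (hcmem r)).2.1 ?_
    rcases le_or_gt r a with h1 | h1
    · rw [hcle r h1]; exact fun h => lt_irrefl _ h.1
    · rw [hcge r (not_lt.1 fun h2 => hr ⟨h1, h2⟩)]; exact fun h => lt_irrefl _ h.2
  set R : ℝ → ℝ := fun r => 8 * Real.pi * c r ^ 2 * rhoAt M χ Φ l L0 δ (c r) (y1 (c r)) with hR
  set P : ℝ → ℝ := fun r => 4 * Real.pi * c r ^ 2 * pAt M χ Φ l L0 δ (c r) (y1 (c r)) with hP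
  have hc0 : ∀ r, 0 < c r := fun r => ha0.trans_le (hcmem r).1
  have hRc : Continuous R := by
    refine Continuous.mul (by fun_prop) (continuous_iff_continuousAt.2 fun r => ?_)
    exact ContinuousAt.comp (g := fun p : ℝ × ℝ => rhoAt M χ Φ l L0 δ p.1 p.2)
      (f := fun r => (c r, y1 (c r))) (h.continuousAt_rhoAt (hc0 r))
      (hcc.prodMk hy1cc).continuousAt
  have hPc : Continuous P := by
    refine Continuous.mul (by fun_prop) (continuous_iff_continuousAt.2 fun r => ?_)
    exact ContinuousAt.comp (g := fun p : ℝ × ℝ => pAt M χ Φ l L0 δ p.1 p.2)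
      (f := fun r => (c r, y1 (c r))) (h.continuousAt_pAt (hc0 r))
      (hcc.prodMk hy1cc).continuousAt
  have hR0 : ∀ r, 0 ≤ R r := fun r => mul_nonneg (by positivity) (h.rhoAt_nonneg (hc0 r) _)
  have hP0 : ∀ r, 0 ≤ P r := fun r => mul_nonneg (by positivity) (h.pAt_nonneg (hc0 r) _)
  have hRz : ∀ r, r ∉ Ioo a b → R r = 0 := fun r hr => by
    simp only [hR]; rw [(hend r hr).1, mul_zero]
  have hPz : ∀ r, r ∉ Ioo a b → P r = 0 := fun r hr => by
    simp only [hP]; rw [(hend r hr).2, mul_zero]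
  set D : ℝ → ℝ := fun r => r - 2 * M - ∫ t in a..r, R t with hD
  have hD' : ∀ r, HasDerivAt D (1 - R r) r := fun r =>
    ((hasDerivAt_id r).sub_const (2 * M)).sub (hRc.integral_hasStrictDerivAt a r).hasDerivAt
  have hDc : Continuous D := continuous_iff_continuousAt.2 fun r => (hD' r).continuousAt
  have hDleft : ∀ r, r ≤ a → D r = r - 2 * M := by
    intro r hr
    have : ∫ t in a..r, R t = 0 := by
      refine (intervalIntegral.integral_congr (g := fun _ => (0 : ℝ)) fun t ht => ?_).trans
        intervalIntegral.integral_zero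
      rw [uIcc_of_ge hr] at ht
      exact hRz t fun h => absurd h.1 (not_lt.2 ht.2)
    simp only [hD]
    rw [this, sub_zero]
  have hDin : EqOn D D1 (Icc a b) := by
    refine eqOn_of_hasDerivWithinAt_Icc (f' := fun r => 1 - R r)
      (fun r _ => (hD' r).hasDerivWithinAt) (fun r hr => ?_) ⟨le_rfl, hab.le⟩
      ((hDleft a le_rfl).trans hDa.symm)
    have := (hsol r hr).2.2.2
    simp only [hR]
    rwa [hcin r hr]
  have hDle : ∀ r, a ≤ r → D r ≤ r - 2 * M := by
    intro r hr
    have : 0 ≤ ∫ t in a..r, R t := intervalIntegral.integral_nonneg hr fun t _ => hR0 t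
    simp only [hD]
    linarith
  have hDpos : ∀ r, 2 * M < r → 0 < D r := by
    intro r hr
    rcases le_or_gt r a with h1 | h1
    · rw [hDleft r h1]; linarith
    · rcases le_or_gt r b with h2 | h2
      · rw [hDin ⟨h1.le, h2⟩]; exact (hsol r ⟨h1.le, h2⟩).1
      · have hm := monotoneOn_of_hasDerivWithinAt_Icc (f := D) (a := b) (b := r)
          (fun t _ => (hD' t).hasDerivWithinAt) (fun t ht => by
            rw [hRz t fun h => absurd h.2 (not_lt.2 ht.1)]; norm_num)
        have h3 := hm ⟨le_rfl, h2.le⟩ ⟨h2.le, le_rfl⟩ h2.le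
        rw [hDin ⟨hab.le, le_rfl⟩] at h3
        exact (hsol b ⟨hab.le, le_rfl⟩).1.trans_le h3
  set F : ℝ → ℝ := fun r => 1 / (2 * r) - (1 / 2 + P r) / D r with hF
  have hFc : ContinuousOn F (Ioi (2 * M)) := by
    refine ContinuousOn.sub ?_ ?_
    · refine continuousOn_const.div (by fun_prop) fun r hr => ?_
      have : 2 * M < r := hr
      have : 0 < r := by linarith
      positivity
    · exact (continuous_const.add hPc).continuousOn.div hDc.continuousOn fun r hr => (hDpos r hr).ne'
  set y : ℝ → ℝ := fun r => yVac M E0 a + ∫ t in a..r, F t with hy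
  have hy' : ∀ r, 2 * M < r → HasDerivAt y (F r) r := fun r hr =>
    (hasDerivAt_integral_of_continuousOn isOpen_Ioi ordConnected_Ioi hFc ha hr).const_add _
  have hya' : y a = yVac M E0 a := by simp [hy]
  have hyin : EqOn y y1 (Icc a b) := by
    refine eqOn_of_hasDerivWithinAt_Icc (f' := F)
      (fun r hr => (hy' r (ha.trans_le hr.1)).hasDerivWithinAt) (fun r hr => ?_) ⟨le_rfl, hab.le⟩
      (hya'.trans hya.symm)
    have h1 := (hsol r hr).2.2.1
    simp only [hF, hP]
    rwa [hcin r hr, hDin hr]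
  have hyleft : ∀ r ∈ Ioc (2 * M) a, y r = yVac M E0 r := by
    intro r hr
    have := eqOn_of_hasDerivWithinAt_Icc (f := y) (g := yVac M E0) (f' := F) (a := r) (b := a)
      (fun t ht => (hy' t (hr.1.trans_le ht.1)).hasDerivWithinAt) (fun t ht => by
        refine (h.hasDerivAt_yVac (hr.1.trans_le ht.1)).hasDerivWithinAt.congr_deriv ?_
        simp only [hF]
        rw [hPz t fun h => absurd h.1 (not_lt.2 ht.2), hDleft t ht.2, add_zero])
      ⟨hr.2, le_rfl⟩ hya'
    exact this ⟨le_rfl, hr.2⟩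
  have hyle : ∀ r, 2 * M < r → y r ≤ yVac M E0 r := by
    intro r hr
    rcases le_or_gt r a with h1 | h1
    · exact (hyleft r ⟨hr, h1⟩).le
    · have hm := monotoneOn_of_hasDerivWithinAt_Icc (f := fun r => yVac M E0 r - y r) (a := a)
        (b := r) (fun t ht => ((h.hasDerivAt_yVac (ha.trans_le ht.1)).sub
          (hy' t (ha.trans_le ht.1))).hasDerivWithinAt) (fun t ht => by
          have h2 : 1 / 2 / (t - 2 * M) ≤ (1 / 2 + P t) / D t :=
            div_le_div₀ (by linarith [hP0 t]) (by linarith [hP0 t])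
              (hDpos t (ha.trans_le ht.1)) (hDle t ht.1)
          simp only [hF]
          linarith)
      have := hm ⟨le_rfl, h1.le⟩ ⟨h1.le, le_rfl⟩ h1.le
      simp only [hya'] at this
      linarith
  -- Self-consistency: inside the shell `y` is the shell solution; outside, `y ≤ y⁰` forces the
  -- density of `y` to vanish, just as `R` does.
  have hRρ : ∀ r, 2 * M < r → 8 * Real.pi * r ^ 2 * rhoRed M χ Φ l L0 δ y r = R r := by
    intro r hr
    by_cases hrs : r ∈ Ioo a b
    · have hrs' := Ioo_subset_Icc_self hrs
      simp only [hR]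
      rw [hcin r hrs', ← hyin hrs']
      rfl
    · rw [hRz r hrs, show rhoRed M χ Φ l L0 δ y r = 0 from (hzero r (y r) hr (hyle r hr) hrs).1,
        mul_zero]
  have hPp : ∀ r, 2 * M < r → 4 * Real.pi * r ^ 2 * pRed M χ Φ l L0 δ y r = P r := by
    intro r hr
    by_cases hrs : r ∈ Ioo a b
    · have hrs' := Ioo_subset_Icc_self hrs
      simp only [hP]
      rw [hcin r hrs', ← hyin hrs']
      rfl
    · rw [hPz r hrs, show pRed M χ Φ l L0 δ y r = 0 from (hzero r (y r) hr (hyle r hr) hrs).2,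
        mul_zero]
  have hDm : ∀ r, 2 * M < r → D r = r - 2 * (M + mRed M χ Φ l L0 δ y r) := by
    intro r hr
    have h1 : mRed M χ Φ l L0 δ y r = 1 / 2 * ∫ t in (2 * M)..r, R t := by
      rw [mRed, ← intervalIntegral.integral_const_mul, ← intervalIntegral.integral_const_mul]
      refine intervalIntegral.integral_congr_Ioo_of_le hr.le fun t ht => ?_
      rw [← hRρ t ht.1]
      ring
    have h2 : ∫ t in (2 * M)..a, R t = 0 := by
      refine (intervalIntegral.integral_congr (g := fun _ => (0 : ℝ)) fun t ht => ?_).trans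
        intervalIntegral.integral_zero
      rw [uIcc_of_le ha.le] at ht
      exact hRz t fun h => absurd h.1 (not_lt.2 ht.2)
    rw [h1, ← intervalIntegral.integral_add_adjacent_intervals (hRc.intervalIntegrable (2 * M) a)
      (hRc.intervalIntegrable a r), h2]
    simp only [hD]
    ring
  refine ⟨y, ⟨contDiffOn_one_of_hasDerivAt isOpen_Ioi hy' hFc, ?_, fun r hr => ?_⟩, fun r hr => ?_,
    hyle, hyleft⟩
  · rw [hyleft (4 * M) ⟨by linarith, h4.le⟩, h.yVac_four_mul]
  · have hr0 : 0 < r := by linarith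
    have hDr := hDpos r hr
    rw [hDm r hr] at hDr
    constructor
    · have e : 1 - 2 / r * (M + mRed M χ Φ l L0 δ y r) =
          (r - 2 * (M + mRed M χ Φ l L0 δ y r)) / r := by field_simp
      rw [e]
      positivity
    · rw [reduced_rhs_eq hr0.ne' hDr.ne', hPp r hr, ← hDm r hr]
      exact hy' r hr
  · have hDr := hDpos r hr
    rw [hDm r hr] at hDr
    linarith

end ShellData

end

section

/-! ### The mass function and uniqueness -/

namespace ShellData

variable {M L0 E0 η0 : ℝ} {χ Φ : ℝ → ℝ} {l δ C : ℝ} {y z : ℝ → ℝ}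

theorem mRed_eq_zero (hρ : ∀ r ∈ Ioc (2 * M) (4 * M), rhoRed M χ Φ l L0 δ y r = 0) {r : ℝ}
    (hr : r ∈ Ioc (2 * M) (4 * M)) : mRed M χ Φ l L0 δ y r = 0 := by
  have : ∫ s in (2 * M)..r, s ^ 2 * rhoRed M χ Φ l L0 δ y s = 0 := by
    refine (intervalIntegral.integral_congr_Ioo_of_le (g := fun _ => (0 : ℝ)) hr.1.le
      fun t ht => ?_).trans intervalIntegral.integral_zero
    rw [hρ t ⟨ht.1, (ht.2.trans_le hr.2).le⟩, mul_zero]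
  rw [mRed, this, mul_zero]

theorem continuousOn_massDensity (h : ShellData M L0 E0 η0 χ Φ l δ C)
    (hy : ContinuousOn y (Ioi (2 * M))) :
    ContinuousOn (fun s => s ^ 2 * rhoRed M χ Φ l L0 δ y s) (Ioi (2 * M)) :=
  (continuousOn_id.pow 2).mul (h.continuousOn_rhoRed (fun r hr => by
    have : 2 * M < r := hr
    linarith [h.M_pos]) hy)

/-- Nothing is known about `y` at the endpoint `2M`. Moving the base point to `4M`, inside the
domain, makes the mass differentiable by the fundamental theorem of calculus. -/
theorem mRed_eq (h : ShellData M L0 E0 η0 χ Φ l δ C) (hy : ContinuousOn y (Ioi (2 * M)))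
    (hρ : ∀ r ∈ Ioc (2 * M) (4 * M), rhoRed M χ Φ l L0 δ y r = 0) {r : ℝ} (hr : 2 * M < r) :
    mRed M χ Φ l L0 δ y r =
      4 * Real.pi * ∫ s in (4 * M)..r, s ^ 2 * rhoRed M χ Φ l L0 δ y s := by
  have hM := h.M_pos
  have h4 : 2 * M < 4 * M := by linarith
  have hi : IntervalIntegrable (fun s => s ^ 2 * rhoRed M χ Φ l L0 δ y s) volume (2 * M) (4 * M) := by
    rw [intervalIntegrable_iff_integrableOn_Ioc_of_le h4.le]
    refine integrableOn_zero.congr_fun (fun t ht => ?_) measurableSet_Ioc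
    rw [hρ t ht, mul_zero]
  have h0 := mRed_eq_zero hρ (r := 4 * M) ⟨h4, le_rfl⟩
  rw [mRed] at h0
  rw [mRed, ← intervalIntegral.integral_add_adjacent_intervals hi
    (((h.continuousOn_massDensity hy).mono
      (ordConnected_Ioi.uIcc_subset h4 hr)).intervalIntegrable), mul_add, h0, zero_add]

theorem hasDerivAt_mRed (h : ShellData M L0 E0 η0 χ Φ l δ C) (hy : ContinuousOn y (Ioi (2 * M)))
    (hρ : ∀ r ∈ Ioc (2 * M) (4 * M), rhoRed M χ Φ l L0 δ y r = 0) {r : ℝ} (hr : 2 * M < r) :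
    HasDerivAt (mRed M χ Φ l L0 δ y) (4 * Real.pi * (r ^ 2 * rhoRed M χ Φ l L0 δ y r)) r := by
  have h4 : 2 * M < 4 * M := by linarith [h.M_pos]
  refine ((hasDerivAt_integral_of_continuousOn isOpen_Ioi ordConnected_Ioi
    (h.continuousOn_massDensity hy) h4 hr).const_mul (4 * Real.pi)).congr_of_eventuallyEq ?_
  filter_upwards [Ioi_mem_nhds hr] with t ht
  exact h.mRed_eq hy hρ ht

/-- A solution is only required to have a nonvanishing denominator; since it is continuous and
positive at `4M`, it cannot change sign. -/
theorem denominator_pos (h : ShellData M L0 E0 η0 χ Φ l δ C)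
    (hz : IsReducedSolution M χ Φ l L0 E0 δ z)
    (hρ : ∀ r ∈ Ioc (2 * M) (4 * M), rhoRed M χ Φ l L0 δ z r = 0) {r : ℝ} (hr : 2 * M < r) :
    0 < r - 2 * (M + mRed M χ Φ l L0 δ z r) := by
  have hM := h.M_pos
  have hzc : ContinuousOn z (Ioi (2 * M)) := hz.1.continuousOn
  rcases le_or_gt r (4 * M) with h1 | h1
  · rw [mRed_eq_zero hρ ⟨hr, h1⟩]; linarith
  · by_contra! hneg
    have hcont : ContinuousOn (fun r => r - 2 * (M + mRed M χ Φ l L0 δ z r)) (Icc (4 * M) r) := by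
      intro t ht
      have := (h.hasDerivAt_mRed hzc hρ (r := t) (by linarith [ht.1])).continuousAt
      exact (continuousAt_id.sub (continuousAt_const.mul
        (continuousAt_const.add this))).continuousWithinAt
    have h4 : 0 ≤ 4 * M - 2 * (M + mRed M χ Φ l L0 δ z (4 * M)) := by
      rw [mRed_eq_zero hρ ⟨by linarith, le_rfl⟩]; linarith
    obtain ⟨q, hq, hq0⟩ := intermediate_value_Icc' h1.le hcont ⟨hneg, h4⟩
    have hq1 : 2 * M < q := by linarith [hq.1]
    have hq2 : q ≠ 0 := by linarith
    refine (hz.2.2 q hq1).1 ?_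
    have e : 1 - 2 / q * (M + mRed M χ Φ l L0 δ z q) =
        (q - 2 * (M + mRed M χ Φ l L0 δ z q)) / q := by field_simp
    rw [e]
    simp only at hq0
    rw [hq0, zero_div]

theorem hasDerivAt_solution (h : ShellData M L0 E0 η0 χ Φ l δ C)
    (hz : IsReducedSolution M χ Φ l L0 E0 δ z)
    (hρ : ∀ r ∈ Ioc (2 * M) (4 * M), rhoRed M χ Φ l L0 δ z r = 0) {r : ℝ} (hr : 2 * M < r) :
    HasDerivAt z (1 / (2 * r) - (1 / 2 + 4 * Real.pi * r ^ 2 * pRed M χ Φ l L0 δ z r) /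
      (r - 2 * (M + mRed M χ Φ l L0 δ z r))) r := by
  have h1 := (hz.2.2 r hr).2
  rwa [reduced_rhs_eq (by linarith [h.M_pos]) (h.denominator_pos hz hρ hr).ne'] at h1

theorem solution_eq_yVac (h : ShellData M L0 E0 η0 χ Φ l δ C)
    (hz : IsReducedSolution M χ Φ l L0 E0 δ z)
    (hρ : ∀ r ∈ Ioc (2 * M) (4 * M), rhoRed M χ Φ l L0 δ z r = 0) {r : ℝ}
    (hr : r ∈ Ioc (2 * M) (4 * M)) : z r = yVac M E0 r := by
  have := eqOn_of_hasDerivWithinAt_Icc (a := r) (b := 4 * M)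
    (fun t ht => (h.hasDerivAt_solution hz hρ (hr.1.trans_le ht.1)).hasDerivWithinAt)
    (fun t ht => by
      have ht1 : 2 * M < t := hr.1.trans_le ht.1
      refine (h.hasDerivAt_yVac ht1).hasDerivWithinAt.congr_deriv ?_
      have hp : pRed M χ Φ l L0 δ z t = 0 :=
        (h.rhoAt_eq_zero_iff (by linarith [h.M_pos]) (z t)).1 (hρ t ⟨ht1, ht.2⟩)
      rw [hp, mRed_eq_zero hρ ⟨ht1, ht.2⟩, mul_zero, add_zero, add_zero])
    ⟨hr.2, le_rfl⟩ (hz.2.1.trans h.yVac_four_mul.symm)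
  exact this ⟨le_rfl, hr.2⟩

theorem hasDerivAt_radialField (h : ShellData M L0 E0 η0 χ Φ l δ C)
    (hz : IsReducedSolution M χ Φ l L0 E0 δ z)
    (hρ : ∀ r ∈ Ioc (2 * M) (4 * M), rhoRed M χ Φ l L0 δ z r = 0) {r : ℝ} (hr : 2 * M < r) :
    HasDerivAt (fun r => (z r, r - 2 * (M + mRed M χ Φ l L0 δ z r)))
      (radialField (fun r y => 4 * Real.pi * r ^ 2 * pAt M χ Φ l L0 δ r y)
        (fun r y => 8 * Real.pi * r ^ 2 * rhoAt M χ Φ l L0 δ r y) r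
        (z r, r - 2 * (M + mRed M χ Φ l L0 δ z r))) r := by
  refine (h.hasDerivAt_solution hz hρ hr).prodMk ?_
  have h1 := (hasDerivAt_id r).sub
    (((h.hasDerivAt_mRed hz.1.continuousOn hρ hr).const_add M).const_mul 2)
  refine h1.congr_deriv ?_
  simp only [rhoAt, rhoRed]
  ring

/-- Absence of matter in `]2M, 4M]` makes both solutions equal to `y⁰` there and fixes `m(4M) = 0`,
hence the initial value of `D`. On `[4M, r]` compactness confines both trajectories to `y ≤ Y`, `D ≥
ε`, where the field is Lipschitz. -/
theorem solution_unique (h : ShellData M L0 E0 η0 χ Φ l δ C)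
    (hy : IsReducedSolution M χ Φ l L0 E0 δ y)
    (hyρ : ∀ r ∈ Ioc (2 * M) (4 * M), rhoRed M χ Φ l L0 δ y r = 0)
    (hz : IsReducedSolution M χ Φ l L0 E0 δ z)
    (hzρ : ∀ r ∈ Ioc (2 * M) (4 * M), rhoRed M χ Φ l L0 δ z r = 0) :
    EqOn z y (Ioi (2 * M)) := by
  intro r hr
  have hM := h.M_pos
  rcases le_or_gt r (4 * M) with h1 | h1
  · rw [h.solution_eq_yVac hz hzρ ⟨hr, h1⟩, h.solution_eq_yVac hy hyρ ⟨hr, h1⟩]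
  have hsub : Icc (4 * M) r ⊆ Ioi (2 * M) := fun t ht => by
    have := ht.1
    exact show 2 * M < t by linarith
  set Z : ℝ → ℝ × ℝ := fun r => (z r, r - 2 * (M + mRed M χ Φ l L0 δ z r))
  set W : ℝ → ℝ × ℝ := fun r => (y r, r - 2 * (M + mRed M χ Φ l L0 δ y r))
  have hZ' := fun t (ht : t ∈ Icc (4 * M) r) => h.hasDerivAt_radialField hz hzρ (hsub ht)
  have hW' := fun t (ht : t ∈ Icc (4 * M) r) => h.hasDerivAt_radialField hy hyρ (hsub ht)
  have hZc : ContinuousOn Z (Icc (4 * M) r) := fun t ht =>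
    (hZ' t ht).continuousAt.continuousWithinAt
  have hWc : ContinuousOn W (Icc (4 * M) r) := fun t ht =>
    (hW' t ht).continuousAt.continuousWithinAt
  have hne : (Icc (4 * M) r).Nonempty := ⟨4 * M, le_rfl, h1.le⟩
  obtain ⟨tz, htz, hmaxz⟩ := isCompact_Icc.exists_isMaxOn hne (continuous_fst.comp_continuousOn hZc)
  obtain ⟨ty, hty, hmaxy⟩ := isCompact_Icc.exists_isMaxOn hne (continuous_fst.comp_continuousOn hWc)
  obtain ⟨sz, hsz, hminz⟩ := isCompact_Icc.exists_isMinOn hne (continuous_snd.comp_continuousOn hZc)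
  obtain ⟨sy, hsy, hminy⟩ := isCompact_Icc.exists_isMinOn hne (continuous_snd.comp_continuousOn hWc)
  set Y := max (Z tz).1 (W ty).1
  set ε := min (Z sz).2 (W sy).2
  have hε : 0 < ε := lt_min (h.denominator_pos hz hzρ (hsub hsz))
    (h.denominator_pos hy hyρ (hsub hsy))
  obtain ⟨K, hp, hρ⟩ := h.exists_matterBound (a := 4 * M) (by linarith) r Y
  obtain ⟨K', hK'⟩ := lipschitzOnWith_radialField hp hρ hε
  have := ODE_solution_unique_of_mem_Icc_right
    (s := fun _ => {z : ℝ × ℝ | z.1 ≤ Y ∧ ε ≤ z.2})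
    (fun t ht => hK' t (Ico_subset_Icc_self ht)) hZc
    (fun t ht => (hZ' t (Ico_subset_Icc_self ht)).hasDerivWithinAt)
    (fun t ht => ⟨(hmaxz (Ico_subset_Icc_self ht)).trans (le_max_left _ _),
      (min_le_left _ _).trans (hminz (Ico_subset_Icc_self ht))⟩) hWc
    (fun t ht => (hW' t (Ico_subset_Icc_self ht)).hasDerivWithinAt)
    (fun t ht => ⟨(hmaxy (Ico_subset_Icc_self ht)).trans (le_max_right _ _),
      (min_le_right _ _).trans (hminy (Ico_subset_Icc_self ht))⟩)
    (by
      have h4 : 4 * M ∈ Ioc (2 * M) (4 * M) := ⟨by linarith, le_rfl⟩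
      simp only [Z, W]
      rw [h.solution_eq_yVac hz hzρ h4, h.solution_eq_yVac hy hyρ h4, mRed_eq_zero hzρ h4,
        mRed_eq_zero hyρ h4])
  exact congrArg Prod.fst (this ⟨h1.le, le_rfl⟩)

/-- For `L₀ ≤ 16M²` the cut-off already excludes matter in `]2M, 4M]`. -/
theorem rhoRed_eq_zero_of_L0_le (h : ShellData M L0 E0 η0 χ Φ l δ C) (hL : L0 ≤ 16 * M ^ 2)
    (z : ℝ → ℝ) {r : ℝ} (hr : r ∈ Ioc (2 * M) (4 * M)) : rhoRed M χ Φ l L0 δ z r = 0 := by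
  have : χ (r - sCrit M L0) = 0 := h.χ_zero _ (by
    linarith [four_mul_le_sCrit h.M_pos h.L0_gt hL, hr.2])
  rw [rhoRed, this, mul_zero, zero_mul]

end ShellData

end

section

/-! ### Properties of the solution -/

namespace ShellData

variable {M L0 E0 η0 : ℝ} {χ Φ : ℝ → ℝ} {l δ C : ℝ} {y : ℝ → ℝ}

theorem rhoRed_eq_zero (h : ShellData M L0 E0 η0 χ Φ l δ C) (hs : IsShellSolution M L0 E0 χ Φ l δ y)
    {r : ℝ} (hr : 2 * M < r) (hr' : r ∉ Ioo (rMinus M E0 L0) (rPlus M E0 L0)) :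
    rhoRed M χ Φ l L0 δ y r = 0 := (h.matter_eq_zero hr (hs.le_yVac r hr) hr').1

theorem pRed_eq_zero (h : ShellData M L0 E0 η0 χ Φ l δ C) (hs : IsShellSolution M L0 E0 χ Φ l δ y)
    {r : ℝ} (hr : 2 * M < r) (hr' : r ∉ Ioo (rMinus M E0 L0) (rPlus M E0 L0)) :
    pRed M χ Φ l L0 δ y r = 0 := (h.matter_eq_zero hr (hs.le_yVac r hr) hr').2

theorem rhoRed_eq_zero_of_le (h : ShellData M L0 E0 η0 χ Φ l δ C)
    (hs : IsShellSolution M L0 E0 χ Φ l δ y) :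
    ∀ r ∈ Ioc (2 * M) (4 * M), rhoRed M χ Φ l L0 δ y r = 0 := fun _ hr =>
  h.rhoRed_eq_zero hs hr.1 fun hr' => absurd (hr'.1.trans_le hr.2) h.four_mul_lt.not_gt

/-- If the density vanished identically, so would `p` and `m`, and `y` would equal `y⁰` on the
shell. But there `Ψ_{L₀}⁰ < E⁰` and `χ = 1`, so `y⁰` generates positive density. -/
theorem exists_rhoRed_ne_zero (h : ShellData M L0 E0 η0 χ Φ l δ C) (hδ : 0 < δ)
    (hs : IsShellSolution M L0 E0 χ Φ l δ y) : ∃ r, 2 * M < r ∧ rhoRed M χ Φ l L0 δ y r ≠ 0 := by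
  by_contra! hzero
  have hab := h.rMinus_lt
  obtain ⟨r, hr⟩ := nonempty_Ioo.2 hab
  have hr2 : 2 * M < r := h.rMinus_gt.trans hr.1
  have hr0 : 0 < r := by linarith [h.M_pos]
  have hm0 : ∀ t, 2 * M < t → mRed M χ Φ l L0 δ y t = 0 := fun t ht => by
    have : ∫ s in (2 * M)..t, s ^ 2 * rhoRed M χ Φ l L0 δ y s = 0 := by
      refine (intervalIntegral.integral_congr_Ioo_of_le (g := fun _ => (0 : ℝ)) ht.le
        fun q hq => ?_).trans intervalIntegral.integral_zero
      rw [hzero q hq.1, mul_zero]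
    rw [mRed, this, mul_zero]
  have hρ := h.rhoRed_eq_zero_of_le hs
  have heq := eqOn_of_hasDerivWithinAt_Icc (a := rMinus M E0 L0) (b := r)
    (fun t ht => (h.hasDerivAt_solution hs.solves hρ
      (h.rMinus_gt.trans_le ht.1)).hasDerivWithinAt)
    (fun t ht => by
      have ht1 : 2 * M < t := h.rMinus_gt.trans_le ht.1
      refine (h.hasDerivAt_yVac ht1).hasDerivWithinAt.congr_deriv ?_
      have hp : pRed M χ Φ l L0 δ y t = 0 :=
        (h.rhoAt_eq_zero_iff (by linarith [h.M_pos]) (y t)).1 (hzero t ht1)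
      rw [hp, hm0 t ht1, mul_zero, add_zero, add_zero])
    ⟨le_rfl, hr.1.le⟩ (hs.eq_yVac _ ⟨h.rMinus_gt, le_rfl⟩)
  have hy := heq ⟨hr.1.le, le_rfl⟩
  have hlt := h.lt_one_of_effPot_lt hr2
    (effPot_lt_of_mem_Ioo h.M_pos h.L0_gt h.E0_gt h.E0_lt hr)
  have hG := G_pos h.profile h.l_gt h.L0_pos.le hr0 hlt
  have hχ : χ (r - sCrit M L0) = 1 := h.χ_one _ (by linarith [h.η0_lt, hr.1])
  have := hzero r hr2
  rw [rhoRed, hχ, hy] at this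
  exact (mul_pos (mul_pos hδ one_pos) hG).ne' this

theorem exists_pRed_ne_zero (h : ShellData M L0 E0 η0 χ Φ l δ C) (hδ : 0 < δ)
    (hs : IsShellSolution M L0 E0 χ Φ l δ y) : ∃ r, 2 * M < r ∧ pRed M χ Φ l L0 δ y r ≠ 0 := by
  obtain ⟨r, hr, hne⟩ := h.exists_rhoRed_ne_zero hδ hs
  exact ⟨r, hr, fun hp => hne ((h.rhoAt_eq_zero_iff (by linarith [h.M_pos]) (y r)).2 hp)⟩

theorem massDensity_eq_zero (h : ShellData M L0 E0 η0 χ Φ l δ C)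
    (hs : IsShellSolution M L0 E0 χ Φ l δ y) {r : ℝ} (hr : 2 * M < r)
    (hr' : r ∉ Ioo (rMinus M E0 L0) (rPlus M E0 L0)) : r ^ 2 * rhoRed M χ Φ l L0 δ y r = 0 := by
  rw [h.rhoRed_eq_zero hs hr hr', mul_zero]

theorem integrableOn_massDensity (h : ShellData M L0 E0 η0 χ Φ l δ C)
    (hs : IsShellSolution M L0 E0 χ Φ l δ y) :
    IntegrableOn (fun r => r ^ 2 * rhoRed M χ Φ l L0 δ y r) (Ioi (2 * M)) := by
  have hc : IntegrableOn (fun r => r ^ 2 * rhoRed M χ Φ l L0 δ y r)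
      (Icc (rMinus M E0 L0) (rPlus M E0 L0)) :=
    ((h.continuousOn_massDensity hs.solves.1.continuousOn).mono fun r hr =>
      h.rMinus_gt.trans_le hr.1).integrableOn_compact isCompact_Icc
  refine hc.of_forall_sdiff_eq_zero measurableSet_Ioi fun r hr => ?_
  exact h.massDensity_eq_zero hs hr.1 fun hr' => hr.2 (Ioo_subset_Icc_self hr')

theorem mRed_nonneg (h : ShellData M L0 E0 η0 χ Φ l δ C) (y : ℝ → ℝ) {r : ℝ} (hr : 2 * M < r) :
    0 ≤ mRed M χ Φ l L0 δ y r := by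
  refine mul_nonneg (by positivity) (intervalIntegral.integral_nonneg hr.le fun t ht => ?_)
  have : 0 < t := by linarith [ht.1, h.M_pos]
  exact mul_nonneg (by positivity) (h.rhoAt_nonneg this _)

theorem mRed_rPlus (h : ShellData M L0 E0 η0 χ Φ l δ C)
    (hs : IsShellSolution M L0 E0 χ Φ l δ y) :
    mRed M χ Φ l L0 δ y (rPlus M E0 L0) = 4 * Real.pi *
      ∫ s in (rMinus M E0 L0)..(rPlus M E0 L0), s ^ 2 * rhoRed M χ Φ l L0 δ y s := by
  have ha := h.rMinus_gt
  have hi := h.integrableOn_massDensity hs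
  have h1 : IntervalIntegrable (fun s => s ^ 2 * rhoRed M χ Φ l L0 δ y s) volume (2 * M)
      (rMinus M E0 L0) := by
    rw [intervalIntegrable_iff_integrableOn_Ioc_of_le ha.le]
    exact hi.mono_set Ioc_subset_Ioi_self
  have h2 : IntervalIntegrable (fun s => s ^ 2 * rhoRed M χ Φ l L0 δ y s) volume
      (rMinus M E0 L0) (rPlus M E0 L0) := by
    rw [intervalIntegrable_iff_integrableOn_Ioc_of_le h.rMinus_lt.le]
    exact hi.mono_set fun t ht => ha.trans ht.1
  have h3 : ∫ s in (2 * M)..(rMinus M E0 L0), s ^ 2 * rhoRed M χ Φ l L0 δ y s = 0 := by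
    refine (intervalIntegral.integral_congr_Ioo_of_le (g := fun _ => (0 : ℝ)) ha.le
      fun q hq => ?_).trans intervalIntegral.integral_zero
    exact h.massDensity_eq_zero hs hq.1 fun hq' => lt_asymm hq.2 hq'.1
  rw [mRed, ← intervalIntegral.integral_add_adjacent_intervals h1 h2, h3, zero_add]

theorem mRed_of_rPlus_le (h : ShellData M L0 E0 η0 χ Φ l δ C)
    (hs : IsShellSolution M L0 E0 χ Φ l δ y) {r : ℝ} (hr : rPlus M E0 L0 ≤ r) :
    mRed M χ Φ l L0 δ y r = mRed M χ Φ l L0 δ y (rPlus M E0 L0) := by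
  have hρ := h.rhoRed_eq_zero_of_le hs
  have := eqOn_of_hasDerivWithinAt_Icc (a := rPlus M E0 L0) (b := r)
    (f := mRed M χ Φ l L0 δ y) (g := fun _ => mRed M χ Φ l L0 δ y (rPlus M E0 L0)) (f' := 0)
    (fun t ht => by
      have ht1 : 2 * M < t := h.rPlus_gt.trans_le ht.1
      refine (h.hasDerivAt_mRed hs.solves.1.continuousOn hρ ht1).hasDerivWithinAt.congr_deriv ?_
      rw [h.massDensity_eq_zero hs ht1 fun ht' => absurd ht'.2 (not_lt.2 ht.1), mul_zero]
      rfl)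
    (fun t _ => hasDerivWithinAt_const _ _ _) ⟨le_rfl, hr⟩ rfl
  exact this ⟨hr, le_rfl⟩

/-- The mass `M + M^δ` seen from infinity. -/
theorem solution_exterior (h : ShellData M L0 E0 η0 χ Φ l δ C)
    (hs : IsShellSolution M L0 E0 χ Φ l δ y) {r : ℝ} (hr : rPlus M E0 L0 ≤ r) :
    y r = y (rPlus M E0 L0) +
      1 / 2 * Real.log (1 - 2 / rPlus M E0 L0 * (M + mRed M χ Φ l L0 δ y (rPlus M E0 L0))) -
      1 / 2 * Real.log (1 - 2 / r * (M + mRed M χ Φ l L0 δ y (rPlus M E0 L0))) := by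
  set b := rPlus M E0 L0
  have hb : 2 * M < b := h.rPlus_gt
  have hA := hs.untrapped b hb
  set A := M + mRed M χ Φ l L0 δ y b with hAdef
  have hρ := h.rhoRed_eq_zero_of_le hs
  have hM := h.M_pos
  have := eqOn_of_hasDerivWithinAt_Icc (a := b) (b := r) (f := y)
    (g := fun r => y b + 1 / 2 * Real.log (1 - 2 / b * A) - 1 / 2 * Real.log (1 - 2 / r * A))
    (fun t ht => (h.hasDerivAt_solution hs.solves hρ (hb.trans_le ht.1)).hasDerivWithinAt)
    (fun t ht => by
      have ht1 : 2 * M < t := hb.trans_le ht.1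
      have ht0 : 0 < t := by linarith
      have htA : 2 * A < t := hA.trans_le ht.1
      have ht2 : t ∉ Ioo (rMinus M E0 L0) (rPlus M E0 L0) := fun ht' =>
        absurd ht'.2 (not_lt.2 ht.1)
      have e1 : 1 - 2 / t * A = (t - 2 * A) / t := by field_simp
      have e2 : 0 < t - 2 * A := by linarith
      have h1 : HasDerivAt (fun r : ℝ => 1 - 2 / r * A) (2 * A / t ^ 2) t := by
        have := (((hasDerivAt_inv ht0.ne').const_mul 2).mul_const A).const_sub 1
        exact this.congr_deriv (by field_simp)
      have h2 := ((h1.log (by rw [e1]; positivity)).const_mul (1 / 2)).const_sub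
        (y b + 1 / 2 * Real.log (1 - 2 / b * A))
      refine h2.hasDerivWithinAt.congr_deriv ?_
      rw [h.pRed_eq_zero hs ht1 ht2, h.mRed_of_rPlus_le hs ht.1, e1, ← hAdef]
      field_simp
      ring)
    ⟨le_rfl, hr⟩ (by ring)
  exact this ⟨hr, le_rfl⟩

theorem tendsto_mass_ratio (A : ℝ) : Tendsto (fun r : ℝ => 1 - 2 / r * A) atTop (𝓝 1) := by
  have h1 : Tendsto (fun r : ℝ => 2 / r) atTop (𝓝 0) := tendsto_const_nhds.div_atTop tendsto_id
  have := (h1.mul_const A).const_sub 1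
  simpa only [zero_mul, sub_zero] using this

theorem tendsto_log_mass_ratio (A : ℝ) :
    Tendsto (fun r : ℝ => 1 / 2 * Real.log (1 - 2 / r * A)) atTop (𝓝 0) := by
  have := ((tendsto_mass_ratio A).log one_ne_zero).const_mul (1 / 2)
  simpa only [Real.log_one, mul_zero] using this

/-- The limit of `y` at infinity. -/
def yLim (M L0 E0 : ℝ) (χ Φ : ℝ → ℝ) (l δ : ℝ) (y : ℝ → ℝ) : ℝ :=
  y (rPlus M E0 L0) +
    1 / 2 * Real.log (1 - 2 / rPlus M E0 L0 * (M + mRed M χ Φ l L0 δ y (rPlus M E0 L0)))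

theorem tendsto_solution (h : ShellData M L0 E0 η0 χ Φ l δ C)
    (hs : IsShellSolution M L0 E0 χ Φ l δ y) :
    Tendsto y atTop (𝓝 (yLim M L0 E0 χ Φ l δ y)) := by
  have h1 := (tendsto_log_mass_ratio (M + mRed M χ Φ l L0 δ y (rPlus M E0 L0))).const_sub
    (yLim M L0 E0 χ Φ l δ y)
  rw [sub_zero] at h1
  refine h1.congr' ?_
  filter_upwards [eventually_ge_atTop (rPlus M E0 L0)] with r hr
  exact (h.solution_exterior hs hr).symm

/-- From `y ≤ y⁰` at `R_max` and `M + m ≥ M` the limit is at most `ln E⁰`, which is negative because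
`E⁰ < 1`. -/
theorem yLim_neg (h : ShellData M L0 E0 η0 χ Φ l δ C)
    (hs : IsShellSolution M L0 E0 χ Φ l δ y) : yLim M L0 E0 χ Φ l δ y < 0 := by
  have hb := h.rPlus_gt
  have hM := h.M_pos
  have h1 := hs.le_yVac _ hb
  have h2 := hs.untrapped _ hb
  have h3 := h.mRed_nonneg y hb
  unfold yLim
  set b := rPlus M E0 L0
  set m := mRed M χ Φ l L0 δ y b
  have hb0 : 0 < b := by linarith
  have hlog : Real.log (1 - 2 / b * (M + m)) ≤ Real.log (1 - 2 * M / b) := by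
    have e1 : 1 - 2 / b * (M + m) = (b - 2 * (M + m)) / b := by field_simp
    have e2 : 1 - 2 * M / b = (b - 2 * M) / b := by field_simp
    rw [e1, e2]
    have : 0 < b - 2 * (M + m) := by linarith
    refine Real.log_le_log (by positivity) ?_
    gcongr
    linarith
  have hE : Real.log E0 < 0 := Real.log_neg h.E0_pos (h.E0_lt.trans_le (min_le_left _ _))
  rw [yVac] at h1
  linarith

theorem tendsto_mRed (h : ShellData M L0 E0 η0 χ Φ l δ C)
    (hs : IsShellSolution M L0 E0 χ Φ l δ y) :
    Tendsto (mRed M χ Φ l L0 δ y) atTop (𝓝 (mRed M χ Φ l L0 δ y (rPlus M E0 L0))) := by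
  refine tendsto_const_nhds.congr' ?_
  filter_upwards [eventually_ge_atTop (rPlus M E0 L0)] with r hr
  exact (h.mRed_of_rPlus_le hs hr).symm

end ShellData

end

section

/-! ### The tangential pressure and the Tolman–Oppenheimer–Volkoff equation -/

/-- The tangential pressure as a function of `(r, y)`. -/
def qAt (M : ℝ) (χ Φ : ℝ → ℝ) (l L0 δ r y : ℝ) : ℝ :=
  δ * χ (r - sCrit M L0) * (Real.pi * r ^ (2 * l) * Real.exp y *
    (L0 / r ^ 2 * cConst l * shellInt Φ 0 (l + 1 / 2) (1 + L0 / r ^ 2) y +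
      cConst (l + 1) * shellInt Φ 0 (l + 3 / 2) (1 + L0 / r ^ 2) y))

/-- The derivative of `H` along a `C¹` curve. -/
theorem hasDerivAt_H {Φ : ℝ → ℝ} {C l L0 r : ℝ} {y y' : ℝ → ℝ} (hΦ : IsProfile Φ C)
    (hl : -(1 / 2) < l) (hL0 : 0 ≤ L0) (hr : 0 < r) (hy : ∀ᶠ x in 𝓝 r, HasDerivAt y (y' x) x)
    (hy' : ContinuousAt y' r) :
    HasDerivAt (fun r => H Φ l L0 r (y r))
      (y' r * (H Φ l L0 r (y r) + G Φ l L0 r (y r)) + 2 / r *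
        (Real.pi * r ^ (2 * l) * Real.exp (y r) *
          (L0 / r ^ 2 * cConst l * shellInt Φ 0 (l + 1 / 2) (1 + L0 / r ^ 2) (y r) +
            cConst (l + 1) * shellInt Φ 0 (l + 3 / 2) (1 + L0 / r ^ 2) (y r))
          - H Φ l L0 r (y r))) r := by
  simp only [H_eq hΦ hl hL0, G_eq hΦ hl hL0]
  have hb : ∀ᶠ x in 𝓝 r, HasDerivAt (fun x : ℝ => 1 + L0 / x ^ 2) (-(2 * L0) / x ^ 3) x := by
    filter_upwards [Ioi_mem_nhds hr] with x hx
    have hx0 : (0 : ℝ) < x := hx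
    have := (((hasDerivAt_pow 2 x).inv (by positivity)).const_mul L0).const_add 1
    exact this.congr_deriv (by push_cast; field_simp)
  have hb' : ContinuousAt (fun x : ℝ => -(2 * L0) / x ^ 3) r :=
    continuousAt_const.div (by fun_prop) (by positivity)
  have hS := hasDerivAt_shellInt hΦ (k := l + 3 / 2) (by linarith) hb hy hb' hy'
    (show 0 < 1 + L0 / r ^ 2 by positivity)
  have hk : l + 3 / 2 - 1 = l + 1 / 2 := by ring
  rw [hk] at hS
  have hpow := Real.hasDerivAt_rpow_const (x := r) (p := 2 * l) (Or.inl hr.ne')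
  have hexp := (hy.self_of_nhds).exp
  have hd := (((hpow.const_mul (2 * Real.pi * dConst l)).mul hexp).mul hS)
  refine hd.congr_deriv ?_
  -- `c_l = 2(l + 3/2) d_l` turns the derivative of the energy integral into `y' G` plus the
  -- `L₀`-part of `q`; `c_{l+1} = 2(l + 1) d_l` turns the derivative of `r^{2l}` into the rest of
  -- `q` minus `H`.
  rw [cConst_eq hl, cConst_succ hl, Real.rpow_sub_one hr.ne',
    show 3 * y r = y r + 2 * y r by ring, Real.exp_add]
  simp only [Pi.mul_apply]
  field_simp
  ring

namespace ShellData

variable {M L0 E0 η0 : ℝ} {χ Φ : ℝ → ℝ} {l δ C : ℝ} {y : ℝ → ℝ}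

theorem qAt_eq_zero (h : ShellData M L0 E0 η0 χ Φ l δ C) {r y : ℝ} (hr : 2 * M < r)
    (hy : y ≤ yVac M E0 r) (hr' : r ∉ Ioo (rMinus M E0 L0) (rPlus M E0 L0)) :
    qAt M χ Φ l L0 δ r y = 0 := by
  rcases le_or_gt (sCrit M L0) r with hs | hs
  · have hL := h.L0_pos
    have h1 := h.one_le_of_le_yVac hr hy (h.le_effPot hs hr')
    have h2 : 0 ≤ 1 + L0 / r ^ 2 := by positivity
    simp only [qAt, shellInt_eq_zero h2 h1, mul_zero, add_zero]
  · have : χ (r - sCrit M L0) = 0 := h.χ_zero _ (by linarith)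
    simp only [qAt, this, mul_zero, zero_mul]

theorem continuousAt_qAt (h : ShellData M L0 E0 η0 χ Φ l δ C) {p : ℝ × ℝ} (hp : 0 < p.1) :
    ContinuousAt (fun p : ℝ × ℝ => qAt M χ Φ l L0 δ p.1 p.2) p := by
  have hl := h.l_gt
  have h1 := continuousAt_weight_mul_exp_mul_shellInt (k := l + 1 / 2) (l := l) (c := 1)
    (a := Real.pi) h.profile 0 (by linarith) h.L0_pos.le p hp
  have h2 := continuousAt_weight_mul_exp_mul_shellInt (k := l + 3 / 2) (l := l) (c := 1)
    (a := Real.pi) h.profile 0 (by linarith) h.L0_pos.le p hp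
  have h3 : ContinuousAt (fun p : ℝ × ℝ => L0 / p.1 ^ 2 * cConst l) p := by
    have : p.1 ^ 2 ≠ 0 := by positivity
    fun_prop (disch := assumption)
  have h4 := (h.continuous_cutoff.comp continuous_fst).continuousAt (x := p)
  refine (h4.mul ((h3.mul h1).add (h2.const_mul (cConst (l + 1))))).congr
    (Eventually.of_forall fun q => ?_)
  simp only [qAt, Pi.mul_apply, Pi.add_apply, Function.comp_apply, one_mul]
  ring

/-- `e^{-2λ} = D / r` with `D = r - 2 (M + m)`. -/
def denom (M : ℝ) (χ Φ : ℝ → ℝ) (l L0 δ : ℝ) (y : ℝ → ℝ) (r : ℝ) : ℝ :=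
  r - 2 * (M + mRed M χ Φ l L0 δ y r)

/-- The derivative of the solution. -/
def yDer (M : ℝ) (χ Φ : ℝ → ℝ) (l L0 δ : ℝ) (y : ℝ → ℝ) (r : ℝ) : ℝ :=
  1 / (2 * r) - (1 / 2 + 4 * Real.pi * r ^ 2 * pRed M χ Φ l L0 δ y r) / denom M χ Φ l L0 δ y r

/-- The derivative of the radial pressure, by the Tolman–Oppenheimer–Volkoff equation. -/
def pDer (M : ℝ) (χ Φ : ℝ → ℝ) (l L0 δ : ℝ) (y : ℝ → ℝ) (r : ℝ) : ℝ :=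
  yDer M χ Φ l L0 δ y r * (pRed M χ Φ l L0 δ y r + rhoRed M χ Φ l L0 δ y r) +
    2 / r * (qAt M χ Φ l L0 δ r (y r) - pRed M χ Φ l L0 δ y r)

theorem denom_pos (hs : IsShellSolution M L0 E0 χ Φ l δ y) {r : ℝ} (hr : 2 * M < r) :
    0 < denom M χ Φ l L0 δ y r := sub_pos.2 (hs.untrapped r hr)

theorem hasDerivAt_denom (h : ShellData M L0 E0 η0 χ Φ l δ C)
    (hs : IsShellSolution M L0 E0 χ Φ l δ y) {r : ℝ} (hr : 2 * M < r) :
    HasDerivAt (denom M χ Φ l L0 δ y) (1 - 8 * Real.pi * r ^ 2 * rhoRed M χ Φ l L0 δ y r) r := by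
  have := (hasDerivAt_id r).sub (((h.hasDerivAt_mRed hs.solves.1.continuousOn
    (h.rhoRed_eq_zero_of_le hs) hr).const_add M).const_mul 2)
  exact this.congr_deriv (by ring)

theorem hasDerivAt_yDer (h : ShellData M L0 E0 η0 χ Φ l δ C)
    (hs : IsShellSolution M L0 E0 χ Φ l δ y) {r : ℝ} (hr : 2 * M < r) :
    HasDerivAt y (yDer M χ Φ l L0 δ y r) r :=
  h.hasDerivAt_solution hs.solves (h.rhoRed_eq_zero_of_le hs) hr

theorem continuousOn_yDer (h : ShellData M L0 E0 η0 χ Φ l δ C)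
    (hs : IsShellSolution M L0 E0 χ Φ l δ y) :
    ContinuousOn (yDer M χ Φ l L0 δ y) (Ioi (2 * M)) := by
  have hpos : ∀ r ∈ Ioi (2 * M), (0 : ℝ) < r := fun r hr => by
    have : 2 * M < r := hr
    linarith [h.M_pos]
  have hp := h.continuousOn_pRed hpos hs.solves.1.continuousOn
  have hD : ContinuousOn (denom M χ Φ l L0 δ y) (Ioi (2 * M)) := fun r hr =>
    (h.hasDerivAt_denom hs hr).continuousAt.continuousWithinAt
  have h1 : ContinuousOn (fun r : ℝ => 1 / (2 * r)) (Ioi (2 * M)) :=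
    continuousOn_const.div (by fun_prop) fun r hr => by
      have := hpos r hr
      positivity
  have h2 : ContinuousOn (fun r : ℝ => 4 * Real.pi * r ^ 2) (Ioi (2 * M)) := by fun_prop
  exact h1.sub ((continuousOn_const.add (h2.mul hp)).div hD fun r hr => (denom_pos hs hr).ne')

/-- A derivative of `χ` would destroy the equation, but none appears: beyond `s_{L₀}⁰ + η₀` the
cut-off is locally `1`, and up to there, being below `R_min`, the pressure vanishes in a
neighbourhood. -/
theorem hasDerivAt_pRed (h : ShellData M L0 E0 η0 χ Φ l δ C)
    (hs : IsShellSolution M L0 E0 χ Φ l δ y) {r : ℝ} (hr : 2 * M < r) :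
    HasDerivAt (pRed M χ Φ l L0 δ y) (pDer M χ Φ l L0 δ y r) r := by
  have hr0 : 0 < r := by linarith [h.M_pos]
  rcases lt_or_ge (sCrit M L0 + η0) r with h1 | h1
  · have hy : ∀ᶠ x in 𝓝 r, HasDerivAt y (yDer M χ Φ l L0 δ y x) x := by
      filter_upwards [Ioi_mem_nhds hr] with x hx using h.hasDerivAt_yDer hs hx
    have hy' := (h.continuousOn_yDer hs).continuousAt (Ioi_mem_nhds hr)
    have hχ : ∀ x, sCrit M L0 + η0 < x → χ (x - sCrit M L0) = 1 := fun x hx =>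
      h.χ_one _ (by linarith)
    have hd := (hasDerivAt_H h.profile h.l_gt h.L0_pos.le hr0 hy hy').const_mul δ
    have heq : pRed M χ Φ l L0 δ y =ᶠ[𝓝 r] fun x => δ * H Φ l L0 x (y x) := by
      filter_upwards [Ioi_mem_nhds h1] with x hx
      rw [pRed, hχ x hx, mul_one]
    refine (hd.congr_of_eventuallyEq heq).congr_deriv ?_
    simp only [pDer, pRed, rhoRed, qAt, hχ r h1, mul_one]
    ring
  · have hra : r < rMinus M E0 L0 := h1.trans_lt h.η0_lt
    have hout : ∀ x, x < rMinus M E0 L0 → x ∉ Ioo (rMinus M E0 L0) (rPlus M E0 L0) :=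
      fun x hx hx' => lt_asymm hx hx'.1
    have hz : pRed M χ Φ l L0 δ y =ᶠ[𝓝 r] fun _ => 0 := by
      filter_upwards [Ioo_mem_nhds hr hra] with x hx
      exact h.pRed_eq_zero hs hx.1 (hout x hx.2)
    refine ((hasDerivAt_const r (0 : ℝ)).congr_of_eventuallyEq hz).congr_deriv ?_
    rw [pDer, h.pRed_eq_zero hs hr (hout r hra), h.rhoRed_eq_zero hs hr (hout r hra),
      h.qAt_eq_zero hr (hs.le_yVac r hr) (hout r hra)]
    ring

theorem continuousOn_pDer (h : ShellData M L0 E0 η0 χ Φ l δ C)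
    (hs : IsShellSolution M L0 E0 χ Φ l δ y) :
    ContinuousOn (pDer M χ Φ l L0 δ y) (Ioi (2 * M)) := by
  have hpos : ∀ r ∈ Ioi (2 * M), (0 : ℝ) < r := fun r hr => by
    have : 2 * M < r := hr
    linarith [h.M_pos]
  have hy := hs.solves.1.continuousOn
  have hp := h.continuousOn_pRed hpos hy
  have hρ := h.continuousOn_rhoRed hpos hy
  have hq : ContinuousOn (fun r => qAt M χ Φ l L0 δ r (y r)) (Ioi (2 * M)) := fun r hr =>
    ContinuousAt.comp_continuousWithinAt
      (g := fun p : ℝ × ℝ => qAt M χ Φ l L0 δ p.1 p.2) (f := fun r => (r, y r))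
      (h.continuousAt_qAt (hpos r hr)) (continuousWithinAt_id.prodMk (hy r hr))
  have h1 : ContinuousOn (fun r : ℝ => 2 / r) (Ioi (2 * M)) :=
    continuousOn_const.div continuousOn_id fun r hr => (hpos r hr).ne'
  exact ((h.continuousOn_yDer hs).mul (hp.add hρ)).add (h1.mul (hq.sub hp))

/-- The second derivative of the solution. -/
def yDer2 (M : ℝ) (χ Φ : ℝ → ℝ) (l L0 δ : ℝ) (y : ℝ → ℝ) (r : ℝ) : ℝ :=
  -(1 / (2 * r ^ 2)) - ((8 * Real.pi * r * pRed M χ Φ l L0 δ y r +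
      4 * Real.pi * r ^ 2 * pDer M χ Φ l L0 δ y r) * denom M χ Φ l L0 δ y r -
    (1 / 2 + 4 * Real.pi * r ^ 2 * pRed M χ Φ l L0 δ y r) *
      (1 - 8 * Real.pi * r ^ 2 * rhoRed M χ Φ l L0 δ y r)) / denom M χ Φ l L0 δ y r ^ 2

theorem hasDerivAt_yDer2 (h : ShellData M L0 E0 η0 χ Φ l δ C)
    (hs : IsShellSolution M L0 E0 χ Φ l δ y) {r : ℝ} (hr : 2 * M < r) :
    HasDerivAt (yDer M χ Φ l L0 δ y) (yDer2 M χ Φ l L0 δ y r) r := by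
  have hr0 : 0 < r := by linarith [h.M_pos]
  have h1 : HasDerivAt (fun r : ℝ => 1 / (2 * r)) (-(1 / (2 * r ^ 2))) r := by
    have := ((hasDerivAt_id r).const_mul 2).inv (by simpa using hr0.ne')
    simp only [one_div]
    refine this.congr_deriv ?_
    simp only [id]
    field_simp
  have h2 : HasDerivAt (fun r : ℝ => 4 * Real.pi * r ^ 2) (8 * Real.pi * r) r := by
    refine ((hasDerivAt_pow 2 r).const_mul (4 * Real.pi)).congr_deriv ?_
    push_cast
    ring
  have h3 := ((h2.mul (h.hasDerivAt_pRed hs hr)).const_add (1 / 2)).div (h.hasDerivAt_denom hs hr)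
    (denom_pos hs hr).ne'
  exact h1.sub h3

theorem continuousOn_yDer2 (h : ShellData M L0 E0 η0 χ Φ l δ C)
    (hs : IsShellSolution M L0 E0 χ Φ l δ y) :
    ContinuousOn (yDer2 M χ Φ l L0 δ y) (Ioi (2 * M)) := by
  have hpos : ∀ r ∈ Ioi (2 * M), (0 : ℝ) < r := fun r hr => by
    have : 2 * M < r := hr
    linarith [h.M_pos]
  have hy := hs.solves.1.continuousOn
  have hp := h.continuousOn_pRed hpos hy
  have hρ := h.continuousOn_rhoRed hpos hy
  have hp' := h.continuousOn_pDer hs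
  have hD : ContinuousOn (denom M χ Φ l L0 δ y) (Ioi (2 * M)) := fun r hr =>
    (h.hasDerivAt_denom hs hr).continuousAt.continuousWithinAt
  unfold yDer2
  refine ContinuousOn.sub (ContinuousOn.neg ?_) (ContinuousOn.div ?_ (hD.pow 2) ?_)
  · exact continuousOn_const.div (by fun_prop) fun r hr => by
      have := hpos r hr
      positivity
  · fun_prop
  · intro r hr
    have := denom_pos hs hr
    positivity

theorem contDiffOn_two (h : ShellData M L0 E0 η0 χ Φ l δ C)
    (hs : IsShellSolution M L0 E0 χ Φ l δ y) : ContDiffOn ℝ 2 y (Ioi (2 * M)) := by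
  rw [show (2 : WithTop ℕ∞) = 1 + 1 by norm_num, contDiffOn_succ_iff_deriv_of_isOpen isOpen_Ioi]
  refine ⟨fun r hr => (h.hasDerivAt_yDer hs hr).differentiableAt.differentiableWithinAt,
    fun h1 => absurd h1 (by decide), ?_⟩
  refine (contDiffOn_one_of_hasDerivAt isOpen_Ioi (fun r hr => h.hasDerivAt_yDer2 hs hr)
    (h.continuousOn_yDer2 hs)).congr fun r hr => ?_
  exact (h.hasDerivAt_yDer hs hr).deriv

end ShellData

end

section

/-! ### The matter quantities of the ansatz -/

/-- The ansatz with cut-off energy `e^Y`, for the metric coefficient `μ = Y - y`. -/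
def shellDist (M L0 : ℝ) (χ Φ : ℝ → ℝ) (l δ Y : ℝ) (y : ℝ → ℝ) : E3 → E3 → ℝ :=
  ansatz M χ Φ l L0 δ (Real.exp Y) (muOf (Real.exp Y) y)

theorem energy_div (Y : ℝ) (y : ℝ → ℝ) (x v : E3) :
    energy (muOf (Real.exp Y) y) x v / Real.exp Y =
      Real.exp (-y ‖x‖) * Real.sqrt (1 + ‖v‖ ^ 2) := by
  rw [energy, muOf, Real.log_exp, mul_comm, mul_div_assoc, ← Real.exp_sub, mul_comm]
  congr 2
  ring

theorem shellDist_eq (M L0 : ℝ) (χ Φ : ℝ → ℝ) (l δ Y : ℝ) (y : ℝ → ℝ) (x v : E3) :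
    shellDist M L0 χ Φ l δ Y y x v = δ * χ (‖x‖ - sCrit M L0) *
      (Φ (1 - Real.exp (-y ‖x‖) * Real.sqrt (1 + ‖v‖ ^ 2)) * posPow (angMom x v - L0) l) := by
  rw [shellDist, ansatz, eos, energy_div]

theorem norm_sq_mul_velMap_snd {x : E3} (hx : x ≠ 0) (v : E3) :
    ‖x‖ ^ 2 * (velMap x v).2 = angMom x v := by
  have hr : 0 < ‖x‖ := norm_pos_iff.2 hx
  simp only [velMap]
  field_simp

namespace ShellData

variable {M L0 E0 η0 : ℝ} {χ Φ : ℝ → ℝ} {l δ C Y : ℝ} {y : ℝ → ℝ}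

theorem rho_integrand_eq {x : E3} (hx : x ≠ 0) (v : E3) :
    Real.sqrt (1 + ‖v‖ ^ 2) * shellDist M L0 χ Φ l δ Y y x v =
      δ * χ (‖x‖ - sCrit M L0) * momIntegrand Φ 2 0 l L0 ‖x‖ (y ‖x‖) (velMap x v) := by
  have hu : 0 < Real.sqrt (1 + ‖v‖ ^ 2) := Real.sqrt_pos.2 (by positivity)
  rw [shellDist_eq, momIntegrand, norm_sq_mul_velMap_snd hx]
  simp only [velMap]
  field_simp

theorem p_integrand_eq {x : E3} (hx : x ≠ 0) (v : E3) :
    radMom x v ^ 2 * shellDist M L0 χ Φ l δ Y y x v / Real.sqrt (1 + ‖v‖ ^ 2) =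
      δ * χ (‖x‖ - sCrit M L0) * momIntegrand Φ 0 1 l L0 ‖x‖ (y ‖x‖) (velMap x v) := by
  have hu : 0 < Real.sqrt (1 + ‖v‖ ^ 2) := Real.sqrt_pos.2 (by positivity)
  rw [shellDist_eq, momIntegrand, norm_sq_mul_velMap_snd hx, pow_one, ← radMom_sq_eq hx]
  simp only [velMap]
  field_simp

/-- Writing `L = L₀ + (L - L₀)` produces powers of `L - L₀` with exponents `l` and `l + 1`, both
covered by `integral_momIntegrand`. -/
theorem q_integrand_eq {x : E3} (hx : x ≠ 0) (v : E3) :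
    (angMom x v / ‖x‖ ^ 2) * shellDist M L0 χ Φ l δ Y y x v / Real.sqrt (1 + ‖v‖ ^ 2) =
      δ * χ (‖x‖ - sCrit M L0) *
        (L0 / ‖x‖ ^ 2 * momIntegrand Φ 0 0 l L0 ‖x‖ (y ‖x‖) (velMap x v) +
          1 / ‖x‖ ^ 2 * momIntegrand Φ 0 0 (l + 1) L0 ‖x‖ (y ‖x‖) (velMap x v)) := by
  have hr : 0 < ‖x‖ := norm_pos_iff.2 hx
  have hu : 0 < Real.sqrt (1 + ‖v‖ ^ 2) := Real.sqrt_pos.2 (by positivity)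
  rw [shellDist_eq, momIntegrand, momIntegrand, norm_sq_mul_velMap_snd hx, posPow_add_one]
  simp only [velMap]
  field_simp
  ring

theorem integrable_shellDist (h : ShellData M L0 E0 η0 χ Φ l δ C) {x : E3} (hx : x ≠ 0) :
    Integrable (fun v : E3 => Real.sqrt (1 + ‖v‖ ^ 2) * shellDist M L0 χ Φ l δ Y y x v) := by
  simp_rw [rho_integrand_eq hx]
  exact (integral_momIntegrand h.profile 2 0 (y ‖x‖) h.l_gt h.L0_pos.le hx).1.const_mul _

theorem rhoOf_shellDist (h : ShellData M L0 E0 η0 χ Φ l δ C) {x : E3} (hx : x ≠ 0) :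
    rhoOf (shellDist M L0 χ Φ l δ Y y) x = rhoRed M χ Φ l L0 δ y ‖x‖ := by
  rw [rhoOf]
  simp_rw [rho_integrand_eq hx]
  rw [integral_const_mul, (integral_momIntegrand h.profile 2 0 (y ‖x‖) h.l_gt h.L0_pos.le hx).2,
    rhoRed, G_eq h.profile h.l_gt h.L0_pos.le, cConst_eq_beta]
  have e : Real.exp (3 * y ‖x‖) = Real.exp (y ‖x‖) ^ 3 := by
    rw [← Real.exp_nat_mul]; norm_num
  have e1 : l + ((0 : ℕ) : ℝ) + 1 / 2 = l + 1 / 2 := by push_cast; ring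
  have e2 : ((0 : ℕ) : ℝ) - 1 / 2 = -(1 / 2) := by push_cast; norm_num
  rw [e, e1, e2]
  ring

theorem pOf_shellDist (h : ShellData M L0 E0 η0 χ Φ l δ C) {x : E3} (hx : x ≠ 0) :
    pOf (shellDist M L0 χ Φ l δ Y y) x = pRed M χ Φ l L0 δ y ‖x‖ := by
  rw [pOf]
  simp_rw [p_integrand_eq hx]
  rw [integral_const_mul, (integral_momIntegrand h.profile 0 1 (y ‖x‖) h.l_gt h.L0_pos.le hx).2,
    pRed, H_eq h.profile h.l_gt h.L0_pos.le, dConst_eq_beta]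
  have e1 : l + ((1 : ℕ) : ℝ) + 1 / 2 = l + 3 / 2 := by push_cast; ring
  have e2 : ((1 : ℕ) : ℝ) - 1 / 2 = 1 / 2 := by push_cast; norm_num
  rw [e1, e2]
  ring

theorem qOf_shellDist (h : ShellData M L0 E0 η0 χ Φ l δ C) {x : E3} (hx : x ≠ 0) :
    qOf (shellDist M L0 χ Φ l δ Y y) x = qAt M χ Φ l L0 δ ‖x‖ (y ‖x‖) := by
  have hr : 0 < ‖x‖ := norm_pos_iff.2 hx
  have hl := h.l_gt
  have i1 := integral_momIntegrand h.profile 0 0 (y ‖x‖) hl h.L0_pos.le hx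
  have i2 := integral_momIntegrand h.profile 0 0 (k := l + 1) (y ‖x‖) (by linarith) h.L0_pos.le hx
  rw [qOf]
  simp_rw [q_integrand_eq hx]
  rw [integral_const_mul, integral_add (i1.1.const_mul _) (i2.1.const_mul _), integral_const_mul,
    integral_const_mul, i1.2, i2.2, qAt, cConst_eq_beta, cConst_eq_beta]
  have e1 : l + ((0 : ℕ) : ℝ) + 1 / 2 = l + 1 / 2 := by push_cast; ring
  have e2 : l + 1 + ((0 : ℕ) : ℝ) + 1 / 2 = l + 3 / 2 := by push_cast; ring
  have e3 : ((0 : ℕ) : ℝ) - 1 / 2 = -(1 / 2) := by push_cast; norm_num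
  have e4 : ‖x‖ ^ (2 * (l + 1)) = ‖x‖ ^ (2 * l) * ‖x‖ ^ 2 := by
    rw [← Real.rpow_natCast, ← Real.rpow_add hr]; congr 1; push_cast; ring
  rw [e1, e2, e3, e4]
  field_simp
  ring

/-- The current vanishes since the ansatz is even in the radial momentum. -/
theorem jOf_shellDist (x : E3) : jOf (shellDist M L0 χ Φ l δ Y y) x = 0 := by
  rw [jOf]
  have hin : ∀ v, inner ℝ x ((Submodule.span ℝ {x})ᗮ.reflection v) = -inner ℝ x v := by
    intro v
    have h1 := (Submodule.span ℝ {x})ᗮ.reflection.inner_map_map x v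
    rw [Submodule.reflection_orthogonalComplement_singleton_eq_neg, inner_neg_left] at h1
    linarith
  have h2 := ((Submodule.span ℝ {x})ᗮ.reflection.measurePreserving).integral_comp'
    (f := (Submodule.span ℝ {x})ᗮ.reflection.toHomeomorph.toMeasurableEquiv)
    (fun v => radMom x v * shellDist M L0 χ Φ l δ Y y x v)
  have h3 : ∀ v, radMom x ((Submodule.span ℝ {x})ᗮ.reflection v) *
      shellDist M L0 χ Φ l δ Y y x ((Submodule.span ℝ {x})ᗮ.reflection v) =
      -(radMom x v * shellDist M L0 χ Φ l δ Y y x v) := by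
    intro v
    simp only [shellDist_eq, radMom, angMom_eq, hin, LinearIsometryEquiv.norm_map, neg_sq]
    ring
  have h4 : ∫ v, -(radMom x v * shellDist M L0 χ Φ l δ Y y x v) =
      ∫ v, radMom x v * shellDist M L0 χ Φ l δ Y y x v := by
    rw [← h2]
    exact integral_congr_ae (ae_of_all _ fun v => (h3 v).symm)
  rw [integral_neg] at h4
  linarith

theorem shellDist_nonneg (h : ShellData M L0 E0 η0 χ Φ l δ C) (x v : E3) :
    0 ≤ shellDist M L0 χ Φ l δ Y y x v := by
  rw [shellDist_eq]
  exact mul_nonneg (mul_nonneg h.δ_nonneg (h.χ_nonneg _))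
    (mul_nonneg (h.profile.nonneg _) (posPow_nonneg _ _))

/-- Where the ansatz function `φ(E, L)` is non-zero. -/
theorem mem_shell_of_eos_ne_zero (h : ShellData M L0 E0 η0 χ Φ l δ C)
    (hs : IsShellSolution M L0 E0 χ Φ l δ y) {x v : E3} (hx : sCrit M L0 ≤ ‖x‖)
    (hne : Φ (1 - Real.exp (-y ‖x‖) * Real.sqrt (1 + ‖v‖ ^ 2)) * posPow (angMom x v - L0) l ≠ 0) :
    ‖x‖ ∈ Ioo (rMinus M E0 L0) (rPlus M E0 L0) ∧
      Real.exp (-y ‖x‖) * Real.sqrt (1 + ‖v‖ ^ 2) < 1 := by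
  have hr2 : 2 * M < ‖x‖ := h.sCrit_gt.trans_le hx
  have hr : 0 < ‖x‖ := by linarith [h.M_pos]
  have h1 : Real.exp (-y ‖x‖) * Real.sqrt (1 + ‖v‖ ^ 2) < 1 := by
    by_contra! hle
    exact hne (by rw [h.profile.zero _ (by linarith), zero_mul])
  have h2 : L0 < angMom x v := by
    by_contra! hle
    exact hne (by rw [posPow_of_nonpos (by linarith), mul_zero])
  refine ⟨?_, h1⟩
  by_contra hout
  have h3 := h.one_le_of_le_yVac hr2 (hs.le_yVac _ hr2) (h.le_effPot hx hout)
  -- From `L₀ < L ≤ r²|v|²`. Outside the shell this already forces `E ≥ E_cut`, against `Φ ≠ 0`.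
  have h4 : L0 / ‖x‖ ^ 2 ≤ ‖v‖ ^ 2 := by
    rw [div_le_iff₀ (by positivity)]
    rw [angMom_eq] at h2
    nlinarith [sq_nonneg (inner ℝ x v)]
  have h5 : Real.sqrt (1 + L0 / ‖x‖ ^ 2) ≤ Real.sqrt (1 + ‖v‖ ^ 2) := Real.sqrt_le_sqrt (by linarith)
  have h6 := mul_le_mul_of_nonneg_left h5 (Real.exp_pos (-y ‖x‖)).le
  linarith

theorem mem_shell_of_ne_zero (h : ShellData M L0 E0 η0 χ Φ l δ C)
    (hs : IsShellSolution M L0 E0 χ Φ l δ y) {x v : E3}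
    (hne : shellDist M L0 χ Φ l δ Y y x v ≠ 0) :
    ‖x‖ ∈ Ioo (rMinus M E0 L0) (rPlus M E0 L0) ∧
      Real.exp (-y ‖x‖) * Real.sqrt (1 + ‖v‖ ^ 2) < 1 := by
  rw [shellDist_eq] at hne
  refine h.mem_shell_of_eos_ne_zero hs ?_ (right_ne_zero_of_mul hne)
  by_contra! hlt
  exact left_ne_zero_of_mul hne (by rw [h.χ_zero _ (by linarith), mul_zero])

theorem shellDist_eq_of_pos (h : ShellData M L0 E0 η0 χ Φ l δ C)
    (hs : IsShellSolution M L0 E0 χ Φ l δ y) {x v : E3}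
    (hpos : 0 < shellDist M L0 χ Φ l δ Y y x v) :
    shellDist M L0 χ Φ l δ Y y x v = δ * eos Φ l L0 (Real.exp Y)
      (energy (muOf (Real.exp Y) y) x v) (angMom x v) := by
  have hx := (h.mem_shell_of_ne_zero hs hpos.ne').1
  have hχ : χ (‖x‖ - sCrit M L0) = 1 := h.χ_one _ (by linarith [h.η0_lt, hx.1])
  rw [shellDist, ansatz, hχ, mul_one]

/-- Radii are confined to the shell, and `E < E_cut` means `√(1 + |v|²) < e^{y(r)}`, which is
bounded there. An explicit compact set away from `r = 2M` also controls the closure of the support.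
-/
theorem exists_compact_support (h : ShellData M L0 E0 η0 χ Φ l δ C)
    (hs : IsShellSolution M L0 E0 χ Φ l δ y) :
    ∃ K : Set (E3 × E3), IsCompact K ∧ (∀ z ∈ K, 2 * M < ‖z.1‖) ∧
      ∀ z, z ∉ K → Function.uncurry (shellDist M L0 χ Φ l δ Y y) z = 0 := by
  have hyc : ContinuousOn y (Icc (rMinus M E0 L0) (rPlus M E0 L0)) :=
    hs.solves.1.continuousOn.mono fun r hr => h.rMinus_gt.trans_le hr.1
  obtain ⟨B, hB⟩ := isCompact_Icc.exists_bound_of_continuousOn hyc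
  refine ⟨(Metric.closedBall 0 (rPlus M E0 L0) \ Metric.ball 0 (rMinus M E0 L0)) ×ˢ
    Metric.closedBall 0 (Real.exp B), ((isCompact_closedBall _ _).diff Metric.isOpen_ball).prod
      (isCompact_closedBall _ _), fun z hz => ?_, fun z hz => ?_⟩
  · have := hz.1.2
    rw [mem_ball_zero_iff, not_lt] at this
    exact h.rMinus_gt.trans_le this
  · by_contra hne
    obtain ⟨h1, h2⟩ := h.mem_shell_of_ne_zero hs hne
    refine hz ⟨⟨?_, ?_⟩, ?_⟩
    · rw [mem_closedBall_zero_iff]; exact h1.2.le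
    · rw [mem_ball_zero_iff]; exact not_lt.2 h1.1.le
    · rw [mem_closedBall_zero_iff]
      have h3 : y ‖z.1‖ ≤ B := (le_abs_self _).trans (hB _ (Ioo_subset_Icc_self h1))
      have h4 : ‖z.2‖ ≤ Real.sqrt (1 + ‖z.2‖ ^ 2) := Real.le_sqrt_of_sq_le (by linarith)
      have h5 : Real.exp (-y ‖z.1‖) * Real.exp (y ‖z.1‖) = 1 := by rw [← Real.exp_add]; simp
      have h6 := mul_lt_mul_of_pos_right h2 (Real.exp_pos (y ‖z.1‖))
      have h7 := Real.exp_le_exp.2 h3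
      have h8 : Real.exp (-y ‖z.1‖) * Real.sqrt (1 + ‖z.2‖ ^ 2) * Real.exp (y ‖z.1‖) =
          Real.sqrt (1 + ‖z.2‖ ^ 2) := by linear_combination Real.sqrt (1 + ‖z.2‖ ^ 2) * h5
      linarith

end ShellData

end

section

/-! ### Conservation of energy and angular momentum along characteristics -/

theorem eq_of_hasDerivWithinAt_zero_Icc {f : ℝ → ℝ} {a b : ℝ} (hab : a ≤ b)
    (hf : ∀ t ∈ Icc a b, HasDerivWithinAt f 0 (Icc a b) t) {t : ℝ} (ht : t ∈ Icc a b) :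
    f t = f a :=
  eqOn_of_hasDerivWithinAt_Icc (f' := fun _ => 0) (g := fun _ => f a) hf
    (fun _ _ => hasDerivWithinAt_const _ _ _) ⟨le_rfl, hab⟩ rfl ht

section Characteristics

variable {M a b : ℝ} {mu lam : ℝ → ℝ} {X V : ℝ → E3}

/-- `X'` is parallel to `V` and `V'` to `X`, so the terms in the derivative of `|X|²|V|² - (X·V)²`
cancel. -/
theorem IsCharacteristic.angMom_eq_initial (hab : a ≤ b) (h : IsCharacteristic M mu lam a b X V)
    {t : ℝ} (ht : t ∈ Icc a b) : angMom (X t) (V t) = angMom (X a) (V a) := by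
  refine eq_of_hasDerivWithinAt_zero_Icc (f := fun t => angMom (X t) (V t)) hab (fun t ht => ?_) ht
  obtain ⟨-, hX, hV⟩ := h t ht
  simp only [angMom_eq]
  have h1 := (hX.norm_sq.mul hV.norm_sq).sub ((hX.inner ℝ hV).pow 2)
  refine h1.congr_deriv ?_
  simp only [inner_smul_right, inner_smul_left, inner_neg_right, real_inner_self_eq_norm_sq,
    real_inner_comm (X t) (V t), RCLike.conj_to_real]
  push_cast
  ring

theorem IsCharacteristic.energy_eq_initial (hM : 0 < M) (hab : a ≤ b)
    (hmu : DifferentiableOn ℝ mu (Ioi (2 * M))) (h : IsCharacteristic M mu lam a b X V)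
    {t : ℝ} (ht : t ∈ Icc a b) : energy mu (X t) (V t) = energy mu (X a) (V a) := by
  refine eq_of_hasDerivWithinAt_zero_Icc (f := fun t => energy mu (X t) (V t)) hab
    (fun t ht => ?_) ht
  obtain ⟨hr, hX, hV⟩ := h t ht
  have hr0 : 0 < ‖X t‖ := by linarith
  have hu : 0 < Real.sqrt (1 + ‖V t‖ ^ 2) := Real.sqrt_pos.2 (by positivity)
  have hN : HasDerivWithinAt (fun t => ‖X t‖) (inner ℝ (X t)
      ((Real.exp (mu ‖X t‖ - lam ‖X t‖) / Real.sqrt (1 + ‖V t‖ ^ 2)) • V t) / ‖X t‖)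
      (Icc a b) t := by
    have h1 := hX.norm_sq.sqrt (by positivity)
    simp only [Real.sqrt_sq (norm_nonneg _)] at h1
    refine h1.congr_deriv ?_
    field_simp
  have hd : HasDerivAt mu (deriv mu ‖X t‖) ‖X t‖ :=
    ((hmu _ hr).differentiableAt (Ioi_mem_nhds hr)).hasDerivAt
  have hE := (hd.comp_hasDerivWithinAt t hN).exp
  have hS := (hV.norm_sq.const_add 1).sqrt (by positivity)
  have hES := hE.mul hS
  simp only [Function.comp_apply] at hES
  refine HasDerivWithinAt.congr_deriv (f := fun t => energy mu (X t) (V t)) hES ?_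
  simp only [inner_smul_right, inner_neg_right, real_inner_comm (X t) (V t)]
  field_simp
  ring

end Characteristics

/-! ### The static solution -/

namespace ShellData

variable {M L0 E0 η0 : ℝ} {χ Φ : ℝ → ℝ} {l δ C Y : ℝ} {y : ℝ → ℝ}

/-- The factor `φ` is conserved with value `κ`. If `κ ≠ 0`, the radius can never lie in `[s_{L₀}⁰,
R_min]`, so by continuity it stays on one side: below, `χ = 0` throughout; above, `χ = 1` at both
ends. -/
theorem shellDist_characteristic (h : ShellData M L0 E0 η0 χ Φ l δ C)
    (hs : IsShellSolution M L0 E0 χ Φ l δ y) {lam : ℝ → ℝ} {a b : ℝ} {X V : ℝ → E3} (hab : a ≤ b)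
    (hchar : IsCharacteristic M (muOf (Real.exp Y) y) lam a b X V) :
    shellDist M L0 χ Φ l δ Y y (X b) (V b) = shellDist M L0 χ Φ l δ Y y (X a) (V a) := by
  have hmu : DifferentiableOn ℝ (muOf (Real.exp Y) y) (Ioi (2 * M)) := fun r hr =>
    ((h.hasDerivAt_yDer hs hr).const_sub _).differentiableAt.differentiableWithinAt
  have hL : ∀ t ∈ Icc a b, angMom (X t) (V t) = angMom (X a) (V a) := fun t ht =>
    hchar.angMom_eq_initial hab ht
  have hE : ∀ t ∈ Icc a b, Real.exp (-y ‖X t‖) * Real.sqrt (1 + ‖V t‖ ^ 2) =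
      Real.exp (-y ‖X a‖) * Real.sqrt (1 + ‖V a‖ ^ 2) := fun t ht => by
    rw [← energy_div Y y, ← energy_div Y y, hchar.energy_eq_initial h.M_pos hab hmu ht]
  set κ := Φ (1 - Real.exp (-y ‖X a‖) * Real.sqrt (1 + ‖V a‖ ^ 2)) *
    posPow (angMom (X a) (V a) - L0) l with hκ
  have hcons : ∀ t ∈ Icc a b, Φ (1 - Real.exp (-y ‖X t‖) * Real.sqrt (1 + ‖V t‖ ^ 2)) *
      posPow (angMom (X t) (V t) - L0) l = κ := fun t ht => by rw [hL t ht, hE t ht]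
  have ha : a ∈ Icc a b := ⟨le_rfl, hab⟩
  have hb : b ∈ Icc a b := ⟨hab, le_rfl⟩
  rw [shellDist_eq, shellDist_eq, hcons a ha, hcons b hb]
  rcases eq_or_ne κ 0 with hz | hnz
  · rw [hz, mul_zero, mul_zero]
  have hout : ∀ t ∈ Icc a b, sCrit M L0 ≤ ‖X t‖ → rMinus M E0 L0 < ‖X t‖ := fun t ht hst =>
    (h.mem_shell_of_eos_ne_zero hs hst (by rw [hcons t ht]; exact hnz)).1.1
  have hXc : ContinuousOn (fun t => ‖X t‖) (Icc a b) := fun t ht =>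
    (hchar t ht).2.1.continuousWithinAt.norm
  have hne : ∀ t ∈ Icc a b, ‖X t‖ ≠ sCrit M L0 := fun t ht heq => by
    have := hout t ht heq.ge
    linarith [h.sCrit_lt]
  have hiff : ‖X a‖ < sCrit M L0 ↔ ‖X b‖ < sCrit M L0 := by
    constructor
    · intro h1
      by_contra! h2
      obtain ⟨t, ht, hts⟩ := intermediate_value_Icc hab hXc ⟨h1.le, h2⟩
      exact hne t ht hts
    · intro h1
      by_contra! h2
      obtain ⟨t, ht, hts⟩ := intermediate_value_Icc' hab hXc ⟨h1.le, h2⟩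
      exact hne t ht hts
  have hχ : χ (‖X b‖ - sCrit M L0) = χ (‖X a‖ - sCrit M L0) := by
    rcases lt_or_ge (‖X a‖) (sCrit M L0) with h1 | h1
    · have h2 := hiff.1 h1
      rw [h.χ_zero _ (by linarith), h.χ_zero _ (by linarith)]
    · have h2 : sCrit M L0 ≤ ‖X b‖ := not_lt.1 fun h3 => absurd (hiff.2 h3) (not_lt.2 h1)
      have h3 := hout a ha h1
      have h4 := hout b hb h2
      have h5 := h.η0_lt
      rw [h.χ_one _ (by linarith), h.χ_one _ (by linarith)]
  rw [hχ]

theorem one_sub_eq_denom_div {r : ℝ} (hr : r ≠ 0) :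
    1 - 2 / r * (M + mRed M χ Φ l L0 δ y r) = denom M χ Φ l L0 δ y r / r := by
  unfold denom
  field_simp

theorem exp_neg_two_lam (h : ShellData M L0 E0 η0 χ Φ l δ C)
    (hs : IsShellSolution M L0 E0 χ Φ l δ y) {r : ℝ} (hr : 2 * M < r) :
    Real.exp (-2 * lamOf M (mRed M χ Φ l L0 δ y) r) = denom M χ Φ l L0 δ y r / r := by
  have hr0 : 0 < r := by linarith [h.M_pos]
  have hD := denom_pos hs hr
  rw [lamOf, one_sub_eq_denom_div hr0.ne',
    show -2 * (-(1 / 2) * Real.log (denom M χ Φ l L0 δ y r / r)) =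
      Real.log (denom M χ Φ l L0 δ y r / r) by ring, Real.exp_log (by positivity)]

/-- The derivative of `λ`. -/
def lamDer (M : ℝ) (χ Φ : ℝ → ℝ) (l L0 δ : ℝ) (y : ℝ → ℝ) (r : ℝ) : ℝ :=
  -(1 / 2) * ((1 - 8 * Real.pi * r ^ 2 * rhoRed M χ Φ l L0 δ y r) / denom M χ Φ l L0 δ y r - 1 / r)

theorem hasDerivAt_lam (h : ShellData M L0 E0 η0 χ Φ l δ C)
    (hs : IsShellSolution M L0 E0 χ Φ l δ y) {r : ℝ} (hr : 2 * M < r) :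
    HasDerivAt (lamOf M (mRed M χ Φ l L0 δ y)) (lamDer M χ Φ l L0 δ y r) r := by
  have hr0 : 0 < r := by linarith [h.M_pos]
  have hD := denom_pos hs hr
  have h1 := (((h.hasDerivAt_denom hs hr).div (hasDerivAt_id r) hr0.ne').log
    (div_pos hD hr0).ne').const_mul (-(1 / 2))
  have heq : lamOf M (mRed M χ Φ l L0 δ y) =ᶠ[𝓝 r]
      fun x => -(1 / 2) * Real.log (denom M χ Φ l L0 δ y x / x) := by
    filter_upwards [Ioi_mem_nhds hr0] with x hx
    rw [lamOf, one_sub_eq_denom_div (ne_of_gt hx)]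
  refine HasDerivAt.congr_of_eventuallyEq (h1.congr_deriv ?_) heq
  simp only [lamDer, id, Pi.div_apply]
  field_simp

theorem contDiffOn_lam (h : ShellData M L0 E0 η0 χ Φ l δ C)
    (hs : IsShellSolution M L0 E0 χ Φ l δ y) :
    ContDiffOn ℝ 1 (lamOf M (mRed M χ Φ l L0 δ y)) (Ioi (2 * M)) := by
  refine contDiffOn_one_of_hasDerivAt isOpen_Ioi (fun r hr => h.hasDerivAt_lam hs hr) ?_
  have hpos : ∀ r ∈ Ioi (2 * M), (0 : ℝ) < r := fun r hr => by
    have : 2 * M < r := hr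
    linarith [h.M_pos]
  have hρ := h.continuousOn_rhoRed hpos hs.solves.1.continuousOn
  have hD : ContinuousOn (denom M χ Φ l L0 δ y) (Ioi (2 * M)) := fun r hr =>
    (h.hasDerivAt_denom hs hr).continuousAt.continuousWithinAt
  unfold lamDer
  refine continuousOn_const.mul (ContinuousOn.sub (ContinuousOn.div (by fun_prop) hD
    fun r hr => (denom_pos hs hr).ne') ?_)
  exact continuousOn_const.div continuousOn_id fun r hr => (hpos r hr).ne'

theorem hasDerivAt_mu (h : ShellData M L0 E0 η0 χ Φ l δ C)
    (hs : IsShellSolution M L0 E0 χ Φ l δ y) {r : ℝ} (hr : 2 * M < r) :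
    HasDerivAt (muOf (Real.exp Y) y) (-yDer M χ Φ l L0 δ y r) r :=
  (h.hasDerivAt_yDer hs hr).const_sub _

theorem deriv_deriv_mu (h : ShellData M L0 E0 η0 χ Φ l δ C)
    (hs : IsShellSolution M L0 E0 χ Φ l δ y) {r : ℝ} (hr : 2 * M < r) :
    deriv (deriv (muOf (Real.exp Y) y)) r = -yDer2 M χ Φ l L0 δ y r := by
  have heq : deriv (muOf (Real.exp Y) y) =ᶠ[𝓝 r] fun x => -yDer M χ Φ l L0 δ y x := by
    filter_upwards [Ioi_mem_nhds hr] with x hx using (h.hasDerivAt_mu hs hx).deriv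
  rw [heq.deriv_eq]
  exact (h.hasDerivAt_yDer2 hs hr).neg.deriv

theorem norm_axisPt {s : ℝ} (hs : 0 ≤ s) : ‖axisPt s‖ = s := by
  simp [axisPt, abs_of_nonneg hs]

theorem ne_zero_of_lt_norm (h : ShellData M L0 E0 η0 χ Φ l δ C) {x : E3} (hx : 2 * M < ‖x‖) :
    x ≠ 0 := norm_pos_iff.1 (by linarith [h.M_pos])

theorem isStaticSolution (h : ShellData M L0 E0 η0 χ Φ l δ C)
    (hs : IsShellSolution M L0 E0 χ Φ l δ y) (hY : Tendsto y atTop (𝓝 Y)) :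
    IsStaticSolution M (shellDist M L0 χ Φ l δ Y y) (muOf (Real.exp Y) y)
      (lamOf M (mRed M χ Φ l L0 δ y)) := by
  have hM := h.M_pos
  obtain ⟨K, hK, hKM, hKz⟩ := h.exists_compact_support (Y := Y) hs
  have hρ0 := h.rhoRed_eq_zero_of_le hs
  refine
    { nonneg := h.shellDist_nonneg
      symm := fun A _ x v _ => ?_
      compactSupport := HasCompactSupport.intro hK hKz
      support_subset := ?_
      integrable := fun x hx => h.integrable_shellDist (h.ne_zero_of_lt_norm hx)
      mu_reg := contDiffOn_const.sub (h.contDiffOn_two hs)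
      lam_reg := h.contDiffOn_lam hs
      vlasov := fun a b X V hab hchar => h.shellDist_characteristic hs hab hchar
      field1 := fun x hx => ?_
      field2 := fun x hx => ?_
      field3 := fun x hx => ?_
      field4 := fun x hx => ?_
      untrapped := fun r hr => ?_
      mu_flat := ?_
      lam_flat := ?_
      horizon := ?_ }
  · simp only [shellDist_eq, angMom_eq, A.norm_map, A.inner_map_map]
  · have : tsupport (Function.uncurry (shellDist M L0 χ Φ l δ Y y)) ⊆ K :=
      closure_minimal (fun z hz => by_contra fun hzK => hz (hKz z hzK)) hK.isClosed
    exact fun z hz => hKM z (this hz)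
  · have hr0 : 0 < ‖x‖ := by linarith
    have hD := denom_pos hs hx
    rw [h.exp_neg_two_lam hs hx, (h.hasDerivAt_lam hs hx).deriv,
      h.rhoOf_shellDist (h.ne_zero_of_lt_norm hx), lamDer]
    field_simp
    ring
  · have hr0 : 0 < ‖x‖ := by linarith
    have hD := denom_pos hs hx
    rw [h.exp_neg_two_lam hs hx, (h.hasDerivAt_mu hs hx).deriv,
      h.pOf_shellDist (h.ne_zero_of_lt_norm hx), yDer]
    field_simp
    ring
  · rw [jOf_shellDist, mul_zero]
  -- After inserting `p'` from the Tolman–Oppenheimer–Volkoff equation this is a rational identity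
  -- in `D`, `p`, `ρ`, `q` and `r`.
  · have hr0 : 0 < ‖x‖ := by linarith
    have hD := denom_pos hs hx
    rw [h.exp_neg_two_lam hs hx, (h.hasDerivAt_mu hs hx).deriv, h.deriv_deriv_mu hs hx,
      (h.hasDerivAt_lam hs hx).deriv, h.qOf_shellDist (h.ne_zero_of_lt_norm hx), yDer2, pDer,
      lamDer, yDer]
    generalize denom M χ Φ l L0 δ y ‖x‖ = D at hD ⊢
    generalize pRed M χ Φ l L0 δ y ‖x‖ = p
    generalize rhoRed M χ Φ l L0 δ y ‖x‖ = ρ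
    generalize qAt M χ Φ l L0 δ ‖x‖ (y ‖x‖) = q
    generalize ‖x‖ = r at hr0 ⊢
    field_simp
    ring
  · have : ∫ s in (2 * M)..r, rhoOf (shellDist M L0 χ Φ l δ Y y) (axisPt s) * s ^ 2 =
        ∫ s in (2 * M)..r, s ^ 2 * rhoRed M χ Φ l L0 δ y s := by
      refine intervalIntegral.integral_congr_Ioo_of_le hr.le fun s hs' => ?_
      have hs0 : 0 < s := by linarith [hs'.1]
      have hn := norm_axisPt hs0.le
      rw [h.rhoOf_shellDist (h.ne_zero_of_lt_norm (by rw [hn]; exact hs'.1)), hn, mul_comm]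
    have h1 := hs.untrapped r hr
    rw [mRed] at h1
    rw [this]
    linarith
  · have := hY.const_sub Y
    rw [sub_self] at this
    refine this.congr fun r => ?_
    rw [muOf, Real.log_exp]
  · have h1 := (tendsto_log_mass_ratio (M + mRed M χ Φ l L0 δ y (rPlus M E0 L0))).neg
    rw [neg_zero] at h1
    refine h1.congr' ?_
    filter_upwards [eventually_ge_atTop (rPlus M E0 L0)] with r hr
    rw [lamOf, h.mRed_of_rPlus_le hs hr]
    ring
  -- On `]2M, 4M]` the mass `m` is zero, so `e^{-2λ}` is exactly `(r - 2M)/r`.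
  · have h1 : Tendsto (fun r : ℝ => (r - 2 * M) / r) (𝓝[>] (2 * M)) (𝓝 0) := by
      have : ContinuousAt (fun r : ℝ => (r - 2 * M) / r) (2 * M) :=
        (continuousAt_id.sub continuousAt_const).div continuousAt_id (by simp [hM.ne'])
      have h2 := this.tendsto.mono_left (nhdsWithin_le_nhds (s := Ioi (2 * M)))
      simpa using h2
    refine h1.congr' ?_
    filter_upwards [Ioc_mem_nhdsGT (show 2 * M < 4 * M by linarith)] with r hr
    rw [h.exp_neg_two_lam hs hr.1, denom, mRed_eq_zero hρ0 hr, add_zero]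

end ShellData

end

end EVShell

end

open MeasureTheory Filter Topology Set EVShell in
theorem mainTheorem3
    (M : ℝ) (hM : 0 < M)
    (L0 : ℝ) (hL0 : 12 * M ^ 2 < L0)
    (E0 : ℝ) (hE0 : effPot M L0 (rCrit M L0) < E0)
    (hE0' : E0 < min 1 (effPot M L0 (sCrit M L0)))
    (η0 : ℝ) (hη0 : 0 < η0) (hη0' : sCrit M L0 + η0 < rMinus M E0 L0)
    (χ : ℝ → ℝ) (hχ : ContDiff ℝ (⊤ : ℕ∞) χ) (hχ_nonneg : ∀ s, 0 ≤ χ s)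
    (hχ_zero : ∀ s, s ≤ 0 → χ s = 0) (hχ_one : ∀ s, η0 ≤ s → χ s = 1)
    (l : ℝ) (hl : -(1 / 2) < l)
    (Φ : ℝ → ℝ) (hΦ_nonneg : ∀ α, 0 ≤ Φ α)
    (hΦ_loc : ∀ K : Set ℝ, IsCompact K → MemLp Φ ⊤ (volume.restrict K))
    (hΦ_zero : ∀ α, α ≤ 0 → Φ α = 0)
    (hΦ_pos : ∃ α0 : ℝ, 0 < α0 ∧ ∀ α ∈ Ioo 0 α0, 0 < Φ α)
    (δ : ℝ) (hδ : 0 ≤ δ) :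
    -- the radii used in the choice of the parameters are as intended
    (critSet M L0 = {sCrit M L0, rCrit M L0} ∧ 2 * M < sCrit M L0 ∧
      levelSet M E0 L0 = {rMinus M E0 L0, rPlus M E0 L0} ∧
      sCrit M L0 < rMinus M E0 L0 ∧ rMinus M E0 L0 < rCrit M L0 ∧
      rCrit M L0 < rPlus M E0 L0 ∧ 4 * M < rMinus M E0 L0) ∧
    ∃ y : ℝ → ℝ,
      -- existence
      IsReducedSolution M χ Φ l L0 E0 δ y ∧
      -- uniqueness among the solutions without matter in `]2M, 4M]`
      (∀ z : ℝ → ℝ, IsReducedSolution M χ Φ l L0 E0 δ z →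
        (∀ r ∈ Ioc (2 * M) (4 * M), rhoRed M χ Φ l L0 δ z r = 0) →
        EqOn z y (Ioi (2 * M))) ∧
      -- unrestricted uniqueness if `L₀ ≤ 16M²`
      (L0 ≤ 16 * M ^ 2 → ∀ z : ℝ → ℝ, IsReducedSolution M χ Φ l L0 E0 δ z →
        EqOn z y (Ioi (2 * M))) ∧
      -- properties of the solution
      (∀ r, 2 * M < r → 2 * (M + mRed M χ Φ l L0 δ y r) < r) ∧
      (∀ r, 2 * M < r → y r ≤ yVac M E0 r) ∧
      (∀ r ∈ Ioc (2 * M) (rMinus M E0 L0), y r = yVac M E0 r) ∧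
      (0 < δ → (∃ r, 2 * M < r ∧ rhoRed M χ Φ l L0 δ y r ≠ 0) ∧
        (∃ r, 2 * M < r ∧ pRed M χ Φ l L0 δ y r ≠ 0)) ∧
      (∀ r ∈ Ioc (2 * M) (rMinus M E0 L0) ∪ Ici (rPlus M E0 L0),
        rhoRed M χ Φ l L0 δ y r = 0 ∧ pRed M χ Φ l L0 δ y r = 0) ∧
      ∃ yInf Mδ : ℝ,
        Tendsto y atTop (𝓝 yInf) ∧ yInf < 0 ∧
        -- the total Vlasov mass is finite
        IntegrableOn (fun r => r ^ 2 * rhoRed M χ Φ l L0 δ y r) (Ioi (2 * M)) ∧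
        Tendsto (mRed M χ Φ l L0 δ y) atTop (𝓝 Mδ) ∧
        Mδ = 4 * Real.pi * (∫ s in (rMinus M E0 L0)..(rPlus M E0 L0),
          s ^ 2 * rhoRed M χ Φ l L0 δ y s) ∧
        2 * (M + Mδ) < rPlus M E0 L0 ∧
        yInf = y (rPlus M E0 L0) +
          1 / 2 * Real.log (1 - 2 / rPlus M E0 L0 * (M + Mδ)) ∧
        -- the resulting static solution of the Einstein–Vlasov system
        ∃ (Ecut : ℝ) (mu lam : ℝ → ℝ) (f : E3 → E3 → ℝ),
          Ecut = Real.exp yInf ∧ Ecut ∈ Ioo (0 : ℝ) 1 ∧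
          mu = muOf Ecut y ∧
          lam = lamOf M (mRed M χ Φ l L0 δ y) ∧
          f = ansatz M χ Φ l L0 δ Ecut mu ∧
          IsStaticSolution M f mu lam ∧
          (∀ x : E3, 2 * M < ‖x‖ →
            rhoOf f x = rhoRed M χ Φ l L0 δ y ‖x‖ ∧ pOf f x = pRed M χ Φ l L0 δ y ‖x‖) ∧
          (∀ x v : E3, 0 < f x v →
            f x v = δ * eos Φ l L0 Ecut (energy mu x v) (angMom x v)) ∧
          (∀ x v : E3, f x v ≠ 0 → ‖x‖ ∈ Icc (rMinus M E0 L0) (rPlus M E0 L0)) := by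
  obtain ⟨C, hΦ⟩ := exists_isProfile hΦ_nonneg hΦ_loc hΦ_zero hΦ_pos
  have h : ShellData M L0 E0 η0 χ Φ l δ C := ⟨hM, hL0, hE0, hE0', hη0, hη0', hχ, hχ_nonneg, hχ_zero,
    hχ_one, hl, hΦ, hδ⟩
  obtain ⟨c1, -, -, -, c2⟩ := crit_spec hM hL0
  obtain ⟨l1, l2, l3, l4, -, -⟩ := level_spec hM hL0 hE0 hE0'
  refine ⟨⟨c2, c1, l1, l2, l3, l4, h.four_mul_lt⟩, ?_⟩
  obtain ⟨y, hs⟩ := h.exists_isShellSolution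
  have hρ0 := h.rhoRed_eq_zero_of_le hs
  refine ⟨y, hs.solves, fun z hz hzρ => h.solution_unique hs.solves hρ0 hz hzρ,
    fun hL z hz => h.solution_unique hs.solves hρ0 hz fun r hr =>
      h.rhoRed_eq_zero_of_L0_le hL z hr,
    hs.untrapped, hs.le_yVac, hs.eq_yVac,
    fun hδ0 => ⟨h.exists_rhoRed_ne_zero hδ0 hs, h.exists_pRed_ne_zero hδ0 hs⟩, ?_, ?_⟩
  · rintro r (hr | hr)
    · have hout : r ∉ Ioo (rMinus M E0 L0) (rPlus M E0 L0) := fun hr' => absurd hr'.1 (not_lt.2 hr.2)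
      exact ⟨h.rhoRed_eq_zero hs hr.1 hout, h.pRed_eq_zero hs hr.1 hout⟩
    · have hout : r ∉ Ioo (rMinus M E0 L0) (rPlus M E0 L0) := fun hr' => absurd hr'.2 (not_lt.2 hr)
      have hr2 : 2 * M < r := h.rPlus_gt.trans_le hr
      exact ⟨h.rhoRed_eq_zero hs hr2 hout, h.pRed_eq_zero hs hr2 hout⟩
  · have hlim := h.tendsto_solution hs
    have hneg := h.yLim_neg hs
    refine ⟨ShellData.yLim M L0 E0 χ Φ l δ y, mRed M χ Φ l L0 δ y (rPlus M E0 L0), hlim, hneg,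
      h.integrableOn_massDensity hs, h.tendsto_mRed hs, h.mRed_rPlus hs,
      hs.untrapped _ h.rPlus_gt, rfl, _, _, _, _, rfl,
      ⟨Real.exp_pos _, by rw [← Real.exp_zero]; exact Real.exp_lt_exp.2 hneg⟩, rfl, rfl, rfl, h.isStaticSolution hs hlim,
      fun x hx => ⟨h.rhoOf_shellDist (h.ne_zero_of_lt_norm hx),
        h.pOf_shellDist (h.ne_zero_of_lt_norm hx)⟩,
      fun x v hpos => h.shellDist_eq_of_pos hs hpos,
      fun x v hne => Ioo_subset_Icc_self (h.mem_shell_of_ne_zero hs hne).1⟩
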